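/- Let $P_k$ denote the path on $k$ vertices, let $M_t$ denote the matching consisting of $t$ pairwise disjoint edges (on $2t$ vertices), and let $\mathcal{N}(H,G)$ denote the number of copies of $H$ in $G$, that is, the number of subgraphs of $G$ isomorphic to $H$. Let $\mathrm{ex}(n,H,F)$ denote the maximum of $\mathcal{N}(H,G)$ over all $n$-vertex graphs $G$ that contain no subgraph isomorphic to $F$ (the $F$-free graphs). Theorem. For all integers $k\ge 1$ and $t\ge 0$ there is $n_0=n_0(k,t)$ such that the following holds for all $n\ge n_0$ and all non-negative integers $a,b$ with $n=a(k-1)+b$ and $b<k$. The disjoint union $aK_{k-1}\cup K_b$ of $a$ cliques on $k-1$ vertices and one clique on $b$ vertices is $P_k$-free, and $$\mathrm{ex}(n,M_t,P_k)=\mathcal{N}(M_t,\,aK_{k-1}\cup K_b).$$ -/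

import Mathlib

/-- The disjoint union `mG` of `m` copies of the graph `G`. -/
def disjointCopies {V : Type*} (m : ℕ) (G : SimpleGraph V) : SimpleGraph (Fin m × V) where
  Adj x y := x.1 = y.1 ∧ G.Adj x.2 y.2
  symm := ⟨fun _ _ h => ⟨h.1.symm, h.2.symm⟩⟩
  loopless := ⟨fun _ h => h.2.ne rfl⟩

/-- The matching `M_t`: the disjoint union of `t` copies of `K_2`. -/
def matchingGraph (t : ℕ) : SimpleGraph (Fin t × Fin 2) :=
  disjointCopies t (⊤ : SimpleGraph (Fin 2))

/-- The graph `aK_s ∪ K_b`: the disjoint union of `a` cliques on `s` vertices and one clique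
on `b` vertices. -/
def cliqueUnion (a s b : ℕ) : SimpleGraph ((Fin a × Fin s) ⊕ Fin b) :=
  (disjointCopies a (⊤ : SimpleGraph (Fin s))).sum (⊤ : SimpleGraph (Fin b))

open Classical in
/-- The generalized Turán number `ex(n, H, F)`: the largest number of copies of `H` (that is,
of subgraphs isomorphic to `H`) in an `F`-free graph on `n` vertices. -/
noncomputable def generalizedTuranNumber {V W : Type*} (n : ℕ) (H : SimpleGraph V)
    (F : SimpleGraph W) : ℕ :=
  (Finset.univ.filter fun G : SimpleGraph (Fin n) => F.Free G).sup fun G => G.copyCount H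

/-! Put s = k - 1 and let m_i(G) be the number of matchings of G with i edges. The generating
function of the m_i is multiplicative over disjoint unions, so components can be treated one at a
time. For fixed t and large n, m_t is governed first by m_1 and then by m_2, where 2 m_2 = m_1 (m_1
+ 1) - Σ d(v)^2: among graphs with equally many edges, a larger sum of squared degrees costs
matchings.

Kopylov's method shows that, for s ≥ 2, a connected graph on n > s vertices without a path on s + 1
vertices has fewer edges than the union of cliques, unless s = 2h + 1, n mod s is h or h + 1, and
the graph is K_h joined to n - h independent vertices. In that case the edge numbers agree, but for
h ≥ 2 the sum of squared degrees is larger, and for h = 1 the graph is a star, which has no two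
disjoint edges. Merging leftover cliques does no harm either, so every graph without such a path is
at most the union of cliques in the sense of `LexLE` (`NoPath.lexLE_cliqueSeries`).

To reach m_t, split off the components equal to K_s, say a of them, and let R be the rest. If R is
bounded, then a is large, each coefficient of the generating function of aK_s dwarfs the preceding
ones, and the first strict difference decides (`coeff_mul_le_of_lex`). If R is large, then by
`exists_preconnected_trichotomy` each of its components has an edge deficit proportional to its
order or a large second moment of degrees: once the vertices of large degree are removed, all paths
on s vertices lie in one component of bounded size, and the Erdős–Gallai bound for s - 1 applies to
what remains. Whichever kind covers at least half of R, its loss outweighs the error in m_i ≈ m_1^i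
/ i!, which is a bounded shift of m_1 (`numMatchings_le_coeff_cliqueSeries`). The case k ≤ 2 is
trivial. -/

section

open scoped Classical

/-! ### Paths as vertex lists and counting along them -/

section
namespace SimpleGraph

variable {V : Type*} {G : SimpleGraph V}

/-- `G` has no path on `N` or more vertices; paths are given by the lists of their vertices. -/
def NoPath (G : SimpleGraph V) (N : ℕ) : Prop :=
  ∀ l : List V, l.Nodup → l.IsChain G.Adj → l.length < N

lemma exists_last_split {α : Type*} (P : α → Prop) (l : List α) (h : ∃ x ∈ l, P x) :
    ∃ l₁ a l₂, l = l₁ ++ a :: l₂ ∧ P a ∧ ∀ x ∈ l₂, ¬ P x := by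
  induction l with
  | nil => simp at h
  | cons b l ih =>
    by_cases h' : ∃ x ∈ l, P x
    · obtain ⟨l₁, a, l₂, rfl, h₁, h₂⟩ := ih h'
      exact ⟨b :: l₁, a, l₂, rfl, h₁, h₂⟩
    · exact ⟨[], b, l, rfl, by grind, by grind⟩

lemma exists_first_split {α : Type*} (P : α → Prop) (l : List α) (h : ∃ x ∈ l, P x) :
    ∃ l₁ a l₂, l = l₁ ++ a :: l₂ ∧ P a ∧ ∀ x ∈ l₁, ¬ P x := by
  induction l with
  | nil => simp at h
  | cons b l ih =>
    by_cases h' : P b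
    · exact ⟨[], b, l, rfl, h', by simp⟩
    · obtain ⟨l₁, a, l₂, rfl, h₁, h₂⟩ := ih (by grind)
      exact ⟨b :: l₁, a, l₂, rfl, h₁, by grind⟩

lemma isChain_join {u w : V} {l l' : List V} (h : (u :: l).IsChain G.Adj)
    (h' : (w :: l').IsChain G.Adj) (huw : G.Adj u w) :
    (l.reverse ++ u :: w :: l').IsChain G.Adj := by
  have h₁ : (l.reverse ++ [u]).IsChain G.Adj := by
    rw [← List.reverse_cons, List.isChain_reverse]
    exact h.imp fun a b hab => hab.symm
  have := h₁.append h' (by simp; exact huw)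
  simpa using this

lemma isChain_reverse_iff {l : List V} : l.reverse.IsChain G.Adj ↔ l.IsChain G.Adj := by
  rw [List.isChain_reverse]
  exact ⟨fun h => h.imp fun a b hab => hab.symm, fun h => h.imp fun a b hab => hab.symm⟩

/-- If consecutive entries never satisfy `Q` and `P` respectively, then `P` and `Q` are satisfied
rarely. -/
lemma countP_add_countP_le {α : Type*} (P Q : α → Prop) (a : α) (l : List α)
    (h : (a :: l).IsChain fun x y => ¬ (Q x ∧ P y)) :
    l.countP (fun x => P x) + (a :: l).countP (fun x => Q x) ≤
      l.length + (if Q ((a :: l).getLast (by simp)) then 1 else 0) := by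
  induction l generalizing a with
  | nil => by_cases hQ : Q a <;> simp [hQ]
  | cons b l ih =>
    rw [List.isChain_cons_cons] at h
    have := ih b h.2
    rw [List.getLast_cons (by simp)]
    rw [List.countP_cons (a := b), List.countP_cons (a := a)]
    simp only [decide_eq_true_eq, List.length_cons]
    split_ifs at * <;> first | omega | grind

/-- Each consecutive pair (x, y) contributes at most one to the count, through `Q x` or through `P
y`. The pair (b, c) contributes nothing, which saves one against `countP_add_countP_le`. -/
lemma countP_add_countP_le_of_slack {α : Type*} (P Q : α → Prop) (a b c : α) (l : List α)
    (h : (a :: b :: c :: l).IsChain fun x y => ¬ (Q x ∧ P y)) (hc : ¬ P c) (hb : ¬ Q b) :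
    (b :: c :: l).countP (fun x => P x) + (a :: b :: c :: l).countP (fun x => Q x) ≤
      l.length + 1 + (if Q ((a :: b :: c :: l).getLast (by simp)) then 1 else 0) := by
  have h' := countP_add_countP_le P Q c l (by
    rw [List.isChain_cons_cons, List.isChain_cons_cons] at h; exact h.2.2)
  rw [List.isChain_cons_cons] at h
  rw [List.getLast_cons (by simp), List.getLast_cons (by simp)]
  rw [List.countP_cons (a := b), List.countP_cons (a := a), List.countP_cons (a := b)]
  rw [List.countP_cons (a := c) (p := fun x => decide (P x))]
  simp only [decide_eq_true_eq, hc, hb, if_false]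
  split_ifs at * <;> first | omega | grind

/-- In a path starting at `u`, every vertex ends a path inside it which is longer than the number
of neighbours of `u` on the path. -/
lemma exists_path_to (u a : V) (U : List V) (hU : (u :: U).IsChain G.Adj)
    (hn : (u :: U).Nodup) (ha : a ∈ u :: U) :
    ∃ l, (a :: l).IsChain G.Adj ∧ (a :: l).Nodup ∧ a :: l ⊆ u :: U ∧
      (u :: U).countP (fun x => G.Adj u x) ≤ l.length := by
  obtain ⟨U₁, U₂, h⟩ := List.append_of_mem ha
  have hc : ∀ U₁ U₂ : List V, u :: U = U₁ ++ a :: U₂ →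
      (U₁ ++ [a]).countP (fun x => G.Adj u x) ≤ U₁.length := by
    intro U₁ U₂ h
    cases U₁ with
    | nil =>
      obtain ⟨rfl, rfl⟩ : u = a ∧ U = U₂ := by simpa using h
      simp
    | cons b U₁ =>
      obtain ⟨rfl, h⟩ : u = b ∧ U = U₁ ++ a :: U₂ := by simpa using h
      rw [List.cons_append, List.countP_cons]
      have := List.countP_le_length (p := fun x => decide (G.Adj u x)) (l := U₁ ++ [a])
      simpa using this
  have hc := hc U₁ U₂ h
  have hrev : (a :: U₁.reverse).IsChain G.Adj := by
    rw [h] at hU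
    have : (U₁ ++ [a]).IsChain G.Adj := by
      apply List.IsChain.left_of_append (l₂ := U₂); simpa using hU
    simpa using isChain_reverse_iff.2 this
  have hnU : (U₁ ++ a :: U₂).Nodup := h ▸ hn
  -- Go back from `a` to `u`, then jump to the first neighbour of `u` beyond `a` and follow the
  -- path. Apart from nonneighbours of `u`, no vertex is skipped; without such a neighbour the walk
  -- stops at `u`.
  by_cases hex : ∃ x ∈ U₂, G.Adj u x
  · obtain ⟨X, b, Y, rfl, hb, hX⟩ := exists_first_split (fun x => G.Adj u x) U₂ hex
    refine ⟨U₁.reverse ++ b :: Y, ?_, ?_, ?_, ?_⟩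
    · have hY : (b :: Y).IsChain G.Adj := by
        rw [h] at hU
        apply List.IsChain.right_of_append (l₁ := U₁ ++ a :: X); simpa using hU
      have := hrev.append hY
      simp only [List.cons_append] at this
      apply this
      cases U₁ with
      | nil =>
        obtain ⟨rfl, -⟩ : u = a ∧ _ := by simpa using h
        simpa using hb
      | cons c U₁ =>
        obtain ⟨rfl, -⟩ : u = c ∧ _ := by simpa using h
        simpa [List.getLast?_cons] using hb
    · simp [List.nodup_append] at hnU ⊢
      grind
    · rw [h]; simp; grind
    · rw [h]
      have : U₁ ++ a :: (X ++ b :: Y) = (U₁ ++ [a]) ++ (X ++ b :: Y) := by simp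
      rw [this, List.countP_append, List.countP_append (l₁ := X)]
      have h1 : X.countP (fun x => G.Adj u x) = 0 := by
        rw [List.countP_eq_zero]; simpa using hX
      have h2 := List.countP_le_length (p := fun x => decide (G.Adj u x)) (l := b :: Y)
      simp only [List.length_cons, List.length_append, List.length_reverse] at h2 ⊢; omega
  · refine ⟨U₁.reverse, hrev, ?_, ?_, ?_⟩
    · simp [List.nodup_append] at hnU ⊢
      grind
    · rw [h]; simp
    · rw [h]
      have : U₁ ++ a :: U₂ = (U₁ ++ [a]) ++ U₂ := by simp
      rw [this, List.countP_append]
      have h1 : U₂.countP (fun x => G.Adj u x) = 0 := by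
        rw [List.countP_eq_zero]; simpa using hex
      simp only [List.length_reverse]; omega

end SimpleGraph

end

/-! ### Rotations of two disjoint paths -/

section
namespace SimpleGraph

variable {V : Type*} {G : SimpleGraph V}

/-- Two disjoint paths, listed from their ends `u` and `v`. -/
structure TwoPaths (G : SimpleGraph V) (u : V) (U : List V) (v : V) (W : List V) : Prop where
  left : (u :: U).IsChain G.Adj
  right : (v :: W).IsChain G.Adj
  nodup : (u :: U ++ v :: W).Nodup

namespace TwoPaths

variable {u v : V} {U W : List V}

lemma symm (h : TwoPaths G u U v W) : TwoPaths G v W u U :=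
  ⟨h.right, h.left, by
    have := h.nodup
    rw [List.nodup_append] at this ⊢
    exact ⟨this.2.1, this.1, fun a ha b hb => (this.2.2 b hb a ha).symm⟩⟩

end TwoPaths

lemma isChain_of_forall_split {α : Type*} {R : α → α → Prop} (l : List α)
    (h : ∀ l₁ a b l₂, l = l₁ ++ a :: b :: l₂ → R a b) : l.IsChain R := by
  induction l with
  | nil => simp
  | cons a l ih =>
    cases l with
    | nil => simp
    | cons b l =>
      rw [List.isChain_cons_cons]
      exact ⟨h [] a b l rfl, ih fun l₁ c d l₂ e => h (a :: l₁) c d l₂ (by simp [e])⟩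

lemma isChain_reverse_prefix {v a : V} {W S T : List V} (hW : (v :: W).IsChain G.Adj)
    (h : v :: W = S ++ a :: T) : (a :: S.reverse).IsChain G.Adj := by
  rw [h] at hW
  have : (S ++ [a]).IsChain G.Adj := by
    apply List.IsChain.left_of_append (l₂ := T); simpa using hW
  simpa using isChain_reverse_iff.2 this

lemma isChain_rotate {v a b : V} {W S T Y : List V} (hW : (v :: W).IsChain G.Adj)
    (h : v :: W = S ++ a :: T) (hY : (b :: Y).IsChain G.Adj) (hb : G.Adj v b) :
    (a :: (S.reverse ++ b :: Y)).IsChain G.Adj := by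
  have := (isChain_reverse_prefix hW h).append hY
  simp only [List.cons_append] at this
  apply this
  cases S with
  | nil =>
    obtain ⟨rfl, -⟩ : v = a ∧ _ := by simpa using h
    simpa using hb
  | cons c S =>
    obtain ⟨rfl, -⟩ : v = c ∧ _ := by simpa using h
    simpa [List.getLast?_cons] using hb

namespace TwoPaths

variable {u v : V} {U W : List V} {N : ℕ}

lemma not_adj (h : TwoPaths G u U v W) (hN : NoPath G N) (hl : N ≤ U.length + W.length + 2) :
    ¬ G.Adj u v := by
  intro huv
  have := hN _ ?_ (isChain_join h.left h.right huv)
  · simp at this; omega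
  · have := h.nodup
    simp [List.nodup_append] at this ⊢
    grind

/-- A crossing would allow the route along the first path to `u`, then to `a`, back to `v`, over to
`b` and on to the end, which covers both paths. -/
lemma isChain_not_cross (h : TwoPaths G u U v W) (hN : NoPath G N)
    (hl : N ≤ U.length + W.length + 2) :
    (v :: W).IsChain fun a b => ¬ (G.Adj u a ∧ G.Adj v b) := by
  apply isChain_of_forall_split
  rintro S a b T e ⟨hua, hvb⟩
  have hY : (b :: T).IsChain G.Adj := by
    have := h.right
    rw [e] at this
    apply List.IsChain.right_of_append (l₁ := S ++ [a]); simpa using this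
  have := hN _ ?_ (isChain_join h.left (isChain_rotate h.right e hY hvb) hua)
  · have h2 := congrArg List.length e
    simp at this h2; omega
  · have := h.nodup
    rw [e] at this
    simp [List.nodup_append] at this ⊢
    grind

lemma not_adj_getLast (h : TwoPaths G u U v W) (hN : NoPath G N)
    (hl : N ≤ U.length + W.length + 2) : ¬ G.Adj u ((v :: W).getLast (by simp)) := by
  intro hw
  have e : v :: W = (v :: W).dropLast ++ [(v :: W).getLast (by simp)] := by
    rw [List.dropLast_append_getLast]
  have := hN _ ?_ (isChain_join h.left (isChain_reverse_prefix h.right e) hw)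
  · simp at this; omega
  · have := h.nodup
    rw [e] at this
    simp only [List.nodup_append, List.nodup_cons, List.nodup_reverse, List.mem_append,
      List.mem_reverse, List.mem_cons] at this ⊢
    grind

/-- The second path has `W.length` consecutive pairs, each contributing at most one. The last vertex
belongs to no pair as a first entry, but it is not a neighbour of `u`. -/
lemma countP_le (h : TwoPaths G u U v W) (hN : NoPath G N) (hl : N ≤ U.length + W.length + 2) :
    (v :: W).countP (fun x => G.Adj v x) + (v :: W).countP (fun x => G.Adj u x) ≤ W.length := by
  have := countP_add_countP_le (fun x => G.Adj v x) (fun x => G.Adj u x) v W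
    (h.isChain_not_cross hN hl)
  rw [if_neg (h.not_adj_getLast hN hl)] at this
  rw [List.countP_cons (a := v)]
  simpa using this

lemma countP_le_of_slack {b c : V} (h : TwoPaths G u U v (b :: c :: W)) (hN : NoPath G N)
    (hl : N ≤ U.length + W.length + 4) (hc : ¬ G.Adj v c) (hb : ¬ G.Adj u b) :
    (v :: b :: c :: W).countP (fun x => G.Adj v x) +
      (v :: b :: c :: W).countP (fun x => G.Adj u x) + 1 ≤ W.length + 2 := by
  have := countP_add_countP_le_of_slack (fun x => G.Adj v x) (fun x => G.Adj u x) v b c W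
    (h.isChain_not_cross hN (by simp; omega)) hc hb
  rw [if_neg (h.not_adj_getLast hN (by simp; omega))] at this
  rw [List.countP_cons (a := v)]
  simp only [SimpleGraph.irrefl, decide_false, Bool.false_eq_true, if_false]
  omega

lemma countP_prefix_le (h : TwoPaths G u U v W) (hN : NoPath G N)
    (hl : N ≤ U.length + W.length + 2) (S : List V) (w : V) (T : List V)
    (e : v :: W = S ++ w :: T) :
    (S ++ [w]).countP (fun x => G.Adj v x) + (S ++ [w]).countP (fun x => G.Adj u x) ≤
      S.length + 1 := by
  have hc := h.isChain_not_cross hN hl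
  rw [e] at hc
  have hc : (S ++ [w]).IsChain fun a b => ¬ (G.Adj u a ∧ G.Adj v b) := by
    apply List.IsChain.left_of_append (l₂ := T); simpa using hc
  have hv : ∃ S', S ++ [w] = v :: S' := by
    cases S with
    | nil => exact ⟨[], by simp at e; simp [e.1]⟩
    | cons d S => exact ⟨S ++ [w], by simp at e; simp [e.1]⟩
  obtain ⟨S', hS'⟩ := hv
  have hlen := congrArg List.length hS'
  rw [hS'] at hc ⊢
  have := countP_add_countP_le (fun x => G.Adj v x) (fun x => G.Adj u x) v S' hc
  rw [List.countP_cons (a := v)]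
  simp only [SimpleGraph.irrefl, decide_false, Bool.false_eq_true, if_false]
  simp at hlen
  split_ifs at this <;> omega

lemma countP_prefix_le_of_slack {b c : V} (h : TwoPaths G u U v (b :: c :: W)) (hN : NoPath G N)
    (hl : N ≤ U.length + W.length + 4) (hc : ¬ G.Adj v c) (hb : ¬ G.Adj u b)
    (S : List V) (w : V) (T : List V)
    (e : v :: b :: c :: W = S ++ w :: T) (hw : G.Adj u w) :
    (S ++ [w]).countP (fun x => G.Adj v x) + (S ++ [w]).countP (fun x => G.Adj u x) + 1 ≤
      S.length + 1 := by
  have huv := h.not_adj hN (by simp; omega)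
  have hX := h.isChain_not_cross hN (by simp; omega)
  rw [e] at hX
  have hX : (S ++ [w]).IsChain fun a b => ¬ (G.Adj u a ∧ G.Adj v b) := by
    apply List.IsChain.left_of_append (l₂ := T); simpa using hX
  have hv : ∃ S', S ++ [w] = v :: b :: c :: S' := by
    match S with
    | [] => simp at e; rw [e.1] at huv; exact absurd hw huv
    | [d] => simp at e; rw [e.2.1] at hb; exact absurd hw hb
    | [d, d'] => exact ⟨[], by simp at e; simp [e.1, e.2.1, e.2.2.1]⟩
    | d :: d' :: d'' :: S => exact ⟨S ++ [w], by simp at e; simp [e.1, e.2.1, e.2.2.1]⟩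
  obtain ⟨S', hS'⟩ := hv
  have hlen := congrArg List.length hS'
  rw [hS'] at hX ⊢
  have := countP_add_countP_le_of_slack (fun x => G.Adj v x) (fun x => G.Adj u x) v b c S' hX hc hb
  rw [List.countP_cons (a := v)]
  simp only [SimpleGraph.irrefl, decide_false, Bool.false_eq_true, if_false]
  simp at hlen
  split_ifs at this <;> omega

/-- Let `w` be the last neighbour of `u` on the second path. Follow the first path to `u`, jump to
`w`, return to `v`, and jump to the first neighbour of `v` beyond `w`, if any. This path contains
the first path, everything up to `w`, and all later neighbours of `v`; up to `w` the count is
bounded by `hσ`, with `σ` the slack. -/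
lemma length_add_countP_lt (h : TwoPaths G u U v W) (hN : NoPath G N)
    {σ : ℕ} (hex : ∃ w ∈ v :: W, G.Adj u w)
    (hσ : ∀ (S : List V) (w : V) (T : List V), v :: W = S ++ w :: T → G.Adj u w →
      (S ++ [w]).countP (fun x => G.Adj v x) + (S ++ [w]).countP (fun x => G.Adj u x) + σ ≤
      S.length + 1) :
    U.length + 1 + (v :: W).countP (fun x => G.Adj v x) +
      (v :: W).countP (fun x => G.Adj u x) + σ < N := by
  obtain ⟨S, w, T, e, hw, hT⟩ := exists_last_split _ _ hex
  have hσ := hσ S w T e hw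
  have e' : S ++ w :: T = (S ++ [w]) ++ T := by simp
  have hT0 : T.countP (fun x => G.Adj u x) = 0 := by
    rw [List.countP_eq_zero]; simpa using hT
  rw [e, e', List.countP_append (l₁ := S ++ [w]), List.countP_append (l₁ := S ++ [w]), hT0]
  by_cases hv : ∃ x ∈ T, G.Adj v x
  · obtain ⟨X, b, Y, rfl, hb, hX⟩ := exists_first_split _ _ hv
    have hY : (b :: Y).IsChain G.Adj := by
      have := h.right
      rw [e] at this
      apply List.IsChain.right_of_append (l₁ := S ++ w :: X); simpa using this
    have := hN _ ?_ (isChain_join h.left (isChain_rotate h.right e hY hb) hw)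
    · have hX0 : X.countP (fun x => G.Adj v x) = 0 := by
        rw [List.countP_eq_zero]; simpa using hX
      have hYl := List.countP_le_length (p := fun x => decide (G.Adj v x)) (l := b :: Y)
      rw [List.countP_append (l₁ := X), hX0]
      simp only [List.length_append, List.length_reverse, List.length_cons] at this hYl
      omega
    · have := h.nodup
      rw [e] at this
      simp [List.nodup_append] at this ⊢
      grind
  · have hT1 : T.countP (fun x => G.Adj v x) = 0 := by
      rw [List.countP_eq_zero]; simpa using hv
    rw [hT1]
    have := hN _ ?_ (isChain_join h.left (isChain_reverse_prefix h.right e) hw)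
    · simp only [List.length_append, List.length_reverse, List.length_cons] at this
      omega
    · have := h.nodup
      rw [e] at this
      simp [List.nodup_append] at this ⊢
      grind

end TwoPaths

end SimpleGraph

end

/-! ### Kopylov's lemma on the ends of two paths -/

section
namespace SimpleGraph

variable {V : Type*} {G : SimpleGraph V}

/-- Two disjoint vertex lists in a connected graph are joined by a path avoiding both inside. -/
lemma Preconnected.exists_connecting_path (hG : G.Preconnected) {A B : V → Prop} {u v : V}
    (hu : A u) (hv : B v) (hAB : ∀ x, A x → ¬ B x) :
    ∃ a X b, A a ∧ B b ∧ (a :: (X ++ [b])).IsChain G.Adj ∧ (a :: (X ++ [b])).Nodup ∧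
      ∀ x ∈ X, ¬ A x ∧ ¬ B x := by
  obtain ⟨p⟩ := hG u v
  have hp := p.toPath.2.support_nodup
  have hc := p.toPath.1.isChain_adj_support
  have hus := p.toPath.1.start_mem_support
  have hvs := p.toPath.1.end_mem_support
  set l := p.toPath.1.support
  have hlast : l.getLast? = some v := by
    simp [l, List.getLast?_eq_some_getLast]
  obtain ⟨l₁, a, l₂, e, ha, hl₂⟩ := exists_last_split A l ⟨u, hus, hu⟩
  have hv₂ : v ∈ l₂ := by
    rw [e] at hlast
    cases l₂ with
    | nil =>
      simp at hlast
      subst hlast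
      exact absurd hv (hAB _ ha)
    | cons c l₂ =>
      simp only [List.getLast?_append, List.getLast?_cons_cons] at hlast
      have : (c :: l₂).getLast? = some v := by
        simpa [List.getLast?_cons] using hlast
      exact List.mem_of_getLast? this
  obtain ⟨X, b, Y, rfl, hb, hX⟩ := exists_first_split B l₂ ⟨v, hv₂, hv⟩
  refine ⟨a, X, b, ha, hb, ?_, ?_, fun x hx => ⟨hl₂ x (by simp [hx]), hX x hx⟩⟩
  · rw [e] at hc
    have := hc.right_of_append
    apply List.IsChain.left_of_append (l₂ := Y); simpa using this
  · rw [e] at hp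
    simp [List.nodup_append] at hp ⊢
    grind

lemma isChain_connect {a b : V} {X l l' : List V} (h : (a :: l).IsChain G.Adj)
    (h' : (b :: l').IsChain G.Adj) (hX : (a :: (X ++ [b])).IsChain G.Adj) :
    (l.reverse ++ a :: (X ++ b :: l')).IsChain G.Adj := by
  have h₁ : (l.reverse ++ [a]).IsChain G.Adj := by
    rw [← List.reverse_cons]; exact isChain_reverse_iff.2 h
  have h₂ := List.IsChain.append_overlap (l₁ := a :: X) (l₂ := [b]) (l₃ := l') (by simpa using hX)
    (by simpa using h') (by simp)
  have h₃ := List.IsChain.append_overlap (l₁ := l.reverse) (l₂ := [a]) (l₃ := X ++ b :: l') h₁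
    (by simpa using h₂) (by simp)
  simpa using h₃

namespace TwoPaths

variable {u v : V} {U W : List V} {N : ℕ}

/-- Join the two paths by a connecting path from `a` to `b`. By `exists_path_to`, each of these
vertices starts a path within its own list with more vertices than the degree of that list's end;
the concatenation must be shorter than `N`. -/
lemma countP_lt_of_not_adj (h : TwoPaths G u U v W) (hG : G.Preconnected) (hN : NoPath G N)
    (hU : ∀ x ∈ u :: U, ¬ G.Adj v x) (hW : ∀ x ∈ v :: W, ¬ G.Adj u x) :
    (v :: W).countP (fun x => G.Adj v x) + (v :: W).countP (fun x => G.Adj u x) +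
    ((u :: U).countP (fun x => G.Adj u x) + (u :: U).countP (fun x => G.Adj v x)) + 3 ≤ N := by
  have hd := h.nodup
  rw [List.nodup_append] at hd
  obtain ⟨a, X, b, ha, hb, hc, hn, hX⟩ := hG.exists_connecting_path (A := fun x => x ∈ u :: U)
    (B := fun x => x ∈ v :: W) (u := u) (v := v) (by simp) (by simp)
    (fun x h₁ h₂ => hd.2.2 _ h₁ _ h₂ rfl)
  obtain ⟨l, hl₁, hl₂, hl₃, hl₄⟩ := exists_path_to u a U h.left hd.1 ha
  obtain ⟨l', hl'₁, hl'₂, hl'₃, hl'₄⟩ := exists_path_to v b W h.right hd.2.1 hb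
  have h1 : (u :: U).countP (fun x => G.Adj v x) = 0 := by
    rw [List.countP_eq_zero]; simpa using hU
  have h2 : (v :: W).countP (fun x => G.Adj u x) = 0 := by
    rw [List.countP_eq_zero]; simpa using hW
  have := hN _ ?_ (isChain_connect hl₁ hl'₁ hc)
  · simp only [List.length_append, List.length_reverse, List.length_cons] at this
    omega
  · have hd3 : ∀ x ∈ a :: l, ∀ y ∈ b :: l', x ≠ y :=
      fun x hx y hy => hd.2.2 x (hl₃ hx) y (hl'₃ hy)
    have hX1 : ∀ x ∈ X, x ∉ a :: l := fun x hx h => (hX x hx).1 (hl₃ h)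
    have hX2 : ∀ x ∈ X, x ∉ b :: l' := fun x hx h => (hX x hx).2 (hl'₃ h)
    clear hl₃ hl'₃ hd hX
    simp [List.nodup_append] at hn hl₂ hl'₂ hd3 hX1 hX2 ⊢
    grind

/-- **Kopylov's lemma for paths**: the ends of two disjoint paths covering at least `N` vertices
have few neighbours on them if there is no path on `N` vertices. -/
lemma countP_add_countP_add_two_le (h : TwoPaths G u U v W) (hG : G.Preconnected)
    (hN : NoPath G N) (hl : N ≤ U.length + W.length + 2) :
    (v :: W).countP (fun x => G.Adj v x) + (v :: W).countP (fun x => G.Adj u x) +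
    ((u :: U).countP (fun x => G.Adj u x) + (u :: U).countP (fun x => G.Adj v x)) + 2 ≤ N := by
  have hl' : N ≤ W.length + U.length + 2 := by omega
  -- One path is charged through `length_add_countP_lt`, which leaves room for the full length of
  -- the other; `countP_le` says that the counts on the other path do not exceed this length.
  by_cases hW : ∃ w ∈ v :: W, G.Adj u w
  · have h1 := h.length_add_countP_lt hN (σ := 0) hW
      fun S w T e _ => h.countP_prefix_le hN hl S w T e
    have h2 := h.symm.countP_le hN hl'
    omega
  by_cases hU : ∃ w ∈ u :: U, G.Adj v w
  · have h1 := h.symm.length_add_countP_lt hN (σ := 0) hU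
      fun S w T e _ => h.symm.countP_prefix_le hN hl' S w T e
    have h2 := h.countP_le hN hl
    omega
  have := h.countP_lt_of_not_adj hG hN (by grind) (by grind)
  omega

/-- The gain of one over Kopylov's lemma comes from the empty pair (b, c). It is what rules out
missing edges in the equality case, see `PathSaturated.adj_of_extremal`. -/
lemma countP_add_countP_add_three_le {b c : V} (h : TwoPaths G u U v (b :: c :: W))
    (hG : G.Preconnected) (hN : NoPath G N) (hl : N ≤ U.length + W.length + 4)
    (hc : ¬ G.Adj v c) (hb : ¬ G.Adj u b) :
    (v :: b :: c :: W).countP (fun x => G.Adj v x) +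
      (v :: b :: c :: W).countP (fun x => G.Adj u x) +
    ((u :: U).countP (fun x => G.Adj u x) + (u :: U).countP (fun x => G.Adj v x)) + 3 ≤ N := by
  have hl' : N ≤ (b :: c :: W).length + U.length + 2 := by simp; omega
  by_cases hW : ∃ w ∈ v :: b :: c :: W, G.Adj u w
  · have h1 := h.length_add_countP_lt hN (σ := 1) hW
      fun S w T e => h.countP_prefix_le_of_slack hN hl hc hb S w T e
    have h2 := h.symm.countP_le hN hl'
    omega
  by_cases hU : ∃ w ∈ u :: U, G.Adj v w
  · have h1 := h.symm.length_add_countP_lt hN (σ := 0) hU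
      fun S w T e _ => h.symm.countP_prefix_le hN hl' S w T e
    have h2 := h.countP_le_of_slack hN hl hc hb
    simp only [List.length_cons] at h1
    omega
  have := h.countP_lt_of_not_adj hG hN (by grind) (by grind)
  omega

end TwoPaths

end SimpleGraph

end

/-! ### Saturated graphs and Kopylov's edge bound -/

section
namespace SimpleGraph

variable {V : Type*} {G : SimpleGraph V}

/-- The number of neighbours of `v` in `S`. -/
noncomputable def degIn (G : SimpleGraph V) (S : Finset V) (v : V) : ℕ :=
  (S.filter fun w => G.Adj v w).card

/-- The sum of the degrees in the graph induced on `S`. -/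
noncomputable def degSumIn (G : SimpleGraph V) (S : Finset V) : ℕ :=
  ∑ v ∈ S, degIn G S v

lemma degIn_insert (S : Finset V) (u v : V) (hv : v ∉ S) :
    degIn G (insert v S) u = degIn G S u + if G.Adj u v then 1 else 0 := by
  unfold degIn
  rw [Finset.filter_insert]
  split_ifs with h
  · rw [Finset.card_insert_of_notMem (by simp [hv])]
  · rfl

lemma degSumIn_insert (S : Finset V) (v : V) (hv : v ∉ S) :
    degSumIn G (insert v S) = degSumIn G S + 2 * degIn G S v := by
  unfold degSumIn
  rw [Finset.sum_insert hv, degIn_insert S v v hv,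
    Finset.sum_congr rfl fun u _ => degIn_insert S u v hv, Finset.sum_add_distrib]
  have : (∑ u ∈ S, if G.Adj u v then 1 else 0) = degIn G S v := by
    rw [degIn, Finset.card_filter]
    simp [G.adj_comm]
  rw [this]; simp; ring

lemma degIn_erase (S : Finset V) (v : V) : degIn G (S.erase v) v = degIn G S v := by
  unfold degIn
  congr 1
  ext w
  simp only [Finset.mem_filter, Finset.mem_erase]
  exact ⟨fun h => ⟨h.1.2, h.2⟩, fun h => ⟨⟨h.2.ne', h.1⟩, h.2⟩⟩

lemma degSumIn_erase (S : Finset V) (v : V) (hv : v ∈ S) :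
    degSumIn G S = degSumIn G (S.erase v) + 2 * degIn G S v := by
  rw [← degIn_erase S v, ← degSumIn_insert _ _ (by simp), Finset.insert_erase hv]

lemma degIn_le (S : Finset V) (v : V) (hv : v ∈ S) : degIn G S v + 1 ≤ S.card := by
  rw [← degIn_erase, ← Finset.card_erase_add_one hv]
  exact Nat.add_le_add_right (Finset.card_filter_le _ _) 1

lemma degSumIn_mono {H : SimpleGraph V} (h : G ≤ H) (S : Finset V) :
    degSumIn G S ≤ degSumIn H S :=
  Finset.sum_le_sum fun _ _ => Finset.card_le_card fun _ hw => by
    rw [Finset.mem_filter] at hw ⊢; exact ⟨hw.1, h hw.2⟩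

lemma degSumIn_le (S : Finset V) : (degSumIn G S : ℤ) ≤ S.card * (S.card - 1) := by
  unfold degSumIn
  push_cast
  rw [← nsmul_eq_mul]
  refine Finset.sum_le_card_nsmul _ _ _ fun v hv => ?_
  have := degIn_le (G := G) S v hv
  omega

/-- Sets maximizing `degSumIn G S - 2 * x * S.card` have large minimum degree. -/
lemma exists_extremal_set [Fintype V] (P : Finset V → Prop) (hP : P Finset.univ) (x : ℕ) :
    ∃ A, P A ∧ (∀ B, P B → (degSumIn G B : ℤ) - 2 * x * B.card ≤ degSumIn G A - 2 * x * A.card) ∧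
      ∀ v ∈ A, P (A.erase v) → x + 1 ≤ degIn G A v := by
  -- The weight `Fintype.card V + 1` turns the cardinality into a tie-breaker: a smallest maximizer
  -- is chosen, so that deleting a vertex strictly loses and the degrees are at least x + 1 instead
  -- of x.
  obtain ⟨A, hA, hmax⟩ := Finset.exists_max_image (Finset.univ.filter P)
    (fun B => ((Fintype.card V : ℤ) + 1) * ((degSumIn G B : ℤ) - 2 * x * B.card) - B.card)
    ⟨Finset.univ, by simpa using hP⟩
  simp only [Finset.mem_filter, Finset.mem_univ, true_and] at hA hmax
  have hn : (0 : ℤ) ≤ Fintype.card V := by positivity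
  refine ⟨A, hA, fun B hB => ?_, fun v hv hAv => ?_⟩
  · have h1 := hmax B hB
    have h2 : (B.card : ℤ) ≤ Fintype.card V := by exact_mod_cast Finset.card_le_univ B
    by_contra! hlt
    have : (degSumIn G A : ℤ) - 2 * x * A.card + 1 ≤ degSumIn G B - 2 * x * B.card := by omega
    nlinarith
  · have h1 := hmax _ hAv
    have h2 := degSumIn_erase (G := G) A v hv
    have h3 : (A.card : ℤ) = (A.erase v).card + 1 := by
      exact_mod_cast (Finset.card_erase_add_one hv).symm
    rw [h2, h3] at h1
    push_cast at h1
    by_contra! hlt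
    have h4 : (degIn G A v : ℤ) ≤ x := by omega
    nlinarith

/-- Adding any edge creates a path on `N` vertices. -/
def PathSaturated (G : SimpleGraph V) (N : ℕ) : Prop :=
  ∀ u v, u ≠ v → ¬ G.Adj u v → ∃ U W, TwoPaths G u U v W ∧ N ≤ U.length + W.length + 2

lemma NoPath.mono {G H : SimpleGraph V} {N : ℕ} (h : G ≤ H) (hH : NoPath H N) : NoPath G N :=
  fun l hn hc => hH l hn (hc.imp fun _ _ hab => h hab)

/-- A path on `N` vertices in the enlarged graph must use the new edge, and only once since its
vertices are distinct. Cutting it there leaves the two paths. -/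
lemma pathSaturated_of_maximal {N : ℕ} (h : Maximal (fun G : SimpleGraph V => NoPath G N) G) :
    PathSaturated G N := by
  intro u v huv hadj
  have hlt : ¬ NoPath (G ⊔ edge u v) N := fun hN => by
    have := h.2 hN le_sup_left
    exact hadj (this (Or.inr (by simp [edge_adj, huv])))
  simp only [NoPath, not_forall, not_lt] at hlt
  obtain ⟨l, hn, hc, hl⟩ := hlt
  have hnc : ¬ l.IsChain G.Adj := fun hc' => by
    have := h.1 l hn hc'; omega
  obtain ⟨l₁, a, b, l₂, rfl, hab⟩ : ∃ l₁ a b l₂, l = l₁ ++ a :: b :: l₂ ∧ ¬ G.Adj a b := by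
    by_contra! hcon
    exact hnc (isChain_of_forall_split l hcon)
  have key : ∀ c d, (G ⊔ edge u v).Adj c d → ¬ G.Adj c d → c = u ∧ d = v ∨ c = v ∧ d = u := by
    intro c d hcd hcd'
    rcases hcd with hcd | hcd
    · exact absurd hcd hcd'
    · rw [edge_adj] at hcd; exact hcd.1
  have hab' : (G ⊔ edge u v).Adj a b := by
    have := hc.right_of_append
    rw [List.isChain_cons_cons] at this
    exact this.1
  have h1 : (l₁ ++ [a]).IsChain G.Adj := by
    have : (l₁ ++ [a]).IsChain (G ⊔ edge u v).Adj := by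
      apply List.IsChain.left_of_append (l₂ := b :: l₂); simpa using hc
    refine this.imp_of_mem_imp fun c d hc' hd' hcd => ?_
    by_contra hcd'
    have k1 := key _ _ hcd hcd'
    have k2 := key _ _ hab' hab
    have : b ∈ l₁ ++ [a] := by grind
    simp [List.nodup_append] at hn this
    grind
  have h2 : (b :: l₂).IsChain G.Adj := by
    have : (b :: l₂).IsChain (G ⊔ edge u v).Adj := by
      apply List.IsChain.right_of_append (l₁ := l₁ ++ [a]); simpa using hc
    refine this.imp_of_mem_imp fun c d hc' hd' hcd => ?_
    by_contra hcd'
    have k1 := key _ _ hcd hcd'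
    have k2 := key _ _ hab' hab
    have : a ∈ b :: l₂ := by grind
    simp [List.nodup_append] at hn this
    grind
  have h3 : TwoPaths G a l₁.reverse b l₂ := by
    refine ⟨by simpa using isChain_reverse_iff.2 h1, h2, ?_⟩
    simp [List.nodup_append] at hn ⊢
    grind
  have hl' : N ≤ l₁.reverse.length + l₂.length + 2 := by
    simp at hl ⊢; omega
  rcases key _ _ hab' hab with ⟨rfl, rfl⟩ | ⟨rfl, rfl⟩
  · exact ⟨_, _, h3, hl'⟩
  · exact ⟨_, _, h3.symm, by omega⟩

lemma exists_pathSaturated [Finite V] {N : ℕ} (h : NoPath G N) :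
    ∃ H, G ≤ H ∧ NoPath H N ∧ PathSaturated H N := by
  obtain ⟨H, hGH, hH⟩ := Set.Finite.exists_le_maximal (Set.toFinite {G | NoPath G N}) h
  exact ⟨H, hGH, hH.1, pathSaturated_of_maximal hH⟩

namespace TwoPaths

variable {u v : V} {U W : List V} {N : ℕ}

lemma extend (h : TwoPaths G u U v W) {u' : V} (hu : G.Adj u u') (hm : u' ∉ u :: U ++ v :: W) :
    TwoPaths G u' (u :: U) v W :=
  ⟨by rw [List.isChain_cons_cons]; exact ⟨hu.symm, h.left⟩, h.right, by
    rw [List.cons_append, List.nodup_cons]; exact ⟨hm, h.nodup⟩⟩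

lemma extend_right (h : TwoPaths G u U v W) {v' : V} (hv : G.Adj v v')
    (hm : v' ∉ u :: U ++ v :: W) : TwoPaths G u U v' (v :: W) :=
  (h.symm.extend hv (by simp at hm ⊢; grind)).symm

lemma degIn_le (w : V) (A : Finset V) (h : ∀ x ∈ A, G.Adj w x → x ∈ u :: U ++ v :: W) :
    degIn G A w ≤ (u :: U).countP (fun x => G.Adj w x) + (v :: W).countP (fun x => G.Adj w x) := by
  rw [← List.countP_append, List.countP_eq_length_filter, degIn]
  refine le_trans (Finset.card_le_card ?_) (List.toFinset_card_le _)
  intro x hx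
  rw [Finset.mem_filter] at hx
  rw [List.mem_toFinset, List.mem_filter]
  exact ⟨h x hx.1 hx.2, by simpa using hx.2⟩

lemma exists_max [Fintype V] (Q : V → V → Prop)
    (h : ∃ u U v W, Q u v ∧ TwoPaths G u U v W ∧ N ≤ U.length + W.length + 2) :
    ∃ u U v W, Q u v ∧ TwoPaths G u U v W ∧ N ≤ U.length + W.length + 2 ∧
      ∀ u' U' v' W', Q u' v' → TwoPaths G u' U' v' W' →
        U'.length + W'.length ≤ U.length + W.length := by
  let S : Set ℕ := {m | ∃ u U v W, Q u v ∧ TwoPaths G u U v W ∧ m = U.length + W.length}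
  have hb : BddAbove S := by
    refine ⟨Fintype.card V, ?_⟩
    rintro m ⟨u, U, v, W, -, h, rfl⟩
    have := h.nodup.length_le_card
    simp at this; omega
  obtain ⟨u, U, v, W, hQ, h, hl⟩ := h
  have hm : U.length + W.length ∈ S := ⟨u, U, v, W, hQ, h, rfl⟩
  obtain ⟨u₁, U₁, v₁, W₁, hQ₁, h₁, e⟩ := Nat.sSup_mem ⟨_, hm⟩ hb
  have hle := le_csSup hb hm
  refine ⟨u₁, U₁, v₁, W₁, hQ₁, h₁, by omega, fun u' U' v' W' hQ' h' => ?_⟩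
  have := le_csSup hb (show U'.length + W'.length ∈ S from ⟨u', U', v', W', hQ', h', rfl⟩)
  omega

end TwoPaths

lemma isChain_of_isClique {A : Finset V} (hA : G.IsClique A) {l : List V} (hn : l.Nodup)
    (hl : ∀ x ∈ l, x ∈ A) : l.IsChain G.Adj := by
  apply List.Pairwise.isChain
  exact hn.pairwise_of_forall_ne fun a ha b hb hab => hA (hl a ha) (hl b hb) hab

lemma Preconnected.exists_adj_of_mem_of_notMem (hG : G.Preconnected) {A : Set V} {u v : V}
    (hu : u ∈ A) (hv : v ∉ A) : ∃ a b, a ∈ A ∧ b ∉ A ∧ G.Adj a b := by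
  obtain ⟨p⟩ := hG u v
  obtain ⟨d, -, h1, h2⟩ := p.exists_boundary_dart A hu hv
  exact ⟨_, _, h1, h2, d.adj⟩

/-- A larger clique does not exhaust the vertices, so connectivity gives an edge leaving it; this
edge followed by a path through the whole clique is too long. -/
lemma Preconnected.card_clique_lt [Fintype V] (hG : G.Preconnected) {s : ℕ}
    (hN : NoPath G (s + 1)) (hs : s < Fintype.card V) {A : Finset V} (hA : G.IsClique A)
    (hne : A.Nonempty) : A.card < s := by
  by_contra! hle
  obtain ⟨u, hu⟩ := hne
  have h1 := hN A.toList A.nodup_toList (isChain_of_isClique hA A.nodup_toList (by simp))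
  rw [Finset.length_toList] at h1
  obtain ⟨v, hv⟩ : ∃ v, v ∉ A := by
    by_contra! hall
    have : A = Finset.univ := Finset.eq_univ_of_forall hall
    rw [this, Finset.card_univ] at h1; omega
  obtain ⟨a, b, ha, hb, hab⟩ := hG.exists_adj_of_mem_of_notMem (A := (A : Set V)) hu hv
  simp only [Finset.mem_coe] at ha hb
  have h2 : (a :: (A.erase a).toList).Nodup := by
    rw [List.nodup_cons]; exact ⟨by simp, Finset.nodup_toList _⟩
  have h3 : (a :: (A.erase a).toList).IsChain G.Adj := by
    apply isChain_of_isClique hA h2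
    simp; grind
  have := hN (b :: a :: (A.erase a).toList) ?_ ?_
  · simp only [List.length_cons, Finset.length_toList, Finset.card_erase_of_mem ha] at this
    omega
  · rw [List.nodup_cons]
    refine ⟨?_, h2⟩
    simp; grind
  · rw [List.isChain_cons_cons]; exact ⟨hab.symm, h3⟩

/-- **Kopylov's theorem** on connected graphs without long paths: in a saturated graph the degree
sums of all large vertex sets are bounded. -/
lemma PathSaturated.degSumIn_le [Fintype V] {s y : ℕ} (hS : PathSaturated G (s + 1))
    (hG : G.Preconnected) (hN : NoPath G (s + 1)) (hs : s < Fintype.card V)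
    (hy : 2 * y + 1 ≤ s) (hy' : s ≤ 2 * y + 2) :
    (∀ B : Finset V, y + 1 ≤ B.card → (degSumIn G B : ℤ) ≤ 2 * y * B.card - y * (y + 1)) ∨
    ∃ m : ℕ, y + 2 ≤ m ∧ m < s ∧
      (degSumIn G Finset.univ : ℤ) ≤ m * (m - 1) + 2 * (s - m) * (Fintype.card V - m) := by
  -- `A` plays the role of a core. If it has the minimal size y + 1, its degree sum is at most y (y
  -- + 1) and maximality is the first alternative; otherwise all degrees inside `A` are at least y +
  -- 1.
  obtain ⟨A, hA, hmax, hdeg⟩ := exists_extremal_set (G := G) (fun B => y + 1 ≤ B.card)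
    (by rw [Finset.card_univ]; omega) y
  have hA2 := SimpleGraph.degSumIn_le (G := G) A
  by_cases hcard : A.card = y + 1
  · left
    intro B hB
    have hle := hmax B hB
    rw [hcard] at hle hA2
    push_cast at hle hA2
    nlinarith
  right
  have hdeg : ∀ v ∈ A, y + 1 ≤ degIn G A v := fun v hv => hdeg v hv (by
    rw [Finset.card_erase_of_mem hv]; omega)
  -- For a nonadjacent pair in `A` with the longest possible paths, all neighbours in `A` lie on the
  -- paths, since otherwise a path extends to another nonadjacent pair. Kopylov's lemma then gives 2
  -- (y + 1) + 2 ≤ s + 1, against s ≤ 2y + 2.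
  have hcl : G.IsClique A := by
    by_contra hcl
    obtain ⟨u, U, v, W, ⟨hu, hv, huv⟩, h, hl, hmax'⟩ :=
      TwoPaths.exists_max (G := G) (N := s + 1) (fun u v => u ∈ A ∧ v ∈ A ∧ ¬ G.Adj u v) (by
        rw [isClique_iff, Set.Pairwise] at hcl
        push Not at hcl
        obtain ⟨u, hu, v, hv, hne, huv⟩ := hcl
        obtain ⟨U, W, h, hl⟩ := hS u v hne huv
        exact ⟨u, U, v, W, ⟨hu, hv, huv⟩, h, hl⟩)
    have h1 := TwoPaths.degIn_le (G := G) (u := u) (U := U) (v := v) (W := W) u A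
      fun x hx hux => by
        by_contra hm
        have h' := h.extend hux hm
        have := hmax' _ _ _ _ ⟨hx, hv, h'.not_adj hN (by simp; omega)⟩ h'
        simp at this
    have h2 := TwoPaths.degIn_le (G := G) (u := u) (U := U) (v := v) (W := W) v A
      fun x hx hux => by
        by_contra hm
        have h' := h.extend_right hux hm
        have := hmax' _ _ _ _ ⟨hu, hx, h'.not_adj hN (by simp; omega)⟩ h'
        simp at this
    have := h.countP_add_countP_add_two_le hG hN hl
    have := hdeg u hu
    have := hdeg v hv
    omega
  have hm : A.card < s := hG.card_clique_lt hN hs hcl (Finset.card_pos.1 (by omega))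
  refine ⟨A.card, by omega, hm, ?_⟩
  -- The threshold s - m, with m the size of `A`, is chosen for the next contradiction: degrees m -
  -- 1 inside the clique and s - m + 1 outside add up to s, one more than Kopylov's lemma allows.
  obtain ⟨B, hAB, hmaxB, hdegB⟩ := exists_extremal_set (G := G) (fun B => A ⊆ B)
    (Finset.subset_univ _) (s - A.card)
  have hleB := hmaxB Finset.univ (Finset.subset_univ _)
  rw [Finset.card_univ] at hleB
  by_cases hBA : B = A
  · rw [hBA, Nat.cast_sub hm.le] at hleB
    nlinarith
  exfalso
  obtain ⟨v, hvB, hvA⟩ := Finset.exists_of_ssubset (hAB.ssubset_of_ne (Ne.symm hBA))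
  have hdegB : ∀ v ∈ B, v ∉ A → s - A.card + 1 ≤ degIn G B v := fun v hv hvA => hdegB v hv
    fun w hw => Finset.mem_erase.2 ⟨fun e => hvA (e ▸ hw), hAB hw⟩
  -- `A` is a maximal clique: a vertex adjacent to all of it would raise the maximized quantity by
  -- 2m - 2y > 0.
  obtain ⟨u, hu, huv⟩ : ∃ u ∈ A, ¬ G.Adj u v := by
    by_contra! hall
    have h1 := hmax (insert v A) (by rw [Finset.card_insert_of_notMem hvA]; omega)
    have h2 : degIn G A v = A.card := by
      rw [degIn, Finset.filter_true_of_mem fun w hw => (hall w hw).symm]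
    rw [degSumIn_insert A v hvA, Finset.card_insert_of_notMem hvA, h2] at h1
    push_cast at h1
    nlinarith
  obtain ⟨u, U, v, W, ⟨hu, hvB, hvA, huv⟩, h, hl, hmax'⟩ :=
    TwoPaths.exists_max (G := G) (N := s + 1)
      (fun u v => u ∈ A ∧ v ∈ B ∧ v ∉ A ∧ ¬ G.Adj u v) (by
        obtain ⟨U, W, h, hl⟩ := hS u v (fun e => hvA (e ▸ hu)) huv
        exact ⟨u, U, v, W, ⟨hu, hvB, hvA, huv⟩, h, hl⟩)
  have h1 := TwoPaths.degIn_le (G := G) (u := u) (U := U) (v := v) (W := W) u A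
    fun x hx hux => by
      by_contra hm
      have h' := h.extend hux hm
      have := hmax' _ _ _ _ ⟨hx, hvB, hvA, h'.not_adj hN (by simp; omega)⟩ h'
      simp at this
  have h2 := TwoPaths.degIn_le (G := G) (u := u) (U := U) (v := v) (W := W) v B
    fun x hx hux => by
      by_contra hm
      have h' := h.extend_right hux hm
      have hnadj := h'.not_adj hN (by simp; omega)
      have hxA : x ∉ A := fun hxA => hnadj (hcl hu hxA (by rintro rfl; simp at hm))
      have := hmax' _ _ _ _ ⟨hu, hx, hxA, hnadj⟩ h'
      simp at this
  have h3 := h.countP_add_countP_add_two_le hG hN hl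
  have h4 := hdegB v hvB hvA
  have h5 : degIn G A u + 1 = A.card := by
    rw [← degIn_erase, degIn, Finset.filter_true_of_mem, Finset.card_erase_add_one hu]
    intro w hw
    rw [Finset.mem_erase] at hw
    exact hcl hu hw.2 hw.1.symm
  omega

end SimpleGraph

end

/-! ### The equality case: a clique joined to an independent set -/

section
namespace SimpleGraph

variable {V : Type*} {G : SimpleGraph V}

lemma eq_of_degSumIn_le [Fintype V] {H : SimpleGraph V} (h : G ≤ H)
    (hle : degSumIn H Finset.univ ≤ degSumIn G Finset.univ) : H = G := by
  have hle' : ∀ v ∈ Finset.univ, degIn G Finset.univ v ≤ degIn H Finset.univ v := fun v _ =>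
    Finset.card_le_card fun w hw => by
      rw [Finset.mem_filter] at hw ⊢; exact ⟨hw.1, h hw.2⟩
  have heq := (Finset.sum_eq_sum_iff_of_le hle').1
    (le_antisymm (Finset.sum_le_sum hle') hle)
  refine le_antisymm (fun u v huv => ?_) h
  have h1 := Finset.eq_of_subset_of_card_le (s := Finset.univ.filter fun w => G.Adj u w)
    (t := Finset.univ.filter fun w => H.Adj u w) (fun w hw => by
      rw [Finset.mem_filter] at hw ⊢; exact ⟨hw.1, h hw.2⟩) (heq u (Finset.mem_univ _)).ge
  have : v ∈ Finset.univ.filter fun w => G.Adj u w := by rw [h1]; simpa using huv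
  simpa using this

/-- If all sets obey `degSumIn G B ≤ 2 * h * B.card - h * (h + 1)` with equality for the set of all
vertices, then there are no vertices of degree less than `h` and no edges between those of
degree `h`. -/
lemma le_degIn_and_not_adj_of_extremal [Fintype V] {h : ℕ} (hn : h + 3 ≤ Fintype.card V)
    (hB : ∀ B : Finset V, h + 1 ≤ B.card → (degSumIn G B : ℤ) ≤ 2 * h * B.card - h * (h + 1))
    (heq : (degSumIn G Finset.univ : ℤ) = 2 * h * Fintype.card V - h * (h + 1)) :
    (∀ v, h ≤ degIn G Finset.univ v) ∧
    ∀ u v, degIn G Finset.univ u = h → degIn G Finset.univ v = h → ¬ G.Adj u v := by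
  constructor
  · intro v
    have h1 := degSumIn_erase (G := G) Finset.univ v (Finset.mem_univ _)
    have h2 := hB (Finset.univ.erase v) (by
      rw [Finset.card_erase_of_mem (Finset.mem_univ _), Finset.card_univ]; omega)
    rw [Finset.cast_card_erase_of_mem (Finset.mem_univ _), Finset.card_univ] at h2
    rw [h1] at heq
    push_cast at heq
    have : (h : ℤ) ≤ degIn G Finset.univ v := by linarith
    exact_mod_cast this
  · intro u v hu hv huv
    have hmem : u ∈ Finset.univ.erase v := by simp [huv.ne]
    have h1 := degSumIn_erase (G := G) Finset.univ v (Finset.mem_univ _)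
    have h3 := degSumIn_erase (G := G) (Finset.univ.erase v) u hmem
    have h4 := degIn_insert (G := G) (Finset.univ.erase v) u v (by simp)
    rw [Finset.insert_erase (Finset.mem_univ _), if_pos huv] at h4
    have h2 := hB ((Finset.univ.erase v).erase u) (by
      rw [Finset.card_erase_of_mem hmem, Finset.card_erase_of_mem (Finset.mem_univ _),
        Finset.card_univ]; omega)
    rw [Finset.cast_card_erase_of_mem hmem, Finset.cast_card_erase_of_mem (Finset.mem_univ _),
      Finset.card_univ] at h2
    -- The edge between `u` and `v` is shared, so deleting both loses only 2h - 1 edges; the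
    -- remaining set would exceed the assumed bound.
    have h5 : (degIn G (Finset.univ.erase v) u : ℤ) = h - 1 := by omega
    have h6 : (degIn G Finset.univ v : ℤ) = h := by omega
    rw [h1, h3] at heq
    push_cast at heq
    rw [h5, h6] at heq
    linarith

lemma degSumIn_sdiff_of_independent [Fintype V] {h : ℕ} (R : Finset V)
    (hR : ∀ u ∈ R, degIn G Finset.univ u = h) (hind : ∀ u ∈ R, ∀ v ∈ R, ¬ G.Adj u v) :
    degSumIn G (Finset.univ \ R) + 2 * h * R.card = degSumIn G Finset.univ := by
  induction R using Finset.induction_on with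
  | empty => simp
  | insert z R hz ih =>
    have ih := ih (fun u hu => hR u (by simp [hu]))
      fun u hu v hv => hind u (by simp [hu]) v (by simp [hv])
    rw [← ih, Finset.card_insert_of_notMem hz, Finset.sdiff_insert,
      degSumIn_erase (Finset.univ \ R) z (by simp [hz])]
    have : degIn G (Finset.univ \ R) z = h := by
      rw [← hR z (by simp), degIn, degIn]
      congr 1
      ext w
      simp only [Finset.mem_filter, Finset.mem_sdiff, Finset.mem_univ, true_and]
      exact ⟨fun h => h.2, fun h => ⟨fun hw => hind z (by simp) w (by simp [hw]) h, h⟩⟩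
    rw [this]; ring

/-- In a saturated graph which is extremal for the degeneracy bound, every vertex of large degree
is adjacent to all others. -/
lemma PathSaturated.adj_of_extremal {h : ℕ} [Fintype V] (hS : PathSaturated G (2 * h + 2))
    (hG : G.Preconnected) (hN : NoPath G (2 * h + 2)) (hh : 1 ≤ h) {Y : Finset V}
    (hmin : ∀ v, h ≤ degIn G Finset.univ v)
    (hind : ∀ u v, u ∉ Y → v ∉ Y → ¬ G.Adj u v)
    (hZ : ∀ u, u ∉ Y → degIn G Finset.univ u = h)
    (hY : ∀ v ∈ Y, h < degIn G Finset.univ v) (hYY : ∀ v ∈ Y, h ≤ degIn G Y v) :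
    ∀ v ∈ Y, ∀ u, u ≠ v → G.Adj u v := by
  by_contra! hcon
  obtain ⟨v, hv, u, hne, huv⟩ := hcon
  obtain ⟨u, U, v, W, ⟨hv, huv⟩, hT, hl, hmax⟩ :=
    TwoPaths.exists_max (G := G) (N := 2 * h + 2) (fun u v => v ∈ Y ∧ ¬ G.Adj u v) (by
      obtain ⟨U, W, hT, hl⟩ := hS u v hne huv
      exact ⟨u, U, v, W, ⟨hv, huv⟩, hT, hl⟩)
  -- The path at `v` may be assumed to have a second vertex. If it has none, a neighbour `a` of `v`
  -- in `Y` lies on the first path by maximality; cut that path before `a` and attach the tail to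
  -- `v`, keeping the total length.
  obtain ⟨U, b, W, hT, hl, hmax⟩ : ∃ U' b W', TwoPaths G u U' v (b :: W') ∧
      2 * h + 2 ≤ U'.length + W'.length + 3 ∧ ∀ u₁ U₁ v₁ W₁, (v₁ ∈ Y ∧ ¬ G.Adj u₁ v₁) →
        TwoPaths G u₁ U₁ v₁ W₁ → U₁.length + W₁.length ≤ U'.length + W'.length + 1 := by
    cases W with
    | cons b W => exact ⟨U, b, W, hT, by simp at hl; omega, fun u₁ U₁ v₁ W₁ h₁ h₂ => by
        have := hmax _ _ _ _ h₁ h₂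
        simp at this; omega⟩
    | nil =>
      have h1 := hYY v hv
      obtain ⟨a, ha⟩ : (Y.filter fun w => G.Adj v w).Nonempty :=
        Finset.card_pos.1 (lt_of_lt_of_le hh h1)
      rw [Finset.mem_filter] at ha
      have haL : a ∈ u :: U ++ [v] := by
        by_contra hm
        have h' := hT.extend_right ha.2 hm
        have := hmax _ _ _ _ ⟨ha.1, h'.not_adj hN (by simp at hl ⊢; omega)⟩ h'
        simp at this
      have haU : a ∈ U := by
        have h1 : a ≠ v := ha.2.ne'
        have h2 : a ≠ u := by rintro rfl; exact huv ha.2.symm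
        simpa [h1, h2] using haL
      obtain ⟨U₁, U₂, rfl⟩ := List.append_of_mem haU
      refine ⟨U₁, a, U₂, ⟨?_, ?_, ?_⟩, ?_, fun u₁ U₁ v₁ W₁ h₁ h₂ => ?_⟩
      · have := hT.left
        apply List.IsChain.left_of_append (l₂ := a :: U₂); simpa using this
      · rw [List.isChain_cons_cons]
        refine ⟨ha.2, ?_⟩
        have := hT.left
        apply List.IsChain.right_of_append (l₁ := u :: U₁); simpa using this
      · have := hT.nodup
        simp [List.nodup_append] at this ⊢
        grind
      · simp at hl ⊢; omega
      · have := hmax _ _ _ _ h₁ h₂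
        simp at this; omega
  have hu1 : ∀ x ∈ Finset.univ, G.Adj u x → x ∈ u :: U ++ v :: b :: W := by
    intro x _ hux
    by_contra hm
    have h' := hT.extend hux hm
    have := hmax _ _ _ _ ⟨hv, h'.not_adj hN (by simp; omega)⟩ h'
    simp at this; omega
  have hv1 : ∀ x ∈ Y, G.Adj v x → x ∈ u :: U ++ v :: b :: W := by
    intro x hx hux
    by_contra hm
    have h' := hT.extend_right hux hm
    have := hmax _ _ _ _ ⟨hx, h'.not_adj hN (by simp; omega)⟩ h'
    simp at this; omega
  have c1 := TwoPaths.degIn_le (G := G) u _ hu1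
  have c2 := TwoPaths.degIn_le (G := G) v _ hv1
  have c3 := hT.countP_add_countP_add_two_le hG hN (by simp; omega)
  have c4 := hYY v hv
  have c5 := hmin u
  -- Kopylov's lemma leaves `v` at most `h` neighbours on the paths, while its degree exceeds `h`.
  -- By maximality the additional neighbour `z` is outside `Y`.
  obtain ⟨z, hvz, hz⟩ : ∃ z, G.Adj v z ∧ z ∉ u :: U ++ v :: b :: W := by
    by_contra! hcon
    have := TwoPaths.degIn_le (G := G) v Finset.univ fun x _ => hcon x
    have := hY v hv
    omega
  have hzY : z ∉ Y := fun hzY => hz (hv1 z hzY hvz)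
  have hT' := hT.extend_right hvz hz
  have hz1 : ∀ x ∈ Finset.univ, G.Adj z x → x ∈ u :: U ++ z :: v :: b :: W := by
    intro x _ hzx
    by_contra hm
    have h' := hT'.extend_right hzx hm
    have hx : x ∈ Y := by
      by_contra hx
      exact hind z x hzY hx hzx
    have := hmax _ _ _ _ ⟨hx, h'.not_adj hN (by simp; omega)⟩ h'
    simp at this; omega
  have hzb : ¬ G.Adj z b := by
    intro hzb
    have h' : TwoPaths G u U v (z :: b :: W) := by
      refine ⟨hT.left, ?_, ?_⟩
      · have := hT.right
        rw [List.isChain_cons_cons] at this ⊢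
        rw [List.isChain_cons_cons]
        exact ⟨hvz, hzb, this.2⟩
      · have := hT'.nodup
        simp [List.nodup_append] at this ⊢
        grind
    have := hmax _ _ _ _ ⟨hv, huv⟩ h'
    simp at this; omega
  have e1 := TwoPaths.degIn_le (G := G) z _ hz1
  have e2 := TwoPaths.degIn_le (G := G) (u := u) (U := U) (v := z) (W := v :: b :: W) u Finset.univ
    fun x hx hux => by
      have := hu1 x hx hux
      simp at this ⊢; tauto
  -- After prepending `z` the second path begins z, v, b, with `z` not adjacent to `b` and `u` not
  -- adjacent to `v`. This is the slack configuration, and the degrees of `u` and `z` add up to at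
  -- least 2h, one too many.
  have e3 := hT'.countP_add_countP_add_three_le hG hN (by omega) hzb huv
  have e4 := hZ z hzY
  omega

/-- The extremal connected graphs for the degeneracy bound consist of `h` vertices adjacent to all
others, and an independent set. -/
lemma PathSaturated.exists_universal_of_extremal {h : ℕ} [Fintype V]
    (hS : PathSaturated G (2 * h + 2)) (hG : G.Preconnected) (hN : NoPath G (2 * h + 2))
    (hh : 1 ≤ h) (hn : 2 * h + 1 < Fintype.card V)
    (hB : ∀ B : Finset V, h + 1 ≤ B.card → (degSumIn G B : ℤ) ≤ 2 * h * B.card - h * (h + 1))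
    (heq : (degSumIn G Finset.univ : ℤ) = 2 * h * Fintype.card V - h * (h + 1)) :
    ∃ Y : Finset V, Y.card = h ∧ (∀ v ∈ Y, degIn G Finset.univ v = Fintype.card V - 1) ∧
      ∀ v, v ∉ Y → degIn G Finset.univ v = h := by
  obtain ⟨hmin, hind⟩ := le_degIn_and_not_adj_of_extremal (by omega) hB heq
  let Z : Finset V := Finset.univ.filter fun v => degIn G Finset.univ v = h
  let Y : Finset V := Finset.univ \ Z
  have hYmem : ∀ v, v ∈ Y ↔ degIn G Finset.univ v ≠ h := fun v => by simp [Y, Z]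
  have hcard : Y.card + Z.card = Fintype.card V := by
    rw [Finset.card_sdiff_add_card, Finset.union_eq_left.2 (Finset.subset_univ _),
      Finset.card_univ]
  have hsum : degSumIn G Y + 2 * h * Z.card = degSumIn G Finset.univ := by
    apply degSumIn_sdiff_of_independent
    · intro u hu; simpa [Z] using hu
    · intro u hu v hv; exact hind u v (by simpa [Z] using hu) (by simpa [Z] using hv)
  -- Each deleted vertex of `Z` removes exactly 2h from the degree sum, so equality in the bound is
  -- inherited by `Y`, and minimum degree `h` inside `Y` can be tested by deleting single vertices.
  have hsum' : (degSumIn G Y : ℤ) = 2 * h * Y.card - h * (h + 1) := by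
    have h1 : (degSumIn G Y : ℤ) + 2 * h * Z.card = degSumIn G Finset.univ := by exact_mod_cast hsum
    have h2 : (Y.card : ℤ) + Z.card = Fintype.card V := by exact_mod_cast hcard
    rw [heq, ← h2] at h1
    linarith
  have hZ : ∀ u, u ∉ Y → degIn G Finset.univ u = h := fun u hu => by
    rw [hYmem] at hu; push Not at hu; exact hu
  have hZY : ∀ u, u ∉ Y → ∀ w, G.Adj u w → w ∈ Y := fun u hu w huw => by
    by_contra hw
    exact hind u w (hZ u hu) (hZ w hw) huw
  have hle : Y.card ≤ h := by
    by_contra! hlt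
    have hYY : ∀ v ∈ Y, h ≤ degIn G Y v := by
      intro v hv
      have h1 := degSumIn_erase (G := G) Y v hv
      have hc := Finset.card_erase_add_one hv
      rw [h1] at hsum'
      push_cast at hsum'
      have : (h : ℤ) ≤ degIn G Y v := by
        rcases Nat.lt_or_ge (h + 1) Y.card with hlt' | hge
        · have h2 := hB (Y.erase v) (by omega)
          rw [Finset.cast_card_erase_of_mem hv] at h2
          linarith
        · have h2 := SimpleGraph.degSumIn_le (G := G) (Y.erase v)
          rw [Finset.cast_card_erase_of_mem hv] at h2
          have h3 : (Y.card : ℤ) = h + 1 := by omega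
          rw [h3] at h2 hsum'
          linarith
      exact_mod_cast this
    have hadj := hS.adj_of_extremal hG hN hh hmin
      (fun u v hu hv => hind u v (hZ u hu) (hZ v hv)) hZ
      (fun v hv => lt_of_le_of_ne (hmin v) ((hYmem v).1 hv).symm) hYY
    -- A vertex outside `Y` has degree `h` but would be adjacent to all of `Y`, which has more than
    -- `h` vertices. So `G` is complete, contrary to `card_clique_lt`.
    have hYuniv : ∀ u, u ∈ Y := by
      intro u
      by_contra hu
      have h1 := hZ u hu
      have h2 : Y.card ≤ degIn G Finset.univ u := by
        rw [degIn]
        apply Finset.card_le_card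
        intro w hw
        simpa using hadj w hw u (fun e => hu (e ▸ hw))
      omega
    have := hG.card_clique_lt (s := 2 * h + 1) hN hn (A := Finset.univ)
      (fun u _ v _ huv => hadj v (hYuniv v) u huv)
      (Finset.card_pos.1 (by rw [Finset.card_univ]; omega))
    rw [Finset.card_univ] at this
    omega
  obtain ⟨z, hz⟩ : ∃ z, z ∉ Y := by
    by_contra! hall
    rw [Finset.eq_univ_of_forall hall, Finset.card_univ] at hle
    omega
  have hnbr : ∀ z, z ∉ Y → Y.card = h ∧ ∀ y ∈ Y, G.Adj z y := by
    intro z hz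
    have h1 := hZ z hz
    have hsub : (Finset.univ.filter fun w => G.Adj z w) ⊆ Y := fun w hw =>
      hZY z hz w (by simpa using hw)
    have h2 := Finset.eq_of_subset_of_card_le hsub (by rw [degIn] at h1; omega)
    refine ⟨by rw [← h2]; exact h1, fun y hy => ?_⟩
    rw [← h2] at hy
    simpa using hy
  have hYh := (hnbr z hz).1
  refine ⟨Y, hYh, fun v hv => ?_, hZ⟩
  -- With |Y| = h the inherited equality makes the degree sum in `Y` equal to h (h - 1), that of a
  -- clique.
  have hadj : ∀ w ∈ Y, w ≠ v → G.Adj v w := by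
    have h1 := degSumIn_erase (G := G) Y v hv
    have h2 := SimpleGraph.degSumIn_le (G := G) (Y.erase v)
    rw [Finset.cast_card_erase_of_mem hv] at h2
    rw [h1, hYh] at hsum'
    rw [hYh] at h2
    push_cast at hsum'
    have h3 : (h : ℤ) - 1 ≤ degIn G Y v := by linarith
    rw [← degIn_erase] at h3
    have h4 := Finset.eq_of_subset_of_card_le
      (Finset.filter_subset (fun w => G.Adj v w) (Y.erase v)) (by
        rw [Finset.card_erase_of_mem hv, hYh]
        rw [degIn] at h3
        omega)
    intro w hw hwv
    have : w ∈ Y.erase v := by simp [hw, hwv]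
    rw [← h4] at this
    simpa using (Finset.mem_filter.1 this).2
  rw [← degIn_erase, degIn, Finset.filter_true_of_mem, Finset.card_erase_of_mem (by simp),
    Finset.card_univ]
  intro w hw
  by_cases hwY : w ∈ Y
  · exact hadj w hwY (by simpa using hw)
  · exact ((hnbr w hwY).2 v hv).symm

end SimpleGraph

end

/-! ### Comparison of edge numbers with the union of cliques -/

section
namespace SimpleGraph

variable {V : Type*} {G : SimpleGraph V}

/-- Twice the number of edges of the disjoint union of `n / s` cliques on `s` vertices and a clique
on `n % s` vertices. -/
def cliqueDegSum (s n : ℕ) : ℕ := n / s * (s * (s - 1)) + n % s * (n % s - 1)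

lemma cast_mul_pred (j : ℕ) : ((j * (j - 1) : ℕ) : ℤ) = j * (j - 1) := by
  cases j <;> simp

/-- Compared with degree s - 1 everywhere, each of the n % s vertices of the last clique loses s - n
% s. -/
lemma cliqueDegSum_eq (s n : ℕ) :
    (cliqueDegSum s n : ℤ) = n * (s - 1) - (n % s : ℕ) * (s - (n % s : ℕ)) := by
  have h : (s : ℤ) * (n / s : ℕ) + (n % s : ℕ) = n := by exact_mod_cast Nat.div_add_mod n s
  rw [cliqueDegSum, Nat.cast_add, Nat.cast_mul, cast_mul_pred, cast_mul_pred]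
  linear_combination ((s : ℤ) - 1) * h

lemma mul_pred_nonneg (a : ℤ) : 0 ≤ a * (a - 1) := by
  rcases le_or_gt a 0 with h | h
  · nlinarith
  · nlinarith

lemma add_mod_le_of_lt {s n : ℕ} (hs : 0 < s) (hsn : s < n) : s + n % s ≤ n := by
  have hq : 1 ≤ n / s := (Nat.one_le_div_iff hs).2 hsn.le
  have hn := Nat.div_add_mod n s
  nlinarith

lemma lt_cliqueDegSum_of_le {s n m E : ℕ} (hsn : s < n) (hms : m < s) (hm : s + 2 ≤ 2 * m)
    (h : (E : ℤ) ≤ m * (m - 1) + 2 * (s - m) * (n - m)) : E < cliqueDegSum s n := by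
  have hj := add_mod_le_of_lt (by omega) hsn
  zify
  rw [cliqueDegSum_eq]
  generalize n % s = j at *
  zify at hj hms hm
  -- The gap between the two sides is exactly the sum of the three products below; the first is
  -- nonnegative because n ≥ s + j.
  have h1 : (0 : ℤ) ≤ (n - s - j) * (2 * m - s - 1) :=
    mul_nonneg (by linarith) (by linarith)
  have h2 := mul_pred_nonneg ((j : ℤ) - (s - m))
  have h3 : (0 : ℤ) < 2 * ((s - m) * (2 * m - s - 1)) :=
    mul_pos (by norm_num) (mul_pos (by linarith) (by linarith))
  nlinarith

lemma lt_cliqueDegSum_of_le_even {y n E : ℕ} (hsn : 2 * y + 2 < n)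
    (h : (E : ℤ) ≤ 2 * y * n - y * (y + 1)) : E < cliqueDegSum (2 * y + 2) n := by
  have hj := add_mod_le_of_lt (by omega) hsn
  zify
  rw [cliqueDegSum_eq]
  generalize n % (2 * y + 2) = j at *
  zify at hj
  have h2 := mul_pred_nonneg ((j : ℤ) - y)
  push_cast
  nlinarith

/-- With j = n % (2y + 1) the two quantities differ by (j - y)(j - y - 1), a product of consecutive
integers, which vanishes only for j = y and j = y + 1. -/
lemma lt_cliqueDegSum_or_of_le_odd {y n E : ℕ}
    (h : (E : ℤ) ≤ 2 * y * n - y * (y + 1)) : E < cliqueDegSum (2 * y + 1) n ∨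
    (E = cliqueDegSum (2 * y + 1) n ∧ (E : ℤ) = 2 * y * n - y * (y + 1) ∧
      (n % (2 * y + 1) = y ∨ n % (2 * y + 1) = y + 1)) := by
  have h0 := cliqueDegSum_eq (2 * y + 1) n
  generalize n % (2 * y + 1) = j at *
  have h1 : (cliqueDegSum (2 * y + 1) n : ℤ) = 2 * y * n - y * (y + 1) +
    ((j : ℤ) - y) * ((j : ℤ) - y - 1) := by rw [h0]; push_cast; ring
  have h2 := mul_pred_nonneg ((j : ℤ) - y)
  rcases h2.lt_or_eq with h2 | h2
  · left; zify; linarith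
  · have h3 : j = y ∨ j = y + 1 := by
      rcases mul_eq_zero.1 h2.symm with h3 | h3 <;> omega
    rcases Nat.lt_or_ge E (cliqueDegSum (2 * y + 1) n) with h4 | h4
    · exact Or.inl h4
    · zify at h4
      exact Or.inr ⟨by zify; linarith, by linarith, h3⟩

/-- A connected graph with more than `s` vertices and no path on `s + 1` vertices has fewer edges
than the union of cliques, or it is the join of a clique and an independent set. -/
lemma Preconnected.degSumIn_lt_or [Fintype V] {s : ℕ} (hG : G.Preconnected)
    (hN : NoPath G (s + 1)) (hs : s < Fintype.card V) (hs2 : 2 ≤ s) :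
    degSumIn G Finset.univ < cliqueDegSum s (Fintype.card V) ∨
    (degSumIn G Finset.univ = cliqueDegSum s (Fintype.card V) ∧ ∃ h, 1 ≤ h ∧ s = 2 * h + 1 ∧
      (Fintype.card V % s = h ∨ Fintype.card V % s = h + 1) ∧
      ∃ Y : Finset V, Y.card = h ∧ (∀ v ∈ Y, degIn G Finset.univ v = Fintype.card V - 1) ∧
        ∀ v, v ∉ Y → degIn G Finset.univ v = h) := by
  -- Saturation preserves the absence of long paths and connectivity and can only raise the degree
  -- sum. If equality is attained by `G`, then no edge was added.
  obtain ⟨H, hGH, hHN, hH⟩ := exists_pathSaturated hN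
  have hHG := hG.mono hGH
  have hle := degSumIn_mono hGH Finset.univ
  obtain ⟨y, hy | hy⟩ : ∃ y, s = 2 * y + 1 ∨ s = 2 * y + 2 := ⟨(s - 1) / 2, by omega⟩
  · rcases hH.degSumIn_le hHG hHN hs (y := y) (by omega) (by omega) with hB | ⟨m, hm, hms, hB⟩
    · have hE := hB Finset.univ (by rw [Finset.card_univ]; omega)
      rw [Finset.card_univ] at hE
      subst hy
      rcases lt_cliqueDegSum_or_of_le_odd hE with h1 | ⟨h1, h2, h3⟩
      · exact Or.inl (hle.trans_lt h1)
      · rcases hle.lt_or_eq with hle | hle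
        · exact Or.inl (h1 ▸ hle)
        · obtain rfl := eq_of_degSumIn_le hGH hle.ge
          exact Or.inr ⟨h1, y, by omega, rfl, h3,
            hH.exists_universal_of_extremal hG hN (by omega) hs hB h2⟩
    · exact Or.inl (hle.trans_lt (lt_cliqueDegSum_of_le hs hms (by omega) hB))
  · rcases hH.degSumIn_le hHG hHN hs (y := y) (by omega) (by omega) with hB | ⟨m, hm, hms, hB⟩
    · have hE := hB Finset.univ (by rw [Finset.card_univ]; omega)
      rw [Finset.card_univ] at hE
      subst hy
      exact Or.inl (hle.trans_lt (lt_cliqueDegSum_of_le_even hs hE))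
    · exact Or.inl (hle.trans_lt (lt_cliqueDegSum_of_le hs hms (by omega) hB))

lemma eq_top_of_degSumIn_ge [Fintype V]
    (h : (Fintype.card V : ℤ) * (Fintype.card V - 1) ≤ degSumIn G Finset.univ) : G = ⊤ := by
  symm
  apply eq_of_degSumIn_le le_top
  have := degSumIn_le (G := (⊤ : SimpleGraph V)) Finset.univ
  rw [Finset.card_univ] at this
  zify
  linarith

lemma cliqueDegSum_le (s n : ℕ) (hs : 1 ≤ s) : cliqueDegSum s n ≤ n * (s - 1) := by
  have h := cliqueDegSum_eq s n
  have h2 : (0 : ℤ) ≤ (n % s : ℕ) * (s - (n % s : ℕ)) :=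
    mul_nonneg (by positivity) (by have := Nat.mod_lt n hs; omega)
  zify [hs]
  linarith

/-- Connected graphs without paths on `s + 1` vertices have average degree less than `s - 1`,
except for the clique on `s` vertices. -/
lemma Preconnected.degSumIn_lt_mul [Fintype V] {s : ℕ} (hG : G.Preconnected)
    (hN : NoPath G (s + 1)) (hs2 : 2 ≤ s) (hV : 0 < Fintype.card V) :
    degSumIn G Finset.univ < Fintype.card V * (s - 1) ∨ (Fintype.card V = s ∧ G = ⊤) := by
  rcases lt_trichotomy (Fintype.card V) s with hlt | heq | hgt
  · left
    have := degSumIn_le (G := G) Finset.univ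
    rw [Finset.card_univ] at this
    zify [show 1 ≤ s by omega]
    nlinarith
  · by_cases htop : G = ⊤
    · exact Or.inr ⟨heq, htop⟩
    · left
      by_contra! hle
      refine htop (eq_top_of_degSumIn_ge ?_)
      rw [← heq] at hle
      zify [show 1 ≤ Fintype.card V by omega] at hle
      exact hle
  · left
    rcases hG.degSumIn_lt_or hN hgt hs2 with h | ⟨h, k, hk, rfl, hmod, -⟩
    · exact h.trans_le (cliqueDegSum_le _ _ (by omega))
    · rw [h]
      have h1 := cliqueDegSum_eq (2 * k + 1) (Fintype.card V)
      generalize Fintype.card V % (2 * k + 1) = j at *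
      -- In the equality case j is k or k + 1, strictly between 0 and 2k + 1, so the union of
      -- cliques is itself strictly below average degree s - 1.
      have h2 : (0 : ℤ) < (j : ℤ) * ((2 * k + 1 : ℕ) - j) :=
        mul_pos (by omega) (by omega)
      zify
      push_cast [show 1 ≤ 2 * k + 1 by omega] at h1 h2 ⊢
      linarith

end SimpleGraph

end

/-! ### Counting matchings by edges and degrees -/

section
namespace SimpleGraph

variable {V : Type*} [Fintype V] (G : SimpleGraph V)

/-- The matchings of `G` with `i` edges, as sets of edges. -/
noncomputable def matchingFinset (i : ℕ) : Finset (Finset (Sym2 V)) :=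
  Finset.univ.filter fun M => (∀ e ∈ M, e ∈ G.edgeSet) ∧ M.card = i ∧
    ∀ e ∈ M, ∀ f ∈ M, e ≠ f → ∀ v, v ∈ e → v ∉ f

/-- The number of matchings of `G` with `i` edges. -/
noncomputable def numMatchings (i : ℕ) : ℕ := (G.matchingFinset i).card

/-- The edges of `G` disjoint from all members of `M`. -/
noncomputable def disjointEdges (M : Finset (Sym2 V)) : Finset (Sym2 V) :=
  Finset.univ.filter fun f => f ∈ G.edgeSet ∧ ∀ e ∈ M, ∀ v, v ∈ e → v ∉ f

/-- The edges of `G` containing `v`. -/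
noncomputable def edgesAt (v : V) : Finset (Sym2 V) :=
  Finset.univ.filter fun f => f ∈ G.edgeSet ∧ v ∈ f

lemma mem_matchingFinset {i : ℕ} {M : Finset (Sym2 V)} :
    M ∈ G.matchingFinset i ↔ (∀ e ∈ M, e ∈ G.edgeSet) ∧ M.card = i ∧
      ∀ e ∈ M, ∀ f ∈ M, e ≠ f → ∀ v, v ∈ e → v ∉ f := by
  simp [matchingFinset]

lemma mem_disjointEdges {M : Finset (Sym2 V)} {f : Sym2 V} :
    f ∈ G.disjointEdges M ↔ f ∈ G.edgeSet ∧ ∀ e ∈ M, ∀ v, v ∈ e → v ∉ f := by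
  simp [disjointEdges]

lemma mem_edgesAt {v : V} {f : Sym2 V} : f ∈ G.edgesAt v ↔ f ∈ G.edgeSet ∧ v ∈ f := by
  simp [edgesAt]

lemma numMatchings_zero : G.numMatchings 0 = 1 := by
  rw [numMatchings, Finset.card_eq_one]
  refine ⟨∅, ?_⟩
  ext M
  rw [mem_matchingFinset, Finset.mem_singleton, Finset.card_eq_zero]
  constructor
  · exact fun h => h.2.1
  · rintro rfl; simp

lemma notMem_of_mem_disjointEdges {M : Finset (Sym2 V)} {f : Sym2 V}
    (hf : f ∈ G.disjointEdges M) : f ∉ M := fun h => by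
  rw [mem_disjointEdges] at hf
  induction f using Sym2.ind with
  | _ a b => exact hf.2 _ h a (by simp) (by simp)

/-- Every matching with `i + 1` edges arises in `i + 1` ways from a matching with `i` edges and an
edge disjoint from it. -/
lemma sum_card_disjointEdges (i : ℕ) :
    ∑ M ∈ G.matchingFinset i, (G.disjointEdges M).card = (i + 1) * G.numMatchings (i + 1) := by
  have h : ∑ M ∈ G.matchingFinset (i + 1), M.card = (i + 1) * G.numMatchings (i + 1) := by
    rw [Finset.sum_congr rfl fun M hM => (G.mem_matchingFinset.1 hM).2.1]
    simp [numMatchings, mul_comm]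
  rw [← h, ← Finset.card_sigma, ← Finset.card_sigma]
  refine Finset.card_bij' (fun p _ => ⟨insert p.2 p.1, p.2⟩) (fun p _ => ⟨p.1.erase p.2, p.2⟩)
    ?_ ?_ ?_ ?_
  · rintro ⟨M, f⟩ hp
    rw [Finset.mem_sigma] at hp ⊢
    have hfM := G.notMem_of_mem_disjointEdges hp.2
    rw [mem_matchingFinset, mem_disjointEdges] at hp
    obtain ⟨⟨h1, h2, h3⟩, h4, h5⟩ := hp
    refine ⟨?_, Finset.mem_insert_self _ _⟩
    rw [mem_matchingFinset]
    refine ⟨by grind, by rw [Finset.card_insert_of_notMem hfM]; exact congrArg (· + 1) h2, ?_⟩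
    intro e he f' hf' hne v hve hvf
    rw [Finset.mem_insert] at he hf'
    rcases he with rfl | he <;> rcases hf' with rfl | hf'
    · exact hne rfl
    · exact h5 _ hf' v hvf hve
    · exact h5 _ he v hve hvf
    · exact h3 _ he _ hf' hne v hve hvf
  · rintro ⟨M, f⟩ hp
    rw [Finset.mem_sigma] at hp ⊢
    rw [mem_matchingFinset] at hp
    obtain ⟨⟨h1, h2, h3⟩, h4⟩ := hp
    rw [mem_matchingFinset, mem_disjointEdges]
    simp only [Finset.mem_erase] at *
    refine ⟨⟨fun e he => h1 e he.2, by rw [Finset.card_erase_of_mem h4]; omega,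
      fun e he f' hf' => h3 e he.2 f' hf'.2⟩, h1 _ h4, fun e he v => h3 e he.2 f h4 he.1 v⟩
  · rintro ⟨M, f⟩ hp
    rw [Finset.mem_sigma] at hp
    have hfM := G.notMem_of_mem_disjointEdges hp.2
    simp [Finset.erase_insert hfM]
  · rintro ⟨M, f⟩ hp
    rw [Finset.mem_sigma] at hp
    simp [Finset.insert_erase hp.2]

lemma sum_matchingFinset_one (φ : Finset (Sym2 V) → ℕ) :
    ∑ M ∈ G.matchingFinset 1, φ M = ∑ e ∈ G.disjointEdges ∅, φ {e} := by
  symm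
  refine Finset.sum_bij (fun e _ => {e}) ?_ ?_ ?_ ?_
  · intro e he
    rw [mem_disjointEdges] at he
    rw [mem_matchingFinset]
    simp [he.1]
  · intro e _ f _ h
    simpa using h
  · intro M hM
    rw [mem_matchingFinset, Finset.card_eq_one] at hM
    obtain ⟨h1, ⟨e, rfl⟩, -⟩ := hM
    exact ⟨e, by rw [mem_disjointEdges]; simp at h1 ⊢; exact h1, rfl⟩
  · intros; rfl

lemma numMatchings_one : G.numMatchings 1 = (G.disjointEdges ∅).card := by
  rw [numMatchings, Finset.card_eq_sum_ones, sum_matchingFinset_one, ← Finset.card_eq_sum_ones]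

lemma card_edgesAt (v : V) : (G.edgesAt v).card = degIn G Finset.univ v := by
  rw [degIn]
  symm
  refine Finset.card_bij (fun w _ => s(v, w)) ?_ ?_ ?_
  · intro w hw
    rw [mem_edgesAt]
    simpa using hw
  · intro w _ w' _ h
    exact Sym2.congr_right.1 h
  · intro f hf
    rw [mem_edgesAt] at hf
    obtain ⟨w, rfl⟩ := Sym2.mem_iff_exists.1 hf.2
    exact ⟨w, by simpa using hf.1, rfl⟩

lemma filter_mem_sym2 {a b : V} : (Finset.univ.filter fun v => v ∈ s(a, b)) = {a, b} := by
  ext v; simp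

lemma sum_sum_mem_edges (φ : V → ℕ) :
    ∑ e ∈ G.disjointEdges ∅, ∑ v with v ∈ e, φ v = ∑ v, φ v * degIn G Finset.univ v := by
  simp_rw [Finset.sum_filter]
  rw [Finset.sum_comm]
  refine Finset.sum_congr rfl fun v _ => ?_
  rw [← Finset.sum_filter, Finset.sum_const, ← card_edgesAt, smul_eq_mul, mul_comm]
  congr 2
  ext f
  simp [mem_disjointEdges, mem_edgesAt]

lemma two_mul_numMatchings_one : 2 * G.numMatchings 1 = degSumIn G Finset.univ := by
  have h := G.sum_sum_mem_edges fun _ => 1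
  simp only [one_mul] at h
  rw [degSumIn, ← h, numMatchings_one, mul_comm, ← smul_eq_mul, ← Finset.sum_const]
  refine Finset.sum_congr rfl fun e he => ?_
  rw [mem_disjointEdges] at he
  induction e using Sym2.ind with
  | _ a b =>
    have hab : a ≠ b := (mem_edgeSet G).1 he.1 |>.ne
    rw [filter_mem_sym2, Finset.sum_pair hab]

/-- The edges meeting `e` are counted by the degrees of its ends, with `e` itself counted twice;
hence the additional one. -/
lemma card_disjointEdges_singleton {e : Sym2 V} (he : e ∈ G.edgeSet) :
    (G.disjointEdges {e}).card + ∑ v with v ∈ e, degIn G Finset.univ v =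
      G.numMatchings 1 + 1 := by
  induction e using Sym2.ind with
  | _ a b =>
  rw [mem_edgeSet] at he
  rw [filter_mem_sym2, Finset.sum_pair he.ne, ← card_edgesAt, ← card_edgesAt,
    ← Finset.card_union_add_card_inter, numMatchings_one]
  have h1 : G.edgesAt a ∩ G.edgesAt b = {s(a, b)} := by
    ext f
    rw [Finset.mem_inter, mem_edgesAt, mem_edgesAt, Finset.mem_singleton]
    constructor
    · rintro ⟨⟨-, h1⟩, -, h2⟩
      exact ((Sym2.mem_and_mem_iff he.ne).1 ⟨h1, h2⟩)
    · rintro rfl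
      simp [he]
  have h2 : G.disjointEdges ∅ = G.disjointEdges {s(a, b)} ∪ (G.edgesAt a ∪ G.edgesAt b) := by
    ext f
    simp only [mem_disjointEdges, mem_edgesAt, Finset.mem_union]
    simp
    tauto
  have h3 : Disjoint (G.disjointEdges {s(a, b)}) (G.edgesAt a ∪ G.edgesAt b) := by
    rw [Finset.disjoint_left]
    intro f hf
    simp only [mem_disjointEdges, mem_edgesAt, Finset.mem_union] at hf ⊢
    simp at hf
    tauto
  rw [h1, Finset.card_singleton, h2, Finset.card_union_of_disjoint h3]
  ring

/-- Sum `card_disjointEdges_singleton` over all edges: the degree of a vertex occurs once for each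
edge at it, which gives the squares. -/
lemma two_mul_numMatchings_two :
    2 * G.numMatchings 2 + ∑ v, degIn G Finset.univ v ^ 2 =
      G.numMatchings 1 * (G.numMatchings 1 + 1) := by
  have h := G.sum_card_disjointEdges 1
  rw [show 1 + 1 = 2 from rfl] at h
  rw [← h, sum_matchingFinset_one]
  simp_rw [pow_two]
  rw [← sum_sum_mem_edges, ← Finset.sum_add_distrib,
    Finset.sum_congr rfl fun e he =>
      G.card_disjointEdges_singleton (G.mem_disjointEdges.1 he).1, Finset.sum_const,
    ← numMatchings_one, smul_eq_mul]

lemma disjointEdges_subset (M : Finset (Sym2 V)) : G.disjointEdges M ⊆ G.disjointEdges ∅ := by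
  intro f hf
  rw [mem_disjointEdges] at hf ⊢
  exact ⟨hf.1, by simp⟩

lemma succ_mul_numMatchings_le (i : ℕ) :
    (i + 1) * G.numMatchings (i + 1) ≤ G.numMatchings i * G.numMatchings 1 := by
  rw [← sum_card_disjointEdges, numMatchings_one, numMatchings, ← smul_eq_mul]
  exact Finset.sum_le_card_nsmul _ _ _ fun M _ => Finset.card_le_card (G.disjointEdges_subset M)

/-- Ordered matchings are among the sequences of edges. -/
lemma factorial_mul_numMatchings_le (i : ℕ) :
    i.factorial * G.numMatchings i ≤ G.numMatchings 1 ^ i := by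
  induction i with
  | zero => simp [numMatchings_zero]
  | succ i ih =>
    calc (i + 1).factorial * G.numMatchings (i + 1)
        = i.factorial * ((i + 1) * G.numMatchings (i + 1)) := by rw [Nat.factorial_succ]; ring
      _ ≤ i.factorial * (G.numMatchings i * G.numMatchings 1) :=
          Nat.mul_le_mul_left _ (G.succ_mul_numMatchings_le i)
      _ = i.factorial * G.numMatchings i * G.numMatchings 1 := by ring
      _ ≤ G.numMatchings 1 ^ i * G.numMatchings 1 := Nat.mul_le_mul_right _ ih
      _ = _ := by ring

/-- Only the first two edges of an ordered matching are required to be disjoint, so a deficit in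
`m_2` carries over to all larger matchings. -/
lemma factorial_mul_numMatchings_add_two_le (i : ℕ) :
    (i + 2).factorial * G.numMatchings (i + 2) ≤
      2 * G.numMatchings 2 * G.numMatchings 1 ^ i := by
  induction i with
  | zero => simp [Nat.factorial]
  | succ i ih =>
    calc (i + 1 + 2).factorial * G.numMatchings (i + 1 + 2)
        = (i + 2).factorial * ((i + 2 + 1) * G.numMatchings (i + 2 + 1)) := by
          rw [show i + 1 + 2 = i + 2 + 1 by ring, Nat.factorial_succ]; ring
      _ ≤ (i + 2).factorial * (G.numMatchings (i + 2) * G.numMatchings 1) :=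
          Nat.mul_le_mul_left _ (G.succ_mul_numMatchings_le _)
      _ = (i + 2).factorial * G.numMatchings (i + 2) * G.numMatchings 1 := by ring
      _ ≤ 2 * G.numMatchings 2 * G.numMatchings 1 ^ i * G.numMatchings 1 :=
          Nat.mul_le_mul_right _ ih
      _ = _ := by ring

lemma numMatchings_one_le_card_disjointEdges {Δ : ℕ} (hΔ : ∀ v, degIn G Finset.univ v ≤ Δ)
    (M : Finset (Sym2 V)) :
    G.numMatchings 1 ≤ (G.disjointEdges M).card + 2 * M.card * Δ := by
  have hsub : G.disjointEdges ∅ ⊆ G.disjointEdges M ∪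
      M.biUnion fun e => (Finset.univ.filter fun v => v ∈ e).biUnion G.edgesAt := by
    intro f hf
    rw [mem_disjointEdges] at hf
    simp only [Finset.mem_union, mem_disjointEdges, Finset.mem_biUnion, mem_edgesAt,
      Finset.mem_filter, Finset.mem_univ, true_and]
    by_cases h : ∀ e ∈ M, ∀ v, v ∈ e → v ∉ f
    · exact Or.inl ⟨hf.1, h⟩
    · push Not at h
      obtain ⟨e, he, v, hv, hvf⟩ := h
      exact Or.inr ⟨e, he, v, hv, hf.1, hvf⟩
  have hcard : (M.biUnion fun e => (Finset.univ.filter fun v => v ∈ e).biUnion G.edgesAt).card ≤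
      M.card * (2 * Δ) := by
    refine Finset.card_biUnion_le_card_mul _ _ _ fun e _ => ?_
    refine (Finset.card_biUnion_le_card_mul _ _ Δ fun v _ => ?_).trans ?_
    · rw [card_edgesAt]; exact hΔ v
    · refine Nat.mul_le_mul_right _ ?_
      induction e using Sym2.ind with
      | _ a b => rw [filter_mem_sym2]; exact Finset.card_le_two
  rw [numMatchings_one]
  have := (Finset.card_le_card hsub).trans (Finset.card_union_le _ _)
  linarith

lemma mul_le_succ_mul_numMatchings {Δ : ℕ} (hΔ : ∀ v, degIn G Finset.univ v ≤ Δ) (i : ℕ) :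
    G.numMatchings i * (G.numMatchings 1 - 2 * i * Δ) ≤ (i + 1) * G.numMatchings (i + 1) := by
  rw [← sum_card_disjointEdges, numMatchings, ← smul_eq_mul]
  refine Finset.card_nsmul_le_sum _ _ _ fun M hM => ?_
  have := G.numMatchings_one_le_card_disjointEdges hΔ M
  rw [(G.mem_matchingFinset.1 hM).2.1] at this
  exact Nat.sub_le_iff_le_add.2 this

/-- Fewer than `t` chosen edges have fewer than 2t ends, which block at most 2tΔ edges. With
truncated subtraction the bound is harmless for graphs with few edges. -/
lemma pow_le_factorial_mul_numMatchings {Δ t : ℕ} (hΔ : ∀ v, degIn G Finset.univ v ≤ Δ) (i : ℕ)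
    (hi : i ≤ t) : (G.numMatchings 1 - 2 * t * Δ) ^ i ≤ i.factorial * G.numMatchings i := by
  induction i with
  | zero => simp [numMatchings_zero]
  | succ i ih =>
    have hle : G.numMatchings 1 - 2 * t * Δ ≤ G.numMatchings 1 - 2 * i * Δ := by
      apply Nat.sub_le_sub_left
      gcongr
      omega
    calc (G.numMatchings 1 - 2 * t * Δ) ^ (i + 1)
        = (G.numMatchings 1 - 2 * t * Δ) ^ i * (G.numMatchings 1 - 2 * t * Δ) := pow_succ _ _
      _ ≤ (i.factorial * G.numMatchings i) * (G.numMatchings 1 - 2 * i * Δ) :=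
          Nat.mul_le_mul (ih (by omega)) hle
      _ = i.factorial * (G.numMatchings i * (G.numMatchings 1 - 2 * i * Δ)) := by ring
      _ ≤ i.factorial * ((i + 1) * G.numMatchings (i + 1)) :=
          Nat.mul_le_mul_left _ (G.mul_le_succ_mul_numMatchings hΔ i)
      _ = _ := by rw [Nat.factorial_succ]; ring

end SimpleGraph

end

/-! ### Generating functions, disjoint unions and components -/

section
namespace SimpleGraph

variable {V W : Type*} {G : SimpleGraph V} {H : SimpleGraph W}

lemma NoPath.of_hom_injective {N : ℕ} (hN : NoPath H N) (f : G →g H)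
    (hf : Function.Injective f) : NoPath G N := by
  intro l hn hc
  have := hN (l.map f) (hn.map hf) (by
    rw [List.isChain_map]
    exact hc.imp fun a b hab => f.map_adj hab)
  simpa using this

lemma mem_edgeSet_sum {e : Sym2 (V ⊕ W)} :
    e ∈ (G ⊕g H).edgeSet ↔ (∃ e' ∈ G.edgeSet, e'.map Sum.inl = e) ∨
      ∃ e' ∈ H.edgeSet, e'.map Sum.inr = e := by
  constructor
  · induction e using Sym2.ind with
    | _ a b =>
      intro h
      rcases a with a | a <;> rcases b with b | b <;> simp at h
      · exact Or.inl ⟨s(a, b), h, rfl⟩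
      · exact Or.inr ⟨s(a, b), h, rfl⟩
  · rintro (⟨e, he, rfl⟩ | ⟨e, he, rfl⟩) <;> induction e using Sym2.ind with
    | _ a b => simpa using he

section counting

variable [Fintype V] [Fintype W]

lemma numMatchings_eq_of_iso (f : G ≃g H) (i : ℕ) : G.numMatchings i = H.numMatchings i := by
  have hmem : ∀ (e : Sym2 V) (v : V), f v ∈ e.map f ↔ v ∈ e := fun e v => by
    rw [Sym2.mem_map]
    exact ⟨fun ⟨a, ha, h⟩ => f.injective h ▸ ha, fun h => ⟨v, h, rfl⟩⟩
  have hinj : Function.Injective (Sym2.map f) := Sym2.map.injective f.injective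
  have hedge : ∀ e : Sym2 V, e.map f ∈ H.edgeSet ↔ e ∈ G.edgeSet := fun e => by
    induction e using Sym2.ind with
    | _ a b => simpa using f.map_adj_iff
  have hsurj : Function.Surjective (Sym2.map f) := by
    intro e
    induction e using Sym2.ind with
    | _ a b => exact ⟨s(f.symm a, f.symm b), by simp⟩
  refine Finset.card_bij (fun M _ => M.image (Sym2.map f)) ?_ ?_ ?_
  · intro M hM
    rw [mem_matchingFinset] at hM ⊢
    refine ⟨?_, by rw [Finset.card_image_of_injective _ hinj]; exact hM.2.1, ?_⟩
    · intro e he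
      obtain ⟨e, he₀, rfl⟩ := Finset.mem_image.1 he
      exact (hedge e).2 (hM.1 e he₀)
    · intro e he e' he' hne v hv
      obtain ⟨e, he₀, rfl⟩ := Finset.mem_image.1 he
      obtain ⟨e', he₀', rfl⟩ := Finset.mem_image.1 he'
      obtain ⟨v, rfl⟩ := f.surjective v
      rw [hmem] at hv ⊢
      exact hM.2.2 e he₀ e' he₀' (fun h => hne (h ▸ rfl)) v hv
  · intro M _ M' _ h
    exact Finset.image_injective hinj h
  · intro M hM
    rw [mem_matchingFinset] at hM
    have hMe : (Finset.univ.filter fun e => Sym2.map f e ∈ M).image (Sym2.map f) = M := by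
      ext e
      obtain ⟨e, rfl⟩ := hsurj e
      simp [hinj.eq_iff]
    refine ⟨Finset.univ.filter fun e => Sym2.map f e ∈ M, ?_, hMe⟩
    rw [mem_matchingFinset]
    refine ⟨fun e he => ?_, ?_, fun e he e' he' hne v hv => ?_⟩
    · exact (hedge e).1 (hM.1 _ (by simpa using he))
    · rw [← Finset.card_image_of_injective _ hinj, hMe]; exact hM.2.1
    · rw [← hmem] at hv ⊢
      exact hM.2.2 _ (by simpa using he) _ (by simpa using he') (fun h => hne (hinj h)) _ hv

lemma numMatchings_sum (n : ℕ) : (G ⊕g H).numMatchings n =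
    ∑ p ∈ Finset.HasAntidiagonal.antidiagonal n, G.numMatchings p.1 * H.numMatchings p.2 := by
  have hl : Function.Injective (Sym2.map (Sum.inl : V → V ⊕ W)) :=
    Sym2.map.injective Sum.inl_injective
  have hr : Function.Injective (Sym2.map (Sum.inr : W → V ⊕ W)) :=
    Sym2.map.injective Sum.inr_injective
  have hlr : ∀ (e : Sym2 V) (f : Sym2 W), e.map Sum.inl ≠ f.map Sum.inr := by
    intro e f
    induction e using Sym2.ind with
    | _ a b => induction f using Sym2.ind with
      | _ c d => simp
  have hedl : ∀ e : Sym2 V, e.map Sum.inl ∈ (G ⊕g H).edgeSet ↔ e ∈ G.edgeSet := by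
    intro e
    rw [mem_edgeSet_sum]
    constructor
    · rintro (⟨e', he', h⟩ | ⟨e', he', h⟩)
      · exact hl h ▸ he'
      · exact absurd h.symm (hlr _ _)
    · exact fun h => Or.inl ⟨e, h, rfl⟩
  have hedr : ∀ e : Sym2 W, e.map Sum.inr ∈ (G ⊕g H).edgeSet ↔ e ∈ H.edgeSet := by
    intro e
    rw [mem_edgeSet_sum]
    constructor
    · rintro (⟨e', he', h⟩ | ⟨e', he', h⟩)
      · exact absurd h (hlr _ _)
      · exact hr h ▸ he'
    · exact fun h => Or.inr ⟨e, h, rfl⟩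
  simp_rw [numMatchings, ← Finset.card_product]
  rw [← Finset.card_sigma]
  symm
  have hcard : ∀ (M₁ : Finset (Sym2 V)) (M₂ : Finset (Sym2 W)),
      (M₁.image (Sym2.map Sum.inl) ∪ M₂.image (Sym2.map Sum.inr)).card = M₁.card + M₂.card := by
    intro M₁ M₂
    rw [Finset.card_union_of_disjoint, Finset.card_image_of_injective _ hl,
      Finset.card_image_of_injective _ hr]
    rw [Finset.disjoint_left]
    intro e he he'
    obtain ⟨e, he, rfl⟩ := Finset.mem_image.1 he
    obtain ⟨e', he', h⟩ := Finset.mem_image.1 he'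
    exact hlr _ _ h.symm
  have hfl : ∀ (M₁ : Finset (Sym2 V)) (M₂ : Finset (Sym2 W)),
      (Finset.univ.filter fun e : Sym2 V => e.map Sum.inl ∈
        M₁.image (Sym2.map Sum.inl) ∪ M₂.image (Sym2.map Sum.inr)) = M₁ := by
    intro M₁ M₂
    ext e
    simp only [Finset.mem_filter, Finset.mem_univ, true_and, Finset.mem_union, Finset.mem_image]
    constructor
    · rintro (⟨e', he', h⟩ | ⟨e', he', h⟩)
      · exact hl h ▸ he'
      · exact absurd h.symm (hlr _ _)
    · exact fun h => Or.inl ⟨e, h, rfl⟩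
  have hfr : ∀ (M₁ : Finset (Sym2 V)) (M₂ : Finset (Sym2 W)),
      (Finset.univ.filter fun e : Sym2 W => e.map Sum.inr ∈
        M₁.image (Sym2.map Sum.inl) ∪ M₂.image (Sym2.map Sum.inr)) = M₂ := by
    intro M₁ M₂
    ext e
    simp only [Finset.mem_filter, Finset.mem_univ, true_and, Finset.mem_union, Finset.mem_image]
    constructor
    · rintro (⟨e', he', h⟩ | ⟨e', he', h⟩)
      · exact absurd h (hlr _ _)
      · exact hr h ▸ he'
    · exact fun h => Or.inr ⟨e, h, rfl⟩
  refine Finset.card_bij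
    (fun p _ => p.2.1.image (Sym2.map Sum.inl) ∪ p.2.2.image (Sym2.map Sum.inr)) ?_ ?_ ?_
  · rintro ⟨⟨i, j⟩, M₁, M₂⟩ h
    simp only [Finset.mem_sigma, Finset.mem_product, Finset.HasAntidiagonal.mem_antidiagonal,
      mem_matchingFinset] at h
    obtain ⟨hij, ⟨h1, h2, h3⟩, h4, h5, h6⟩ := h
    rw [mem_matchingFinset]
    refine ⟨?_, by
      rw [hcard]; exact (congrArg₂ (· + ·) h2 h5).trans hij, ?_⟩
    · intro e he
      rw [Finset.mem_union, Finset.mem_image, Finset.mem_image] at he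
      rcases he with ⟨e, he, rfl⟩ | ⟨e, he, rfl⟩
      · exact (hedl e).2 (h1 e he)
      · exact (hedr e).2 (h4 e he)
    · intro e he f hf hne v hv hv'
      rw [Finset.mem_union, Finset.mem_image, Finset.mem_image] at he hf
      rcases he with ⟨e, he, rfl⟩ | ⟨e, he, rfl⟩ <;> rcases hf with ⟨f, hf, rfl⟩ | ⟨f, hf, rfl⟩ <;>
        rw [Sym2.mem_map] at hv hv' <;> obtain ⟨a, ha, rfl⟩ := hv <;>
        obtain ⟨b, hb, hab⟩ := hv'
      · obtain rfl := Sum.inl_injective hab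
        exact h3 e he f hf (fun h => hne (h ▸ rfl)) _ ha hb
      · cases hab
      · cases hab
      · obtain rfl := Sum.inr_injective hab
        exact h6 e he f hf (fun h => hne (h ▸ rfl)) _ ha hb
  · rintro ⟨⟨i, j⟩, M₁, M₂⟩ h ⟨⟨i', j'⟩, M₁', M₂'⟩ h' heq
    simp only [Finset.mem_sigma, Finset.mem_product, Finset.HasAntidiagonal.mem_antidiagonal,
      mem_matchingFinset] at h h' heq
    have e1 : M₁ = M₁' := by rw [← hfl M₁ M₂, heq, hfl]
    have e2 : M₂ = M₂' := by rw [← hfr M₁ M₂, heq, hfr]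
    subst e1 e2
    obtain ⟨-, ⟨-, rfl, -⟩, -, rfl, -⟩ := h
    obtain ⟨-, ⟨-, rfl, -⟩, -, rfl, -⟩ := h'
    rfl
  · intro M hM
    rw [mem_matchingFinset] at hM
    obtain ⟨h1, h2, h3⟩ := hM
    let M₁ : Finset (Sym2 V) := Finset.univ.filter fun e => e.map Sum.inl ∈ M
    let M₂ : Finset (Sym2 W) := Finset.univ.filter fun e => e.map Sum.inr ∈ M
    have hMe : M₁.image (Sym2.map Sum.inl) ∪ M₂.image (Sym2.map Sum.inr) = M := by
      ext e
      rw [Finset.mem_union, Finset.mem_image, Finset.mem_image]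
      constructor
      · rintro (⟨e, he, rfl⟩ | ⟨e, he, rfl⟩)
        · simpa [M₁] using he
        · simpa [M₂] using he
      · intro he
        rcases mem_edgeSet_sum.1 (h1 e he) with ⟨e, -, rfl⟩ | ⟨e, -, rfl⟩
        · exact Or.inl ⟨e, by simpa [M₁] using he, rfl⟩
        · exact Or.inr ⟨e, by simpa [M₂] using he, rfl⟩
    refine ⟨⟨(M₁.card, M₂.card), M₁, M₂⟩, ?_, hMe⟩
    simp only [Finset.mem_sigma, Finset.mem_product, Finset.HasAntidiagonal.mem_antidiagonal,
      mem_matchingFinset]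
    refine ⟨by rw [← hcard, hMe, h2], ⟨fun e he => ?_, trivial, fun e he f hf hne v hv hv' => ?_⟩,
      fun e he => ?_, trivial, fun e he f hf hne v hv hv' => ?_⟩
    · exact (hedl e).1 (h1 _ (by simpa [M₁] using he))
    · exact h3 _ (by simpa [M₁] using he) _ (by simpa [M₁] using hf) (fun h => hne (hl h))
        (Sum.inl v) (Sym2.mem_map.2 ⟨v, hv, rfl⟩) (Sym2.mem_map.2 ⟨v, hv', rfl⟩)
    · exact (hedr e).1 (h1 _ (by simpa [M₂] using he))
    · exact h3 _ (by simpa [M₂] using he) _ (by simpa [M₂] using hf) (fun h => hne (hr h))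
        (Sum.inr v) (Sym2.mem_map.2 ⟨v, hv, rfl⟩) (Sym2.mem_map.2 ⟨v, hv', rfl⟩)

/-- The generating function of the numbers of matchings. -/
noncomputable def matchingSeries {V : Type*} [Fintype V] (G : SimpleGraph V) : PowerSeries ℕ :=
  PowerSeries.mk G.numMatchings

@[simp] lemma coeff_matchingSeries (i : ℕ) :
    PowerSeries.coeff i G.matchingSeries = G.numMatchings i := by
  simp [matchingSeries]

lemma matchingSeries_eq_of_iso (f : G ≃g H) : G.matchingSeries = H.matchingSeries := by
  ext i; simp [numMatchings_eq_of_iso f]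

lemma matchingSeries_sum :
    (G ⊕g H).matchingSeries = G.matchingSeries * H.matchingSeries := by
  ext i; simp [PowerSeries.coeff_mul, numMatchings_sum]

lemma matchingSeries_of_isEmpty [IsEmpty V] : G.matchingSeries = 1 := by
  ext i
  rw [coeff_matchingSeries, PowerSeries.coeff_one]
  split_ifs with h
  · rw [h, numMatchings_zero]
  · rw [numMatchings, Finset.card_eq_zero, Finset.eq_empty_iff_forall_notMem]
    intro M hM
    rw [mem_matchingFinset] at hM
    have : M = ∅ := Finset.eq_empty_of_isEmpty M
    rw [this] at hM
    simp at hM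
    omega

lemma degIn_inl (v : V) : degIn (G ⊕g H) Finset.univ (Sum.inl v) = degIn G Finset.univ v := by
  rw [degIn, degIn]
  symm
  refine Finset.card_bij (fun w _ => Sum.inl w) ?_ ?_ ?_
  · intro w hw; simpa using hw
  · intro w _ w' _ h; exact Sum.inl_injective h
  · rintro (w | w) hw
    · exact ⟨w, by simpa using hw, rfl⟩
    · simp at hw

lemma degIn_inr (v : W) : degIn (G ⊕g H) Finset.univ (Sum.inr v) = degIn H Finset.univ v := by
  rw [degIn, degIn]
  symm
  refine Finset.card_bij (fun w _ => Sum.inr w) ?_ ?_ ?_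
  · intro w hw; simpa using hw
  · intro w _ w' _ h; exact Sum.inr_injective h
  · rintro (w | w) hw
    · simp at hw
    · exact ⟨w, by simpa using hw, rfl⟩

lemma sum_degIn_sum (φ : ℕ → ℕ) : ∑ v, φ (degIn (G ⊕g H) Finset.univ v) =
    ∑ v, φ (degIn G Finset.univ v) + ∑ v, φ (degIn H Finset.univ v) := by
  rw [Fintype.sum_sum_type]
  simp_rw [degIn_inl, degIn_inr]

end counting

/-- A graph is the disjoint union of its restrictions to a union of components and to the rest. -/
noncomputable def isoSumOfClosed (S : Set V) (hS : ∀ u v, u ∈ S → G.Adj u v → v ∈ S) :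
    G.induce S ⊕g G.induce Sᶜ ≃g G where
  toEquiv := Equiv.Set.sumCompl S
  map_rel_iff' := by
    rintro (⟨u, hu⟩ | ⟨u, hu⟩) (⟨v, hv⟩ | ⟨v, hv⟩)
    · simp
    · simp; exact fun h => hv (hS _ _ hu h)
    · simp; exact fun h => hu (hS _ _ hv h.symm)
    · simp

universe u in
/-- A property of graphs holds if it is invariant under isomorphisms, stable under disjoint unions,
and holds for empty and connected graphs. -/
theorem induction_on_components {P : ∀ {V : Type u} [Fintype V], SimpleGraph V → Prop}
    (iso : ∀ {V W : Type u} [Fintype V] [Fintype W] {G : SimpleGraph V} {H : SimpleGraph W},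
      G ≃g H → P G → P H)
    (sum : ∀ {V W : Type u} [Fintype V] [Fintype W] {G : SimpleGraph V} {H : SimpleGraph W},
      P G → P H → P (G ⊕g H))
    (empty : ∀ {V : Type u} [Fintype V] [IsEmpty V] {G : SimpleGraph V}, P G)
    (connected : ∀ {V : Type u} [Fintype V] {G : SimpleGraph V}, 0 < Fintype.card V →
      G.Preconnected → P G)
    {V : Type u} [Fintype V] (G : SimpleGraph V) : P G := by
  generalize hn : Fintype.card V = n
  induction n using Nat.strong_induction_on generalizing V with
  | _ n ih =>
    subst hn
    rcases Nat.eq_zero_or_pos (Fintype.card V) with h0 | hpos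
    · have := Fintype.card_eq_zero_iff.1 h0
      exact empty
    by_cases hG : G.Preconnected
    · exact connected hpos hG
    rw [Preconnected] at hG
    push Not at hG
    obtain ⟨u, v, huv⟩ := hG
    let S : Set V := {w | G.Reachable u w}
    have hS : ∀ a b, a ∈ S → G.Adj a b → b ∈ S := fun a b ha hab =>
      Reachable.trans ha hab.reachable
    have hu : u ∈ S := Reachable.refl u
    have hv : v ∉ S := huv
    refine iso (isoSumOfClosed S hS) (sum (ih _ ?_ _ rfl) (ih _ ?_ _ rfl))
    · exact Fintype.card_subtype_lt hv
    · exact Fintype.card_subtype_lt (x := u) (by simpa using hu)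

end SimpleGraph

end

/-! ### The lexicographic comparison with the union of cliques -/

section
namespace SimpleGraph

variable {V W : Type*} {G : SimpleGraph V} {H : SimpleGraph W}

lemma NoPath.left_of_sum {N : ℕ} (hN : NoPath (G ⊕g H) N) : NoPath G N :=
  hN.of_hom_injective (Embedding.sumInl (G := G) (H := H)).toHom Sum.inl_injective

lemma NoPath.right_of_sum {N : ℕ} (hN : NoPath (G ⊕g H) N) : NoPath H N :=
  hN.of_hom_injective (Embedding.sumInr (G := G) (H := H)).toHom Sum.inr_injective

section counting

variable [Fintype V] [Fintype W]

lemma numMatchings_le_of_injective (f : G →g H) (hf : Function.Injective f) (i : ℕ) :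
    G.numMatchings i ≤ H.numMatchings i := by
  have hinj : Function.Injective (Sym2.map f) := Sym2.map.injective hf
  refine Finset.card_le_card_of_injOn (fun M => M.image (Sym2.map f)) ?_
    fun M _ M' _ h => Finset.image_injective hinj h
  intro M hM
  rw [Finset.mem_coe, mem_matchingFinset] at hM ⊢
  refine ⟨?_, by rw [Finset.card_image_of_injective _ hinj]; exact hM.2.1, ?_⟩
  · intro e he
    obtain ⟨e, he₀, rfl⟩ := Finset.mem_image.1 he
    have := hM.1 e he₀
    induction e using Sym2.ind with
    | _ a b => exact f.map_adj this
  · intro e he e' he' hne v hv hv'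
    obtain ⟨e, he₀, rfl⟩ := Finset.mem_image.1 he
    obtain ⟨e', he₀', rfl⟩ := Finset.mem_image.1 he'
    obtain ⟨a, ha, rfl⟩ := Sym2.mem_map.1 hv
    obtain ⟨b, hb, hab⟩ := Sym2.mem_map.1 hv'
    obtain rfl := hf hab
    exact hM.2.2 e he₀ e' he₀' (fun h => hne (h ▸ rfl)) _ ha hb

end counting

/-- Comparison of the first coefficients, then of the second ones, then of all. -/
def LexLE (f g : PowerSeries ℕ) : Prop :=
  PowerSeries.coeff 1 f < PowerSeries.coeff 1 g ∨
    (PowerSeries.coeff 1 f = PowerSeries.coeff 1 g ∧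
      (PowerSeries.coeff 2 f < PowerSeries.coeff 2 g ∨
        ∀ i, PowerSeries.coeff i f ≤ PowerSeries.coeff i g))

lemma LexLE.of_le {f g : PowerSeries ℕ}
    (h : ∀ i, PowerSeries.coeff i f ≤ PowerSeries.coeff i g) : LexLE f g := by
  rcases (h 1).lt_or_eq with h1 | h1
  · exact Or.inl h1
  · exact Or.inr ⟨h1, Or.inr h⟩

lemma LexLE.trans {f g k : PowerSeries ℕ} (h : LexLE f g) (h' : LexLE g k) : LexLE f k := by
  rcases h with h | ⟨h, h2 | h2⟩ <;> rcases h' with h' | ⟨h', h2' | h2'⟩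
  · exact Or.inl (h.trans h')
  · exact Or.inl (h' ▸ h)
  · exact Or.inl (h' ▸ h)
  · exact Or.inl (h ▸ h')
  · exact Or.inr ⟨h.trans h', Or.inl (h2.trans h2')⟩
  · exact Or.inr ⟨h.trans h', Or.inl (h2.trans_le (h2' 2))⟩
  · exact Or.inl (h ▸ h')
  · exact Or.inr ⟨h.trans h', Or.inl ((h2 2).trans_lt h2')⟩
  · exact Or.inr ⟨h.trans h', Or.inr fun i => (h2 i).trans (h2' i)⟩

lemma coeff_one_mul' (f g : PowerSeries ℕ) (hf : PowerSeries.coeff 0 f = 1)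
    (hg : PowerSeries.coeff 0 g = 1) :
    PowerSeries.coeff 1 (f * g) = PowerSeries.coeff 1 f + PowerSeries.coeff 1 g := by
  rw [PowerSeries.coeff_mul, Finset.Nat.sum_antidiagonal_eq_sum_range_succ_mk]
  simp only [Finset.sum_range_succ, Finset.sum_range_zero, hf, hg]
  simp [add_comm]

lemma coeff_two_mul' (f g : PowerSeries ℕ) (hf : PowerSeries.coeff 0 f = 1)
    (hg : PowerSeries.coeff 0 g = 1) :
    PowerSeries.coeff 2 (f * g) = PowerSeries.coeff 2 f +
      PowerSeries.coeff 1 f * PowerSeries.coeff 1 g + PowerSeries.coeff 2 g := by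
  rw [PowerSeries.coeff_mul, Finset.Nat.sum_antidiagonal_eq_sum_range_succ_mk]
  simp only [Finset.sum_range_succ, Finset.sum_range_zero, hf, hg]
  norm_num
  ring

lemma coeff_zero_mul' (f g : PowerSeries ℕ) (hf : PowerSeries.coeff 0 f = 1)
    (hg : PowerSeries.coeff 0 g = 1) : PowerSeries.coeff 0 (f * g) = 1 := by
  rw [PowerSeries.coeff_mul, Finset.Nat.sum_antidiagonal_eq_sum_range_succ_mk]
  simp only [Finset.sum_range_succ, Finset.sum_range_zero]
  simp [hf, hg]

/-- With constant terms one, the linear coefficients add, and the quadratic ones add up to a cross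
term that depends only on the linear ones. A tie in the linear coefficient is therefore broken as in
the factors. -/
lemma LexLE.mul {f g f' g' : PowerSeries ℕ} (hf : PowerSeries.coeff 0 f = 1)
    (hg : PowerSeries.coeff 0 g = 1) (hf' : PowerSeries.coeff 0 f' = 1)
    (hg' : PowerSeries.coeff 0 g' = 1) (h : LexLE f g) (h' : LexLE f' g') :
    LexLE (f * f') (g * g') := by
  have a1 := coeff_one_mul' f f' hf hf'
  have a2 := coeff_one_mul' g g' hg hg'
  have b1 := coeff_two_mul' f f' hf hf'
  have b2 := coeff_two_mul' g g' hg hg'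
  rcases h with h | ⟨h, h2⟩ <;> rcases h' with h' | ⟨h', h2'⟩
  · exact Or.inl (by omega)
  · exact Or.inl (by omega)
  · exact Or.inl (by omega)
  refine Or.inr ⟨by omega, ?_⟩
  rw [b1, b2, h, h']
  rcases h2 with h2 | h2 <;> rcases h2' with h2' | h2'
  · exact Or.inl (by omega)
  · exact Or.inl (by have := h2' 2; omega)
  · exact Or.inl (by have := h2 2; omega)
  · right
    intro i
    rw [PowerSeries.coeff_mul, PowerSeries.coeff_mul]
    exact Finset.sum_le_sum fun p _ => Nat.mul_le_mul (h2 _) (h2' _)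

/-- The generating function of the numbers of matchings of the disjoint union of `n / s` cliques on
`s` vertices and a clique on `n % s` vertices. -/
noncomputable def cliqueSeries (s n : ℕ) : PowerSeries ℕ :=
  (⊤ : SimpleGraph (Fin s)).matchingSeries ^ (n / s) *
    (⊤ : SimpleGraph (Fin (n % s))).matchingSeries

/-- `f` has constant coefficient one, its linear coefficient is half of `d`, and its second
coefficient is that of a graph with sum of squares of the degrees `q`. -/
structure DegreeData (f : PowerSeries ℕ) (d q : ℕ) : Prop where
  zero : PowerSeries.coeff 0 f = 1
  one : 2 * PowerSeries.coeff 1 f = d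
  two : 2 * PowerSeries.coeff 2 f + q = PowerSeries.coeff 1 f * (PowerSeries.coeff 1 f + 1)

lemma DegreeData.mul {f g : PowerSeries ℕ} {d q d' q' : ℕ} (hf : DegreeData f d q)
    (hg : DegreeData g d' q') : DegreeData (f * g) (d + d') (q + q') := by
  refine ⟨coeff_zero_mul' _ _ hf.zero hg.zero, ?_, ?_⟩
  · rw [coeff_one_mul' _ _ hf.zero hg.zero, mul_add, hf.one, hg.one]
  · rw [coeff_one_mul' _ _ hf.zero hg.zero, coeff_two_mul' _ _ hf.zero hg.zero]
    have := hf.two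
    have := hg.two
    linarith

lemma DegreeData.pow {f : PowerSeries ℕ} {d q : ℕ} (hf : DegreeData f d q) (m : ℕ) :
    DegreeData (f ^ m) (m * d) (m * q) := by
  induction m with
  | zero =>
    rw [pow_zero, zero_mul, zero_mul]
    constructor <;> simp [PowerSeries.coeff_one]
  | succ m ih =>
    rw [pow_succ, add_one_mul, add_one_mul]
    exact ih.mul hf

lemma degreeData_matchingSeries [Fintype V] (G : SimpleGraph V) :
    DegreeData G.matchingSeries (degSumIn G Finset.univ) (∑ v, degIn G Finset.univ v ^ 2) :=
  ⟨by simp [numMatchings_zero], by simpa using G.two_mul_numMatchings_one,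
    by simpa using G.two_mul_numMatchings_two⟩

lemma degIn_top [Fintype V] (v : V) :
    degIn (⊤ : SimpleGraph V) Finset.univ v = Fintype.card V - 1 := by
  rw [← Finset.card_univ, ← Finset.card_erase_of_mem (Finset.mem_univ v), degIn]
  congr 1
  ext w
  simp [eq_comm]

lemma degreeData_top (m : ℕ) : DegreeData (⊤ : SimpleGraph (Fin m)).matchingSeries
    (m * (m - 1)) (m * (m - 1) ^ 2) := by
  have := degreeData_matchingSeries (⊤ : SimpleGraph (Fin m))
  simpa [degSumIn, degIn_top] using this

lemma degreeData_cliqueSeries (s n : ℕ) : DegreeData (cliqueSeries s n) (cliqueDegSum s n)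
    (n / s * (s * (s - 1) ^ 2) + n % s * (n % s - 1) ^ 2) :=
  ((degreeData_top s).pow _).mul (degreeData_top _)

lemma cliqueSeries_of_le {s n : ℕ} (hs : 0 < s) (h : n ≤ s) :
    cliqueSeries s n = (⊤ : SimpleGraph (Fin n)).matchingSeries := by
  rw [cliqueSeries]
  rcases h.lt_or_eq with h | rfl
  · rw [Nat.div_eq_of_lt h, Nat.mod_eq_of_lt h, pow_zero, one_mul]
  · have : IsEmpty (Fin (n % n)) := by rw [Nat.mod_self]; infer_instance
    rw [Nat.div_self hs, pow_one, matchingSeries_of_isEmpty (V := Fin (n % n)), mul_one]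

/-- Two cliques that fit into one of size at most `s` embed into it. Otherwise shifting vertices
until one clique has size `s` raises the degree sum by 2 (s - i)(s - j) > 0. -/
lemma lexLE_mul_top {s i j : ℕ} (hs : 0 < s) (hi : i < s) (hj : j < s) :
    LexLE ((⊤ : SimpleGraph (Fin i)).matchingSeries * (⊤ : SimpleGraph (Fin j)).matchingSeries)
      (cliqueSeries s (i + j)) := by
  rcases le_or_gt (i + j) s with h | h
  · rw [cliqueSeries_of_le hs h, ← matchingSeries_sum]
    apply LexLE.of_le
    intro k
    rw [coeff_matchingSeries, coeff_matchingSeries]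
    refine numMatchings_le_of_injective ⟨finSumFinEquiv, ?_⟩ finSumFinEquiv.injective k
    intro a b hab
    rw [top_adj]
    exact fun h => hab.ne (finSumFinEquiv.injective h)
  · left
    have h1 := ((degreeData_top i).mul (degreeData_top j)).one
    have h2 := (degreeData_cliqueSeries s (i + j)).one
    have h3 : (i + j) / s = 1 := Nat.div_eq_of_lt_le (by omega) (by omega)
    have h4 : (i + j) % s = i + j - s := by
      rw [Nat.mod_eq_sub_mod h.le, Nat.mod_eq_of_lt (by omega)]
    rw [cliqueDegSum, h3, h4] at h2
    obtain ⟨r, hr⟩ : ∃ r, i + j = s + r := ⟨i + j - s, by omega⟩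
    rw [show i + j - s = r by omega] at h2
    have h5 : i * (i - 1) + j * (j - 1) < s * (s - 1) + r * (r - 1) := by
      zify
      rw [← Nat.cast_mul, ← Nat.cast_mul, ← Nat.cast_mul, ← Nat.cast_mul, cast_mul_pred,
        cast_mul_pred, cast_mul_pred, cast_mul_pred]
      zify at hr hi hj
      have : (r : ℤ) = i + j - s := by linarith
      rw [this]
      nlinarith [mul_pos (sub_pos.2 hi) (sub_pos.2 hj)]
    omega

/-- The full cliques occur as a common factor on both sides; only the two leftover cliques have to
be merged. -/
lemma lexLE_cliqueSeries_mul {s : ℕ} (hs : 0 < s) (m n : ℕ) :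
    LexLE (cliqueSeries s m * cliqueSeries s n) (cliqueSeries s (m + n)) := by
  have h := lexLE_mul_top hs (Nat.mod_lt m hs) (Nat.mod_lt n hs)
  have h0 := ((degreeData_top s).pow (m / s + n / s)).zero
  have h1 := LexLE.mul h0 h0 ((degreeData_top _).mul (degreeData_top _)).zero
    (degreeData_cliqueSeries _ _).zero (LexLE.of_le fun _ => le_rfl) h
  have e1 : (m + n) / s = m / s + n / s + (m % s + n % s) / s := by
    conv_lhs => rw [← Nat.div_add_mod m s, ← Nat.div_add_mod n s]
    rw [show s * (m / s) + m % s + (s * (n / s) + n % s) =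
      m % s + n % s + s * (m / s + n / s) by ring, Nat.add_mul_div_left _ _ hs]
    ring
  have e2 : (m % s + n % s) % s = (m + n) % s := (Nat.add_mod m n s).symm
  have e3 : cliqueSeries s (m + n) =
      (⊤ : SimpleGraph (Fin s)).matchingSeries ^ (m / s + n / s) *
        cliqueSeries s (m % s + n % s) := by
    rw [cliqueSeries, cliqueSeries, e1, e2, pow_add _ (m / s + n / s), mul_assoc]
  have e4 : cliqueSeries s m * cliqueSeries s n =
      (⊤ : SimpleGraph (Fin s)).matchingSeries ^ (m / s + n / s) *
      ((⊤ : SimpleGraph (Fin (m % s))).matchingSeries *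
        (⊤ : SimpleGraph (Fin (n % s))).matchingSeries) := by
    rw [cliqueSeries, cliqueSeries, pow_add]; ring
  rw [e3, e4]
  exact h1

lemma sum_degIn_sq_join {h n : ℕ} [Fintype V] (hV : Fintype.card V = n) (Y : Finset V)
    (hY : Y.card = h)
    (h1 : ∀ v ∈ Y, degIn G Finset.univ v = n - 1)
    (h2 : ∀ v, v ∉ Y → degIn G Finset.univ v = h) (φ : ℕ → ℕ) :
    ∑ v, φ (degIn G Finset.univ v) = h * φ (n - 1) + (n - h) * φ h := by
  rw [← Finset.sum_add_sum_compl Y, Finset.sum_congr rfl fun v hv => by rw [h1 v hv],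
    Finset.sum_congr (s₁ := Yᶜ) rfl fun v hv => by rw [h2 v (by simpa using hv)]]
  simp [Finset.card_compl, hV, hY]

/-- The right side is the sum of squared degrees of K_h joined to N + 1 - h independent vertices,
the left side that of the union of cliques. Since j ≥ h forces N ≥ 3h, substituting h = r + 2 and N
= 3h + p leaves a difference with positive coefficients. -/
lemma sum_sq_lt_of_two_le {h q j N : ℕ} (hh : 2 ≤ h) (hj : j = h ∨ j = h + 1)
    (hmod : (2 * h + 1) * q + j = N + 1) (hjn : 2 * h + 1 + j ≤ N + 1) :
    q * ((2 * h + 1) * (2 * h) ^ 2) + j * (j - 1) ^ 2 < h * N ^ 2 + (N + 1 - h) * h ^ 2 := by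
  obtain ⟨r, rfl⟩ : ∃ r, h = r + 2 := ⟨h - 2, by omega⟩
  rcases hj with hj | hj
  · subst hj
    obtain ⟨p, hp⟩ : ∃ p, N = 3 * (r + 2) + p := ⟨N - 3 * (r + 2), by omega⟩
    rw [show N + 1 - (r + 2) = N - r - 1 by omega]
    rw [show r + 2 - 1 = r + 1 by omega]
    zify at hmod ⊢
    rw [Nat.cast_sub (by omega), Nat.cast_sub (by omega)]
    have hpz : (N : ℤ) = 3 * (r + 2) + p := by exact_mod_cast hp
    push_cast at hmod ⊢
    have hq : (q : ℤ) * (2 * (r + 2) + 1) = 3 * (r + 2) + p + 1 - (r + 2) := by linarith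
    have : (q : ℤ) * ((2 * (r + 2) + 1) * (2 * (r + 2)) ^ 2) =
      (3 * (r + 2) + p + 1 - (r + 2)) * (2 * (r + 2)) ^ 2 := by rw [← hq]; ring
    rw [this, hpz]
    have hp0 : (0 : ℤ) ≤ p := by positivity
    have hr0 : (0 : ℤ) ≤ r := by positivity
    rw [← sub_pos]
    ring_nf
    positivity
  · subst hj
    obtain ⟨p, hp⟩ : ∃ p, N = 3 * (r + 2) + p := ⟨N - 3 * (r + 2), by omega⟩
    rw [show N + 1 - (r + 2) = N - r - 1 by omega]
    rw [show r + 2 + 1 - 1 = r + 2 by omega]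
    zify at hmod ⊢
    rw [Nat.cast_sub (by omega), Nat.cast_sub (by omega)]
    have hpz : (N : ℤ) = 3 * (r + 2) + p := by exact_mod_cast hp
    push_cast at hmod ⊢
    have hq : (q : ℤ) * (2 * (r + 2) + 1) = 3 * (r + 2) + p + 1 - (r + 2 + 1) := by linarith
    have : (q : ℤ) * ((2 * (r + 2) + 1) * (2 * (r + 2)) ^ 2) =
      (3 * (r + 2) + p + 1 - (r + 2 + 1)) * (2 * (r + 2)) ^ 2 := by rw [← hq]; ring
    rw [this, hpz]
    have hp0 : (0 : ℤ) ≤ p := by positivity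
    have hr0 : (0 : ℤ) ≤ r := by positivity
    rw [← sub_pos]
    ring_nf
    positivity

/-- Connected graphs without a path on `s + 1` vertices do not beat the union of cliques. -/
lemma Preconnected.lexLE_cliqueSeries [Fintype V] {s : ℕ} (hG : G.Preconnected)
    (hN : NoPath G (s + 1)) (hs : 2 ≤ s) :
    LexLE G.matchingSeries (cliqueSeries s (Fintype.card V)) := by
  rcases le_or_gt (Fintype.card V) s with hle | hgt
  · rw [cliqueSeries_of_le (by omega) hle]
    apply LexLE.of_le
    intro k
    rw [coeff_matchingSeries, coeff_matchingSeries]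
    refine numMatchings_le_of_injective ⟨Fintype.equivFin V, ?_⟩ (Fintype.equivFin V).injective k
    intro a b hab
    rw [top_adj]
    exact fun h => hab.ne ((Fintype.equivFin V).injective h)
  have d1 := degreeData_matchingSeries G
  have d2 := degreeData_cliqueSeries s (Fintype.card V)
  have e1 := d1.one
  have e2 := d2.one
  rcases hG.degSumIn_lt_or hN hgt hs with hlt | ⟨heq, h, hh, rfl, hj, Y, hY, hY1, hY2⟩
  · left; omega
  right
  have he : PowerSeries.coeff 1 G.matchingSeries =
    PowerSeries.coeff 1 (cliqueSeries (2 * h + 1) (Fintype.card V)) := by omega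
  refine ⟨he, ?_⟩
  have hsq := sum_degIn_sq_join rfl Y hY hY1 hY2 fun x => x ^ 2
  have hsum := sum_degIn_sq_join rfl Y hY hY1 hY2 fun x => x
  change degSumIn G Finset.univ = _ at hsum
  have f1 := d1.two
  have f2 := d2.two
  rw [hsq] at f1
  rw [hsum] at e1
  obtain ⟨N, hc⟩ : ∃ N, Fintype.card V = N + 1 := ⟨Fintype.card V - 1, by omega⟩
  have hN' : Fintype.card V - 1 = N := by omega
  rw [hN', hc] at f1 e1
  -- For h ≥ 2 the tie in edges is broken by the squared degrees. For h = 1 the graph is a star and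
  -- has no matchings with two or more edges.
  rcases hh.lt_or_eq with hh | rfl
  · left
    have key := sum_sq_lt_of_two_le hh hj (by rw [← hc]; exact Nat.div_add_mod _ _)
      (by rw [← hc]; exact add_mod_le_of_lt (by omega) hgt)
    rw [he] at f1
    rw [Nat.add_sub_cancel] at f2
    omega
  · right
    have hN1 : G.numMatchings 1 = N := by
      rw [coeff_matchingSeries] at e1; omega
    have hN2 : G.numMatchings 2 = 0 := by
      rw [coeff_matchingSeries, coeff_matchingSeries, hN1] at f1
      simp only [Nat.add_sub_cancel] at f1
      nlinarith
    have hzero : ∀ i, G.numMatchings (i + 2) = 0 := by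
      intro i
      induction i with
      | zero => exact hN2
      | succ i ih =>
        have := G.succ_mul_numMatchings_le (i + 2)
        rw [ih, zero_mul, Nat.le_zero, mul_eq_zero] at this
        exact this.resolve_left (by omega)
    intro i
    match i with
    | 0 => rw [d1.zero, d2.zero]
    | 1 => exact he.le
    | i + 2 => rw [coeff_matchingSeries, hzero]; exact Nat.zero_le _

universe u in
-- Each component is replaced by its own union of cliques, and then the unions are merged.
lemma NoPath.lexLE_cliqueSeries {V : Type u} [Fintype V] {G : SimpleGraph V} {s : ℕ} (hs : 2 ≤ s)
    (hN : NoPath G (s + 1)) : LexLE G.matchingSeries (cliqueSeries s (Fintype.card V)) := by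
  revert hN
  refine induction_on_components (P := fun {V} _ G => NoPath G (s + 1) →
    LexLE G.matchingSeries (cliqueSeries s (Fintype.card V))) ?_ ?_ ?_ ?_ G
  · intro V W _ _ G H f ih hN
    rw [← matchingSeries_eq_of_iso f, ← Fintype.card_congr f.toEquiv]
    exact ih (hN.of_hom_injective f.toHom f.injective)
  · intro V W _ _ G H hG hH hN
    rw [matchingSeries_sum, Fintype.card_sum]
    exact (LexLE.mul (degreeData_matchingSeries G).zero (degreeData_cliqueSeries _ _).zero
      (degreeData_matchingSeries H).zero (degreeData_cliqueSeries _ _).zero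
      (hG (hN.left_of_sum))
      (hH (hN.right_of_sum))).trans
      (lexLE_cliqueSeries_mul (by omega) _ _)
  · intro V _ _ G _
    rw [Fintype.card_eq_zero, cliqueSeries_of_le (by omega) (by omega), matchingSeries_of_isEmpty,
      matchingSeries_of_isEmpty]
    exact LexLE.of_le fun _ => le_rfl
  · intro V _ G _ hG hN
    exact hG.lexLE_cliqueSeries hN hs

end SimpleGraph

end

/-! ### Components other than K_s: edge deficit or large second moment -/

section
namespace SimpleGraph

variable {V : Type*} {G F : SimpleGraph V}

lemma reachable_of_isChain {a x : V} {l : List V} (h : (a :: l).IsChain F.Adj)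
    (hx : x ∈ a :: l) : F.Reachable a x := by
  induction l generalizing a with
  | nil => rw [List.mem_singleton.1 hx]
  | cons b l ih =>
    rw [List.isChain_cons_cons] at h
    rcases List.mem_cons.1 hx with rfl | hx
    · exact Reachable.refl _
    · exact h.1.reachable.trans (ih h.2 hx)

/-- From every vertex of the component of a path starts a path at least half as long. -/
lemma Reachable.exists_half_path {a b : V} {l : List V} (h : F.Reachable a b) (hb : b ∈ l)
    (hn : l.Nodup) (hc : l.IsChain F.Adj) :
    ∃ L, (a :: L).IsChain F.Adj ∧ (a :: L).Nodup ∧ l.length + 1 ≤ 2 * (L.length + 1) := by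
  obtain ⟨p⟩ := h
  have hpn := p.toPath.2.support_nodup
  have hpc := p.toPath.1.isChain_adj_support
  obtain ⟨X, x, Y, e, hx, hX⟩ := exists_first_split (· ∈ l) p.toPath.1.support
    ⟨b, p.toPath.1.end_mem_support, hb⟩
  have hhead : (X ++ [x]).head? = some a := by
    have h1 : p.toPath.1.support.head? = some a := by
      rw [← Walk.cons_tail_support]; rfl
    rw [e] at h1
    cases X <;> simpa using h1
  rw [e] at hpn hpc
  obtain ⟨l₁, l₂, rfl⟩ := List.append_of_mem hx
  have key : ∀ l', (x :: l').IsChain F.Adj → (x :: l').Nodup → (∀ y ∈ l', y ∉ X) →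
      ∃ L, (a :: L).IsChain F.Adj ∧ (a :: L).Nodup ∧ l'.length ≤ L.length := by
    intro l' h1 h2 h3
    have h4 : (X ++ x :: l').IsChain F.Adj := by
      have := List.IsChain.append_overlap (l₁ := X) (l₂ := [x]) (l₃ := l') (R := F.Adj)
        (List.IsChain.left_of_append (l₂ := Y) (by simpa using hpc)) (by simpa using h1) (by simp)
      simpa using this
    have h5 : (X ++ x :: l').Nodup := by
      simp only [List.nodup_append, List.nodup_cons] at hpn h2 ⊢
      grind
    cases X with
    | nil =>
      obtain rfl : x = a := by simpa using hhead
      exact ⟨l', h1, h2, le_rfl⟩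
    | cons c X =>
      obtain rfl : c = a := by simpa using hhead
      exact ⟨X ++ x :: l', h4, h5, by simp; omega⟩
  -- `x` is where the route from `a` first meets the path; continue along the longer of the two
  -- sides.
  rcases le_total l₁.length l₂.length with hle | hle
  · obtain ⟨L, h1, h2, h3⟩ := key l₂ hc.right_of_append (List.Nodup.of_append_right hn)
      (fun y hy hyX => hX y hyX (by simp [hy]))
    exact ⟨L, h1, h2, by simp; omega⟩
  · obtain ⟨L, h1, h2, h3⟩ := key l₁.reverse
      (by
        rw [← isChain_reverse_iff]
        apply List.IsChain.left_of_append (l₂ := l₂)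
        simpa using hc)
      (by simp only [List.nodup_append, List.nodup_cons, List.nodup_reverse, List.mem_reverse]
            at hn ⊢
          grind)
      (fun y hy hyX => hX y hyX (by simp at hy; simp [hy]))
    rw [List.length_reverse] at h3
    exact ⟨L, h1, h2, by simp; omega⟩

/-- In a connected graph without a path on `s + 1` vertices, all paths on `s` vertices of a subgraph
lie in the same component of this subgraph. -/
lemma Preconnected.reachable_of_paths {s : ℕ} (hG : G.Preconnected) (hN : NoPath G (s + 1))
    (hF : F ≤ G) {u v : V} {l l' : List V} (hl : l.Nodup) (hc : l.IsChain F.Adj)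
    (hs : s ≤ l.length) (hl' : l'.Nodup) (hc' : l'.IsChain F.Adj) (hs' : s ≤ l'.length)
    (hu : u ∈ l) (hv : v ∈ l') : F.Reachable u v := by
  by_contra huv
  obtain ⟨a, X, b, ha, hb, hX, hXn, hXd⟩ := hG.exists_connecting_path
    (A := fun x => F.Reachable x u) (B := fun x => F.Reachable x v) (Reachable.refl u)
    (Reachable.refl v) fun x hx hx' => huv (hx.symm.trans hx')
  obtain ⟨L, h1, h2, h3⟩ := ha.exists_half_path hu hl hc
  obtain ⟨L', h1', h2', h3'⟩ := hb.exists_half_path hv hl' hc'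
  have hA : ∀ x ∈ a :: L, F.Reachable x u := fun x hx =>
    (reachable_of_isChain h1 hx).symm.trans ha
  have hB : ∀ x ∈ b :: L', F.Reachable x v := fun x hx =>
    (reachable_of_isChain h1' hx).symm.trans hb
  have hAB : ∀ x, F.Reachable x u → ¬ F.Reachable x v := fun x hx hx' => huv (hx.symm.trans hx')
  -- Each half path has at least (s + 1) / 2 vertices, so joining two of them through `G` gives at
  -- least s + 1.
  have := hN (L.reverse ++ a :: (X ++ b :: L')) (by
      have d1 : ∀ x ∈ a :: L, x ∉ X := fun x hx hxX => (hXd x hxX).1 (hA x hx)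
      have d2 : ∀ x ∈ b :: L', x ∉ X := fun x hx hxX => (hXd x hxX).2 (hB x hx)
      have d3 : ∀ x ∈ a :: L, x ∉ b :: L' := fun x hx hx' => hAB x (hA x hx) (hB x hx')
      clear hA hB hAB hXd
      simp only [List.nodup_append, List.nodup_cons, List.nodup_reverse, List.mem_reverse,
        List.mem_cons, List.mem_append] at h2 h2' hXn ⊢
      grind)
    (isChain_connect (h1.imp fun _ _ h => hF h) (h1'.imp fun _ _ h => hF h) hX)
  simp at this
  omega

/-- The vertices at the end of a walk of length at most `i` from `v`. -/
noncomputable def ballFinset [Fintype V] (F : SimpleGraph V) (v : V) : ℕ → Finset V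
  | 0 => {v}
  | i + 1 => ballFinset F v i ∪
      (ballFinset F v i).biUnion fun w => Finset.univ.filter fun x => F.Adj w x

lemma card_ballFinset_le [Fintype V] {Δ : ℕ} (hΔ : ∀ v, degIn F Finset.univ v ≤ Δ) (v : V) (i : ℕ) :
    (ballFinset F v i).card ≤ (Δ + 1) ^ i := by
  induction i with
  | zero => simp [ballFinset]
  | succ i ih =>
    rw [ballFinset]
    calc _ ≤ (ballFinset F v i).card + (ballFinset F v i).card * Δ :=
          (Finset.card_union_le _ _).trans (Nat.add_le_add_left
            (Finset.card_biUnion_le_card_mul _ _ _ fun w _ => hΔ w) _)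
      _ = (ballFinset F v i).card * (Δ + 1) := by ring
      _ ≤ (Δ + 1) ^ i * (Δ + 1) := Nat.mul_le_mul_right _ ih
      _ = (Δ + 1) ^ (i + 1) := (pow_succ _ _).symm

lemma ballFinset_mono [Fintype V] (v : V) : Monotone (ballFinset F v) :=
  monotone_nat_of_le_succ fun _ => Finset.subset_union_left

lemma mem_ballFinset_length [Fintype V] {v w : V} (p : F.Walk w v) :
    w ∈ ballFinset F v p.length := by
  induction p with
  | nil => simp [ballFinset]
  | cons h p ih =>
    rw [Walk.length_cons, ballFinset]
    refine Finset.mem_union_right _ (Finset.mem_biUnion.2 ⟨_, ih, ?_⟩)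
    simpa using h.symm

/-- Moore's bound for the size of a component. -/
lemma card_reachable_le [Fintype V] {Δ s : ℕ} (hΔ : ∀ v, degIn F Finset.univ v ≤ Δ)
    (hN : NoPath F (s + 1)) (v : V) :
    (Finset.univ.filter fun w => F.Reachable w v).card ≤ (Δ + 1) ^ s := by
  refine (Finset.card_le_card fun w hw => ?_).trans (card_ballFinset_le hΔ v s)
  obtain ⟨p⟩ := (Finset.mem_filter.1 hw).2
  refine ballFinset_mono v ?_ (mem_ballFinset_length p.toPath.1)
  have := hN _ p.toPath.2.support_nodup p.toPath.1.isChain_adj_support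
  rw [Walk.length_support] at this
  omega

/-- The **Erdős–Gallai theorem** for paths. -/
lemma NoPath.degSumIn_le [Fintype V] {r : ℕ} (hr : 1 ≤ r) (hN : NoPath G (r + 1)) :
    degSumIn G Finset.univ ≤ Fintype.card V * (r - 1) := by
  rcases hr.lt_or_eq with hr | rfl
  · have h := hN.lexLE_cliqueSeries hr
    have h1 : PowerSeries.coeff 1 G.matchingSeries ≤
      PowerSeries.coeff 1 (cliqueSeries r (Fintype.card V)) := by
      rcases h with h | h
      · exact h.le
      · exact h.1.le
    have := (degreeData_matchingSeries G).one
    have := (degreeData_cliqueSeries r (Fintype.card V)).one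
    have := cliqueDegSum_le r (Fintype.card V) (by omega)
    omega
  · rw [Nat.sub_self, mul_zero, Nat.le_zero]
    refine Finset.sum_eq_zero fun v _ => Finset.card_eq_zero.2 ?_
    refine Finset.filter_eq_empty_iff.2 fun w _ h => ?_
    have := hN [v, w] (by simpa using h.ne) (by simpa using h)
    simp at this

/-- The graph obtained by removing all edges with an end in `Z`. -/
def removeAt (G : SimpleGraph V) (Z : Finset V) : SimpleGraph V where
  Adj u v := G.Adj u v ∧ u ∉ Z ∧ v ∉ Z
  symm := ⟨fun _ _ h => ⟨h.1.symm, h.2.2, h.2.1⟩⟩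
  loopless := ⟨fun _ h => h.1.ne rfl⟩

lemma removeAt_le (Z : Finset V) : removeAt G Z ≤ G := fun _ _ h => h.1

lemma degSumIn_le_removeAt [Fintype V] (Z : Finset V) : degSumIn G Finset.univ ≤
    degSumIn (removeAt G Z) Finset.univ + 2 * ∑ v ∈ Z, degIn G Finset.univ v := by
  have h1 : ∀ v, degIn G Finset.univ v ≤ degIn (removeAt G Z) Finset.univ v +
      (degIn G Z v + if v ∈ Z then degIn G Finset.univ v else 0) := by
    intro v
    split_ifs with hv
    · omega
    · rw [add_zero, degIn, degIn, degIn]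
      refine (Finset.card_le_card fun w hw => ?_).trans (Finset.card_union_le _ _)
      by_cases hwZ : w ∈ Z <;> simp_all [removeAt]
  have h2 : ∑ v, degIn G Z v = ∑ v ∈ Z, degIn G Finset.univ v := by
    simp only [degIn]
    refine (Finset.sum_card_bipartiteAbove_eq_sum_card_bipartiteBelow
      (s := Finset.univ) (t := Z) fun v w => G.Adj v w).trans ?_
    simp only [Finset.bipartiteBelow, G.adj_comm]
  calc degSumIn G Finset.univ ≤ ∑ v, (degIn (removeAt G Z) Finset.univ v +
      (degIn G Z v + if v ∈ Z then degIn G Finset.univ v else 0)) :=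
        Finset.sum_le_sum fun v _ => h1 v
    _ = _ := by
      rw [Finset.sum_add_distrib, Finset.sum_add_distrib, h2, Finset.sum_ite_mem,
        Finset.univ_inter, degSumIn]
      ring

/-- A connected graph without paths on `s + 1` vertices whose degrees are mostly small has at most
about `(s - 2) / 2` edges per vertex. -/
lemma Preconnected.degSumIn_le_add [Fintype V] {s Δ : ℕ} (hG : G.Preconnected)
    (hN : NoPath G (s + 1)) (hs : 2 ≤ s) : degSumIn G Finset.univ ≤ Fintype.card V * (s - 2) +
      2 * (∑ v with Δ ≤ degIn G Finset.univ v, degIn G Finset.univ v + (Δ + 1) ^ s * Δ) := by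
  set H : Finset V := Finset.univ.filter fun v => Δ ≤ degIn G Finset.univ v with hH
  set F := removeAt G H with hF
  have hFG : F ≤ G := removeAt_le H
  have hΔ : ∀ v, degIn F Finset.univ v ≤ Δ := by
    intro v
    by_cases hv : v ∈ H
    · have : degIn F Finset.univ v = 0 :=
        Finset.card_eq_zero.2 (Finset.filter_eq_empty_iff.2 fun w _ h => h.2.1 hv)
      omega
    · have h1 : degIn G Finset.univ v < Δ := by simpa [H] using hv
      have h2 : degIn F Finset.univ v ≤ degIn G Finset.univ v :=
        Finset.card_le_card fun w hw => by
          simp only [Finset.mem_filter] at hw ⊢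
          exact ⟨hw.1, hFG hw.2⟩
      omega
  have hFN : NoPath F (s + 1) := hN.mono hFG
  -- `Q` is the single component of `F` that contains all its paths on `s` vertices, or empty if
  -- there are none; it is bounded because `F` has bounded degrees and no long paths.
  obtain ⟨Q, hQ, hQp⟩ : ∃ Q : Finset V, Q.card ≤ (Δ + 1) ^ s ∧
      ∀ l : List V, l.Nodup → l.IsChain F.Adj → s ≤ l.length → ∀ x ∈ l, x ∈ Q := by
    by_cases hex : ∃ l : List V, l.Nodup ∧ l.IsChain F.Adj ∧ s ≤ l.length
    · obtain ⟨l, hl, hc, hls⟩ := hex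
      obtain ⟨v, hv⟩ := List.exists_mem_of_length_pos (by omega : 0 < l.length)
      refine ⟨_, card_reachable_le hΔ hFN v, fun l' hl' hc' hls' x hx => ?_⟩
      simp only [Finset.mem_filter, Finset.mem_univ, true_and]
      exact hG.reachable_of_paths hN hFG hl' hc' hls' hl hc hls hx hv
    · exact ⟨∅, by simp, fun l hl hc hls => absurd ⟨l, hl, hc, hls⟩ hex⟩
  -- A path on `s` ≥ 2 vertices that survives would lie in `Q`, yet its first vertex still has an
  -- edge. The Erdős–Gallai bound thus applies with s - 1 in place of s.
  have hF' : NoPath (removeAt G (H ∪ Q)) (s - 1 + 1) := by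
    intro l hl hc
    by_contra! hls
    have hsub : ∀ u v, (removeAt G (H ∪ Q)).Adj u v → F.Adj u v := fun u v h =>
      ⟨h.1, fun hu => h.2.1 (Finset.mem_union_left _ hu),
        fun hv => h.2.2 (Finset.mem_union_left _ hv)⟩
    have := hQp l hl (hc.imp hsub) (by omega)
    match l with
    | [] => simp at hls
    | [a] => simp at hls; omega
    | a :: b :: l =>
      rw [List.isChain_cons_cons] at hc
      exact hc.1.2.1 (Finset.mem_union_right _ (this a (by simp)))
  have h1 := hF'.degSumIn_le (by omega)
  have h2 := degSumIn_le_removeAt (G := G) (H ∪ Q)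
  have h3 : ∑ v ∈ H ∪ Q, degIn G Finset.univ v ≤
      ∑ v ∈ H, degIn G Finset.univ v + (Δ + 1) ^ s * Δ := by
    rw [← Finset.union_sdiff_self_eq_union, Finset.sum_union Finset.disjoint_sdiff]
    refine Nat.add_le_add_left ?_ _
    refine (Finset.sum_le_card_nsmul _ _ Δ fun v hv => ?_).trans ?_
    · have : v ∉ H := (Finset.mem_sdiff.1 hv).2
      simp [H] at this
      omega
    · rw [smul_eq_mul]
      exact Nat.mul_le_mul_right _ ((Finset.card_le_card Finset.sdiff_subset).trans hQ)
  rw [show s - 1 - 1 = s - 2 by omega] at h1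
  omega

/-- A connected graph without paths on `s + 1` vertices is a clique on `s` vertices, or it has fewer
edges than such cliques in proportion, or the degrees have a large second moment. -/
lemma exists_preconnected_trichotomy {s : ℕ} (hs : 2 ≤ s) (K : ℕ) :
    ∃ N₀, ∀ (V : Type) [Fintype V] (G : SimpleGraph V), 0 < Fintype.card V → G.Preconnected →
      NoPath G (s + 1) → (Fintype.card V = s ∧ G = ⊤) ∨
      N₀ * degSumIn G Finset.univ + Fintype.card V ≤ N₀ * (Fintype.card V * (s - 1)) ∨
      K * Fintype.card V ≤ ∑ v, degIn G Finset.univ v ^ 2 := by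
  obtain ⟨Δ, hΔ⟩ : ∃ Δ, Δ = 8 * K := ⟨_, rfl⟩
  obtain ⟨C, hC⟩ : ∃ C, C = (Δ + 1) ^ s * Δ := ⟨_, rfl⟩
  refine ⟨8 * C + 2, fun V _ G hV hG hN => ?_⟩
  have h1 := hG.degSumIn_le_add hN hs (Δ := Δ)
  rw [← hC] at h1
  rcases hG.degSumIn_lt_mul hN hs hV with h2 | h2
  swap
  · exact Or.inl h2
  right
  obtain ⟨D, hD⟩ : ∃ D, Fintype.card V * (s - 1) = degSumIn G Finset.univ + D :=
    ⟨_, (Nat.add_sub_of_le h2.le).symm⟩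
  rw [hD, mul_add]
  suffices h : Fintype.card V ≤ (8 * C + 2) * D ∨
      K * Fintype.card V ≤ ∑ v, degIn G Finset.univ v ^ 2 from
    h.imp_left fun h => Nat.add_le_add_left h _
  have hD0 : 1 ≤ D := by omega
  -- `D` is the deficit. For orders below 8C a deficit of one suffices. Beyond, either the vertices
  -- of degree at least Δ = 8K carry an eighth of the order in degrees, hence a second moment of K
  -- times the order, or the deficit is at least half the order.
  rcases Nat.lt_or_ge (Fintype.card V) (8 * C) with h3 | h3
  · left
    nlinarith
  by_cases h4 : Fintype.card V ≤ 8 * ∑ v with Δ ≤ degIn G Finset.univ v, degIn G Finset.univ v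
  · right
    have h5 : Δ * ∑ v with Δ ≤ degIn G Finset.univ v, degIn G Finset.univ v ≤
        ∑ v, degIn G Finset.univ v ^ 2 := by
      rw [Finset.mul_sum]
      refine (Finset.sum_le_sum fun v hv => ?_).trans
        (Finset.sum_le_sum_of_subset (Finset.subset_univ _))
      rw [sq]
      exact Nat.mul_le_mul_right _ (Finset.mem_filter.1 hv).2
    rw [hΔ] at h5 h4
    nlinarith
  · left
    obtain ⟨r, rfl⟩ : ∃ r, s = r + 2 := ⟨s - 2, by omega⟩
    rw [show r + 2 - 1 = r + 1 by omega, mul_add] at hD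
    rw [Nat.add_sub_cancel] at h1
    have h5 : Fintype.card V ≤ 2 * D := by omega
    nlinarith

end SimpleGraph

end

/-! ### From the lexicographic comparison to matchings of size t -/

section
namespace SimpleGraph

variable {V : Type*} {G : SimpleGraph V}

section cliqueUnion

/-- The disjoint union of `a + 1` copies is that of `a` copies and one further copy. -/
def disjointCopiesSucc (a : ℕ) (G : SimpleGraph V) :
    disjointCopies (a + 1) G ≃g disjointCopies a G ⊕g G where
  toFun x := Fin.lastCases (Sum.inr x.2) (fun i => Sum.inl (i, x.2)) x.1
  invFun := Sum.elim (fun y => (y.1.castSucc, y.2)) fun v => (Fin.last a, v)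
  left_inv := by
    rintro ⟨i, v⟩
    induction i using Fin.lastCases <;> simp
  right_inv := by rintro (⟨i, v⟩ | v) <;> simp
  map_rel_iff' := by
    rintro ⟨i, v⟩ ⟨j, w⟩
    induction i using Fin.lastCases <;> induction j using Fin.lastCases <;>
      simp [disjointCopies, Fin.castSucc_ne_last, (Fin.castSucc_ne_last _).symm]

lemma matchingSeries_disjointCopies [Fintype V] (a : ℕ) (G : SimpleGraph V) :
    (disjointCopies a G).matchingSeries = G.matchingSeries ^ a := by
  induction a with
  | zero => rw [pow_zero, matchingSeries_of_isEmpty]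
  | succ a ih =>
    rw [matchingSeries_eq_of_iso (disjointCopiesSucc a G), matchingSeries_sum, ih, pow_succ]

lemma degIn_disjointCopies_le [Fintype V] {a : ℕ} (x : Fin a × V) :
    degIn (disjointCopies a G) Finset.univ x ≤ degIn G Finset.univ x.2 := by
  refine Finset.card_le_card_of_injOn Prod.snd (fun y hy => ?_) fun y hy z hz h => ?_
  · simp only [Finset.coe_filter, Finset.mem_univ, true_and, Set.mem_ofPred_eq] at hy ⊢
    exact hy.2
  · simp only [Finset.coe_filter, Finset.mem_univ, true_and, Set.mem_ofPred_eq] at hy hz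
    exact Prod.ext (hy.1.symm.trans hz.1) h

lemma matchingSeries_cliqueUnion (a s b : ℕ) : (cliqueUnion a s b).matchingSeries =
    (⊤ : SimpleGraph (Fin s)).matchingSeries ^ a *
      (⊤ : SimpleGraph (Fin b)).matchingSeries := by
  rw [cliqueUnion, matchingSeries_sum, matchingSeries_disjointCopies]

lemma degIn_cliqueUnion_le {a s b : ℕ} (hb : b ≤ s) (x) :
    degIn (cliqueUnion a s b) Finset.univ x ≤ s := by
  rcases x with x | x
  · rw [cliqueUnion, degIn_inl]
    have := degIn_disjointCopies_le (G := (⊤ : SimpleGraph (Fin s))) x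
    rw [degIn_top, Fintype.card_fin] at this
    omega
  · rw [cliqueUnion, degIn_inr, degIn_top, Fintype.card_fin]
    omega

lemma coeff_cliqueSeries (s r i : ℕ) : PowerSeries.coeff i (cliqueSeries s r) =
    (cliqueUnion (r / s) s (r % s)).numMatchings i := by
  rw [cliqueSeries, ← matchingSeries_cliqueUnion, coeff_matchingSeries]

lemma coeff_top_pow (s a i : ℕ) :
    PowerSeries.coeff i ((⊤ : SimpleGraph (Fin s)).matchingSeries ^ a) =
      (cliqueUnion a s 0).numMatchings i := by
  rw [← coeff_matchingSeries, matchingSeries_cliqueUnion,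
    matchingSeries_of_isEmpty (V := Fin 0), mul_one]

lemma cliqueSeries_mul_add {s : ℕ} (hs : 0 < s) (a r : ℕ) :
    cliqueSeries s (a * s + r) =
      (⊤ : SimpleGraph (Fin s)).matchingSeries ^ a * cliqueSeries s r := by
  rw [cliqueSeries, cliqueSeries, add_comm, Nat.add_mul_div_right _ _ hs, Nat.add_mul_mod_self_right,
    add_comm, pow_add, mul_assoc]

lemma mul_le_cliqueDegSum_add (s r : ℕ) (hs : 1 ≤ s) : r * (s - 1) ≤ cliqueDegSum s r + s ^ 2 := by
  have h := cliqueDegSum_eq s r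
  have h1 := Nat.mod_lt r hs
  generalize r % s = j at *
  zify [hs] at h1 ⊢
  nlinarith [sq_nonneg (j : ℤ), mul_nonneg (Int.natCast_nonneg s) (sub_nonneg.2 h1.le)]

end cliqueUnion

/-- Removing the components that are cliques on `s` vertices from a graph without a path on `s + 1`
vertices leaves a graph that has either noticeably fewer edges than the union of cliques, or
a large second moment of the degrees. -/
lemma exists_remainder {s : ℕ} (hs : 2 ≤ s) (K : ℕ) : ∃ N₀, ∀ (V : Type) [Fintype V]
    (G : SimpleGraph V), NoPath G (s + 1) → ∃ (a r₁ r₂ : ℕ) (W : Type) (_ : Fintype W)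
      (R : SimpleGraph W), Fintype.card V = a * s + Fintype.card W ∧
      G.matchingSeries = (⊤ : SimpleGraph (Fin s)).matchingSeries ^ a * R.matchingSeries ∧
      LexLE R.matchingSeries (cliqueSeries s (Fintype.card W)) ∧ Fintype.card W = r₁ + r₂ ∧
      N₀ * degSumIn R Finset.univ + r₁ ≤ N₀ * (Fintype.card W * (s - 1)) ∧
      K * r₂ ≤ ∑ v, degIn R Finset.univ v ^ 2 := by
  obtain ⟨N₀, h₀⟩ := exists_preconnected_trichotomy hs K
  -- In the remainder, r₁ counts the vertices in components with an edge deficit and r₂ those in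
  -- components with a large second moment.
  refine ⟨N₀, fun V _ G => induction_on_components (P := fun {V} _ G => NoPath G (s + 1) →
    ∃ (a r₁ r₂ : ℕ) (W : Type) (_ : Fintype W)
      (R : SimpleGraph W), Fintype.card V = a * s + Fintype.card W ∧
      G.matchingSeries = (⊤ : SimpleGraph (Fin s)).matchingSeries ^ a * R.matchingSeries ∧
      LexLE R.matchingSeries (cliqueSeries s (Fintype.card W)) ∧ Fintype.card W = r₁ + r₂ ∧
      N₀ * degSumIn R Finset.univ + r₁ ≤ N₀ * (Fintype.card W * (s - 1)) ∧
      K * r₂ ≤ ∑ v, degIn R Finset.univ v ^ 2) ?_ ?_ ?_ ?_ G⟩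
  · intro V W _ _ G H f ih hN
    rw [← matchingSeries_eq_of_iso f, ← Fintype.card_congr f.toEquiv]
    exact ih (hN.of_hom_injective f.toHom f.injective)
  · intro V₁ V₂ _ _ G₁ G₂ ih₁ ih₂ hN
    obtain ⟨a, r₁, r₂, W, _, R, h1, h2, h3, h4, h5, h6⟩ := ih₁ hN.left_of_sum
    obtain ⟨a', r₁', r₂', W', _, R', h1', h2', h3', h4', h5', h6'⟩ := ih₂ hN.right_of_sum
    refine ⟨a + a', r₁ + r₁', r₂ + r₂', W ⊕ W', inferInstance, R ⊕g R', ?_, ?_, ?_, ?_, ?_, ?_⟩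
    · rw [Fintype.card_sum, Fintype.card_sum, h1, h1']; ring
    · rw [matchingSeries_sum, matchingSeries_sum, h2, h2', pow_add]; ring
    · rw [matchingSeries_sum, Fintype.card_sum]
      exact (LexLE.mul (degreeData_matchingSeries R).zero (degreeData_cliqueSeries _ _).zero
        (degreeData_matchingSeries R').zero (degreeData_cliqueSeries _ _).zero h3 h3').trans
        (lexLE_cliqueSeries_mul (by omega) _ _)
    · rw [Fintype.card_sum, h4, h4']; ring
    · have : degSumIn (R ⊕g R') Finset.univ = degSumIn R Finset.univ + degSumIn R' Finset.univ :=
        sum_degIn_sum fun x => x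
      rw [this, Fintype.card_sum]
      linarith
    · rw [sum_degIn_sum fun x => x ^ 2]
      linarith
  · intro V _ _ G hN
    exact ⟨0, 0, 0, V, inferInstance, G, by simp, by simp, hN.lexLE_cliqueSeries hs, by simp,
      by simp [degSumIn], by simp⟩
  · intro V _ G hV hG hN
    rcases h₀ V G hV hG hN with ⟨hc, rfl⟩ | h | h
    · refine ⟨1, 0, 0, Empty, inferInstance, ⊥, by simp [hc], ?_, ?_, by simp,
        by simp [degSumIn], by simp⟩
      · rw [pow_one, matchingSeries_of_isEmpty (V := Empty), mul_one]
        exact matchingSeries_eq_of_iso (Iso.completeGraph (Fintype.equivFinOfCardEq hc))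
      · rw [Fintype.card_empty, cliqueSeries_of_le (by omega) (by omega), matchingSeries_of_isEmpty,
          matchingSeries_of_isEmpty]
        exact LexLE.of_le fun _ => le_rfl
    · exact ⟨0, Fintype.card V, 0, V, inferInstance, G, by simp, by simp,
        hN.lexLE_cliqueSeries hs, by simp, h, by simp⟩
    -- With r₁ = 0 the deficit inequality demands no gain and is the Erdős–Gallai bound.
    · exact ⟨0, 0, Fintype.card V, V, inferInstance, G, by simp, by simp,
        hN.lexLE_cliqueSeries hs, by simp,
        Nat.mul_le_mul_left _ (hN.degSumIn_le (by omega)), h⟩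

/-- A Bernoulli-type inequality, valid also where the subtraction is truncated: lowering the base by
`A` costs at most this much. -/
lemma pow_succ_le_sub_pow_add (E A i : ℕ) :
    E ^ (i + 1) ≤ (E - A) ^ (i + 1) + (i + 1) * A * E ^ i := by
  induction i with
  | zero => simp; omega
  | succ i ih =>
    have h1 : E ≤ E - A + A := by omega
    have h2 : (E - A) ^ (i + 1) ≤ E ^ (i + 1) := Nat.pow_le_pow_left (Nat.sub_le _ _) _
    calc E ^ (i + 1 + 1) = E * E ^ (i + 1) := by ring
      _ ≤ E * ((E - A) ^ (i + 1) + (i + 1) * A * E ^ i) := Nat.mul_le_mul_left _ ih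
      _ = E * (E - A) ^ (i + 1) + (i + 1) * A * E ^ (i + 1) := by ring
      _ ≤ (E - A + A) * (E - A) ^ (i + 1) + (i + 1) * A * E ^ (i + 1) := by gcongr
      _ = (E - A) ^ (i + 1 + 1) + A * (E - A) ^ (i + 1) + (i + 1) * A * E ^ (i + 1) := by ring
      _ ≤ (E - A) ^ (i + 1 + 1) + A * E ^ (i + 1) + (i + 1) * A * E ^ (i + 1) := by gcongr
      _ = _ := by ring

/-- With `E` the number of edges of the union of cliques and A = 2ts, its matchings satisfy (E -
A)^i ≤ i! m_i. It therefore suffices to bound i! m_i(G) by (E - A)^i, using whichever of r₁ and r₂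
is at least half of the order. -/
lemma numMatchings_le_coeff_cliqueSeries [Fintype V] {s t N₀ r₁ r₂ : ℕ} (hs : 2 ≤ s)
    (hlex : LexLE G.matchingSeries (cliqueSeries s (Fintype.card V)))
    (hr : Fintype.card V = r₁ + r₂)
    (hN₀ : N₀ * degSumIn G Finset.univ + r₁ ≤ N₀ * (Fintype.card V * (s - 1)))
    (hq : (1 + t * (2 * t * s)) * s * r₂ ≤ ∑ v, degIn G Finset.univ v ^ 2)
    (hB : 2 * N₀ * (4 * t * s + s ^ 2) < Fintype.card V) {i : ℕ} (hi : i ≤ t) :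
    G.numMatchings i ≤ PowerSeries.coeff i (cliqueSeries s (Fintype.card V)) := by
  have hle : G.numMatchings 1 ≤ PowerSeries.coeff 1 (cliqueSeries s (Fintype.card V)) := by
    rw [← coeff_matchingSeries]
    rcases hlex with h | h
    · exact h.le
    · exact h.1.le
  have d := degreeData_matchingSeries G
  have d1 := (degreeData_cliqueSeries s (Fintype.card V)).one
  have d2 := mul_le_cliqueDegSum_add s (Fintype.card V) (by omega)
  have d3 := cliqueDegSum_le s (Fintype.card V) (by omega)
  have hdeg : ∀ v, degIn (cliqueUnion (Fintype.card V / s) s (Fintype.card V % s)) Finset.univ v ≤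
    s := degIn_cliqueUnion_le (Nat.mod_lt _ (by omega)).le
  have hpow := pow_le_factorial_mul_numMatchings _ hdeg (t := t)
  simp only [← coeff_cliqueSeries] at hpow
  set E := PowerSeries.coeff 1 (cliqueSeries s (Fintype.card V)) with hE
  set A := 2 * t * s with hA
  have e1 := d.one
  have e2 := d.two
  rw [coeff_matchingSeries] at e1 e2
  rw [coeff_matchingSeries] at e2
  refine Nat.le_of_mul_le_mul_left ?_ i.factorial_pos
  rcases le_total r₂ r₁ with h12 | h12
  -- The deficit gives m_1(G) ≤ E - A: otherwise r₁ ≤ N₀ (4ts + s²), where 4ts = 2A and s² bounds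
  -- the loss from the incomplete clique, against `hB`.
  · refine (G.factorial_mul_numMatchings_le i).trans ((Nat.pow_le_pow_left ?_ i).trans (hpow i hi))
    by_contra! hlt
    have h1 : Fintype.card V * (s - 1) ≤ degSumIn G Finset.univ + (4 * t * s + s ^ 2) := by
      have : 4 * t * s = 2 * A := by rw [hA]; ring
      omega
    have h2 := Nat.mul_le_mul_left N₀ h1
    rw [mul_add] at h2
    have h3 : 2 * N₀ * (4 * t * s + s ^ 2) = 2 * (N₀ * (4 * t * s + s ^ 2)) := by ring
    omega
  · match i with
    | 0 => rw [numMatchings_zero, (degreeData_cliqueSeries s (Fintype.card V)).zero]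
    | 1 => simpa using hle
    | i + 2 =>
      -- The second moment is at least (1 + tA) E, so 2 m_2(G) ≤ E² - tAE. Multiplied by the
      -- remaining powers of `E`, this loss covers the difference between the powers of `E` and E -
      -- A.
      refine (G.factorial_mul_numMatchings_add_two_le i).trans (le_trans ?_ (hpow _ hi))
      have h1 := pow_succ_le_sub_pow_add E A (i + 1)
      have h2 : 2 * E ≤ Fintype.card V * s :=
        d1 ▸ d3.trans (Nat.mul_le_mul_left _ (Nat.sub_le _ _))
      have h3 : (1 + t * A) * E ≤ ∑ v, degIn G Finset.univ v ^ 2 := by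
        have h5 : E ≤ s * r₂ := by
          have : Fintype.card V * s ≤ 2 * (s * r₂) := by rw [hr]; nlinarith
          omega
        calc (1 + t * A) * E ≤ (1 + t * A) * (s * r₂) := Nat.mul_le_mul_left _ h5
          _ = (1 + t * A) * s * r₂ := by ring
          _ ≤ _ := hq
      have h4 : G.numMatchings 1 * (G.numMatchings 1 + 1) ≤ E * (E + 1) :=
        Nat.mul_le_mul hle (by omega)
      have h5 : 2 * G.numMatchings 2 + t * A * E ≤ E ^ 2 := by nlinarith
      have h6 : (2 * G.numMatchings 2 + t * A * E) * E ^ i ≤ E ^ 2 * E ^ i :=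
        Nat.mul_le_mul_right _ h5
      have h7 : 2 * G.numMatchings 2 * G.numMatchings 1 ^ i ≤ 2 * G.numMatchings 2 * E ^ i :=
        Nat.mul_le_mul_left _ (Nat.pow_le_pow_left hle i)
      have h8 : (i + 2) * (A * E ^ (i + 1)) ≤ t * (A * E ^ (i + 1)) := Nat.mul_le_mul_right _ hi
      have h9 : (2 * G.numMatchings 2 + t * A * E) * E ^ i =
        2 * G.numMatchings 2 * E ^ i + t * (A * E ^ (i + 1)) := by ring
      have h10 : E ^ 2 * E ^ i = E ^ (i + 1 + 1) := by ring
      have h11 : (i + 1 + 1) * A * E ^ (i + 1) = (i + 2) * (A * E ^ (i + 1)) := by ring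
      change _ ≤ (E - A) ^ (i + 1 + 1)
      omega

/-- At index `m` the second factor gains at least one, weighted by coefficient t - m of `P`. Larger
indices of `f` meet only earlier coefficients of `P`, which sum to at most that weight even after
multiplication by `C`; smaller indices are compared termwise. -/
lemma coeff_mul_le_of_lex {P f g : PowerSeries ℕ} {t m C : ℕ} (hC : 1 ≤ C)
    (hP : ∀ j < t, t * C * PowerSeries.coeff j P ≤ PowerSeries.coeff (j + 1) P)
    (hlt : ∀ i < m, PowerSeries.coeff i f ≤ PowerSeries.coeff i g)
    (hm : PowerSeries.coeff m f < PowerSeries.coeff m g)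
    (hfC : ∀ i ≤ t, PowerSeries.coeff i f ≤ C) :
    PowerSeries.coeff t (P * f) ≤ PowerSeries.coeff t (P * g) := by
  rw [PowerSeries.coeff_mul, PowerSeries.coeff_mul,
    Finset.Nat.sum_antidiagonal_eq_sum_range_succ_mk,
    Finset.Nat.sum_antidiagonal_eq_sum_range_succ_mk]
  rcases Nat.lt_or_ge t m with htm | hmt
  · exact Finset.sum_le_sum fun k _ => Nat.mul_le_mul_left _ (hlt _ (by omega))
  have hmono : ∀ j l, j ≤ l → l ≤ t → PowerSeries.coeff j P ≤ PowerSeries.coeff l P := by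
    intro j l hjl hlt
    induction l, hjl using Nat.le_induction with
    | base => exact le_rfl
    | succ l hjl ih =>
      refine (ih (by omega)).trans ((Nat.le_mul_of_pos_left _ ?_).trans (hP l (by omega)))
      exact Nat.mul_pos (by omega) hC
  have h1 : ∑ k ∈ Finset.range (t - m), C * PowerSeries.coeff k P ≤
      PowerSeries.coeff (t - m) P := by
    rcases Nat.eq_zero_or_pos (t - m) with h0 | h0
    · simp [h0]
    refine Nat.le_of_mul_le_mul_left (c := t) ?_ (by omega)
    rw [Finset.mul_sum]
    refine (Finset.sum_le_card_nsmul _ _ (PowerSeries.coeff (t - m) P) fun k hk => ?_).trans ?_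
    · have := Finset.mem_range.1 hk
      rw [← mul_assoc]
      exact (hP k (by omega)).trans (hmono _ _ (by omega) (by omega))
    · rw [Finset.card_range, smul_eq_mul]
      exact Nat.mul_le_mul_right _ (Nat.sub_le _ _)
  have h2 : ∑ k ∈ Finset.range (t - m), PowerSeries.coeff k P * PowerSeries.coeff (t - k) f ≤
      ∑ k ∈ Finset.range (t - m), C * PowerSeries.coeff k P := by
    refine Finset.sum_le_sum fun k _ => ?_
    rw [mul_comm]
    exact Nat.mul_le_mul_right _ (hfC _ (Nat.sub_le _ _))
  obtain ⟨l, hl⟩ : ∃ l, t = m + l := ⟨t - m, by omega⟩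
  have h3 : ∀ f : PowerSeries ℕ, ∑ k ∈ Finset.range t.succ,
      PowerSeries.coeff k P * PowerSeries.coeff (t - k) f =
      ∑ k ∈ Finset.range (t - m), PowerSeries.coeff k P * PowerSeries.coeff (t - k) f +
      (PowerSeries.coeff (t - m) P * PowerSeries.coeff m f +
      ∑ k ∈ Finset.range m, PowerSeries.coeff (t - m + 1 + k) P *
        PowerSeries.coeff (t - (t - m + 1 + k)) f) := by
    intro f
    rw [show t.succ = t - m + 1 + m by omega, Finset.sum_range_add, Finset.sum_range_succ,
      show t - (t - m) = m by omega, add_assoc]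
  rw [h3, h3]
  have h4 : ∑ k ∈ Finset.range m, PowerSeries.coeff (t - m + 1 + k) P *
        PowerSeries.coeff (t - (t - m + 1 + k)) f ≤
      ∑ k ∈ Finset.range m, PowerSeries.coeff (t - m + 1 + k) P *
        PowerSeries.coeff (t - (t - m + 1 + k)) g :=
    Finset.sum_le_sum fun k hk => Nat.mul_le_mul_left _
      (hlt _ (by have := Finset.mem_range.1 hk; omega))
  have h5 : PowerSeries.coeff (t - m) P * PowerSeries.coeff m f + PowerSeries.coeff (t - m) P ≤
      PowerSeries.coeff (t - m) P * PowerSeries.coeff m g := by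
    rw [← mul_add_one]
    exact Nat.mul_le_mul_left _ hm
  omega

/-- Among the large graphs without a path on `s + 1` vertices, the union of cliques on `s` vertices
has the largest number of matchings of a given size. -/
theorem exists_forall_numMatchings_le {s : ℕ} (hs : 2 ≤ s) (t : ℕ) : ∃ n₀, ∀ (V : Type) [Fintype V]
    (G : SimpleGraph V), n₀ ≤ Fintype.card V → NoPath G (s + 1) →
      G.numMatchings t ≤ PowerSeries.coeff t (cliqueSeries s (Fintype.card V)) := by
  obtain ⟨N₀, h₀⟩ := exists_remainder hs ((1 + t * (2 * t * s)) * s)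
  obtain ⟨B, hB⟩ : ∃ B, B = 2 * N₀ * (4 * t * s + s ^ 2) := ⟨_, rfl⟩
  obtain ⟨C, hC⟩ : ∃ C, C = (B * s + 1) ^ t := ⟨_, rfl⟩
  have hC1 : 1 ≤ C := hC ▸ Nat.one_le_pow _ _ (by omega)
  refine ⟨(2 * t * s + (t + 1) * (t * C)) * s + B, fun V _ G hn hN => ?_⟩
  obtain ⟨a, r₁, r₂, W, _, R, h1, h2, h3, h4, h5, h6⟩ := h₀ V G hN
  rw [← coeff_matchingSeries, h2, h1, cliqueSeries_mul_add (by omega)]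
  rcases Nat.lt_or_ge B (Fintype.card W) with h7 | h7
  · rw [PowerSeries.coeff_mul, PowerSeries.coeff_mul]
    refine Finset.sum_le_sum fun p hp => Nat.mul_le_mul_left _ ?_
    rw [coeff_matchingSeries]
    refine numMatchings_le_coeff_cliqueSeries hs h3 h4 h5 h6 (hB ▸ h7) ?_
    have := Finset.HasAntidiagonal.mem_antidiagonal.1 hp
    omega
  -- Here the remainder has at most `B` vertices, so the order forces many copies of K_s. Each has
  -- an edge, and the choice of n₀ makes every coefficient at least tC times the preceding one.
  have ha : 2 * t * s + (t + 1) * (t * C) ≤ a := by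
    refine Nat.le_of_mul_le_mul_right (c := s) ?_ (by omega)
    omega
  have hP : ∀ j < t, t * C * PowerSeries.coeff j
      ((⊤ : SimpleGraph (Fin s)).matchingSeries ^ a) ≤ PowerSeries.coeff (j + 1)
      ((⊤ : SimpleGraph (Fin s)).matchingSeries ^ a) := by
    intro j hj
    have hdeg := degIn_cliqueUnion_le (a := a) (s := s) (b := 0) (by omega)
    have hmul := mul_le_succ_mul_numMatchings _ hdeg j
    simp only [← coeff_top_pow] at hmul
    have hone := ((degreeData_top s).pow a).one
    have hge : a ≤ PowerSeries.coeff 1 ((⊤ : SimpleGraph (Fin s)).matchingSeries ^ a) := by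
      have : 2 ≤ s * (s - 1) := by
        calc 2 = 2 * 1 := rfl
          _ ≤ s * (s - 1) := Nat.mul_le_mul hs (by omega)
      nlinarith
    have hj2 : 2 * j * s ≤ 2 * t * s := by gcongr
    have hge' : (j + 1) * (t * C) ≤
        PowerSeries.coeff 1 ((⊤ : SimpleGraph (Fin s)).matchingSeries ^ a) - 2 * j * s := by
      have : (j + 1) * (t * C) ≤ (t + 1) * (t * C) := by gcongr
      omega
    have := (Nat.mul_le_mul_left _ hge').trans hmul
    refine Nat.le_of_mul_le_mul_left (c := j + 1) ?_ (by omega)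
    refine le_trans (le_of_eq ?_) this
    ring
  -- A remainder on at most `B` vertices has at most Bs edges. The added one in `C` keeps the base
  -- positive, so that its powers increase with the exponent.
  have hfC : ∀ i ≤ t, PowerSeries.coeff i R.matchingSeries ≤ C := by
    intro i hi
    rw [coeff_matchingSeries, hC]
    refine (Nat.le_mul_of_pos_left _ i.factorial_pos).trans
      ((R.factorial_mul_numMatchings_le i).trans ((Nat.pow_le_pow_left ?_ i).trans
        (Nat.pow_le_pow_right (by omega) hi)))
    have g1 : R.numMatchings 1 ≤ PowerSeries.coeff 1 (cliqueSeries s (Fintype.card W)) := by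
      rw [← coeff_matchingSeries]
      rcases h3 with h | h
      · exact h.le
      · exact h.1.le
    have g2 := (degreeData_cliqueSeries s (Fintype.card W)).one
    have g3 := cliqueDegSum_le s (Fintype.card W) (by omega)
    have g4 : Fintype.card W * (s - 1) ≤ B * s := Nat.mul_le_mul h7 (Nat.sub_le _ _)
    omega
  have hz : PowerSeries.coeff 0 R.matchingSeries ≤
      PowerSeries.coeff 0 (cliqueSeries s (Fintype.card W)) := by
    rw [(degreeData_matchingSeries R).zero, (degreeData_cliqueSeries _ _).zero]
  rcases h3 with h | ⟨h, h' | h'⟩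
  · refine coeff_mul_le_of_lex hC1 hP (m := 1) (fun i hi => ?_) h hfC
    obtain rfl : i = 0 := by omega
    exact hz
  · refine coeff_mul_le_of_lex hC1 hP (m := 2) (fun i hi => ?_) h' hfC
    obtain rfl | rfl : i = 0 ∨ i = 1 := by omega
    · exact hz
    · exact h.le
  · rw [PowerSeries.coeff_mul, PowerSeries.coeff_mul]
    exact Finset.sum_le_sum fun p _ => Nat.mul_le_mul_left _ (h' _)

end SimpleGraph

end

/-! ### Copies as matchings, and paths in cliques -/

section
namespace SimpleGraph

variable {V : Type*} {G : SimpleGraph V}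

section matchingGraph

variable {t : ℕ}

lemma mem_edgeSet_toSubgraph (f : Copy (matchingGraph t) G) {e : Sym2 V} :
    e ∈ f.toSubgraph.edgeSet ↔ ∃ i, e = s(f (i, 0), f (i, 1)) := by
  rw [Copy.toSubgraph, Subgraph.edgeSet_map]
  constructor
  · rintro ⟨e, he, rfl⟩
    induction e using Sym2.ind with
    | _ x y =>
      obtain ⟨i, j⟩ := x
      obtain ⟨i', j'⟩ := y
      obtain ⟨rfl, hj⟩ : i = i' ∧ j ≠ j' := he
      refine ⟨i, ?_⟩
      fin_cases j <;> fin_cases j' <;> first | exact absurd rfl hj | rfl | exact Sym2.eq_swap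
  · rintro ⟨i, rfl⟩
    exact ⟨s((i, 0), (i, 1)), ⟨rfl, zero_ne_one⟩, rfl⟩

lemma mem_verts_toSubgraph (f : Copy (matchingGraph t) G) {v : V} :
    v ∈ f.toSubgraph.verts ↔ ∃ e ∈ f.toSubgraph.edgeSet, v ∈ e := by
  constructor
  · rintro ⟨⟨i, j⟩, -, rfl⟩
    refine ⟨_, (mem_edgeSet_toSubgraph f).2 ⟨i, rfl⟩, ?_⟩
    fin_cases j
    · exact Sym2.mem_mk_left _ _
    · exact Sym2.mem_mk_right _ _
  · rintro ⟨e, he, hv⟩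
    exact Subgraph.mem_verts_of_mem_edge he hv

/-- The copies of the matching with `t` edges correspond to the matchings with `t` edges. -/
lemma copyCount_matchingGraph [Fintype V] (G : SimpleGraph V) (t : ℕ) :
    G.copyCount (matchingGraph t) = G.numMatchings t := by
  have : Fintype {f : matchingGraph t →g G // Function.Injective f} := Fintype.ofFinite _
  rw [copyCount_eq_card_image_copyToSubgraph, numMatchings]
  refine Finset.card_nbij (fun S => Finset.univ.filter fun e => e ∈ S.edgeSet) ?_ ?_ ?_
  · intro S hS
    obtain ⟨f, -, rfl⟩ := Finset.mem_image.1 hS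
    rw [Finset.mem_coe, mem_matchingFinset]
    refine ⟨fun e he => f.toSubgraph.edgeSet_subset (Finset.mem_filter.1 he).2, ?_, ?_⟩
    · have : (Finset.univ.filter fun e => e ∈ f.toSubgraph.edgeSet) =
          Finset.univ.image fun i => s(f (i, 0), f (i, 1)) := by
        ext e
        simp only [Finset.mem_filter, Finset.mem_univ, true_and, Finset.mem_image,
          mem_edgeSet_toSubgraph, eq_comm]
      change Finset.card (Finset.univ.filter fun e => e ∈ f.toSubgraph.edgeSet) = t
      rw [this, Finset.card_image_of_injective, Finset.card_univ, Fintype.card_fin]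
      intro i i' h
      have h' : f (i, 0) ∈ s(f (i', 0), f (i', 1)) := by
        rw [← show s(f (i, 0), f (i, 1)) = s(f (i', 0), f (i', 1)) from h]
        exact Sym2.mem_mk_left _ _
      rcases Sym2.mem_iff.1 h' with h' | h'
      · exact congrArg Prod.fst (f.injective h')
      · exact congrArg Prod.fst (f.injective h')
    · intro e he e' he' hne v hv hv'
      obtain ⟨i, rfl⟩ := (mem_edgeSet_toSubgraph f).1 (Finset.mem_filter.1 he).2
      obtain ⟨i', rfl⟩ := (mem_edgeSet_toSubgraph f).1 (Finset.mem_filter.1 he').2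
      have hi : i ≠ i' := by rintro rfl; exact hne rfl
      rcases Sym2.mem_iff.1 hv with rfl | rfl <;> rcases Sym2.mem_iff.1 hv' with h | h <;>
        exact hi (congrArg Prod.fst (f.injective h))
  · intro S hS S' hS' h
    obtain ⟨f, -, rfl⟩ := Finset.mem_image.1 hS
    obtain ⟨g, -, rfl⟩ := Finset.mem_image.1 hS'
    have hE : ∀ e, e ∈ f.toSubgraph.edgeSet ↔ e ∈ g.toSubgraph.edgeSet := fun e => by
      have := Finset.ext_iff.1 h e
      simpa using this
    apply Subgraph.ext
    · ext v
      rw [mem_verts_toSubgraph, mem_verts_toSubgraph]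
      simp only [hE]
    · ext v w
      rw [← Subgraph.mem_edgeSet, ← Subgraph.mem_edgeSet, hE]
  · intro M hM
    obtain ⟨hMG, hMt, hMd⟩ := (mem_matchingFinset G).1 hM
    obtain ⟨φ⟩ : Nonempty (Fin t ≃ M) := ⟨(M.equivFinOfCardEq hMt).symm⟩
    have hex : ∀ e : Sym2 V, ∃ p : V × V, e = s(p.1, p.2) := fun e => by
      induction e using Sym2.ind with
      | _ a b => exact ⟨(a, b), rfl⟩
    choose p hp using hex
    have hadj : ∀ i, G.Adj (p (φ i)).1 (p (φ i)).2 := fun i => by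
      have := hMG _ (φ i).2
      rw [hp (φ i)] at this
      exact this
    let F : Fin t × Fin 2 → V := fun x => if x.2 = 0 then (p (φ x.1)).1 else (p (φ x.1)).2
    have hF : ∀ x, F x ∈ (φ x.1 : Sym2 V) := by
      intro x
      rw [hp (φ x.1)]
      simp only [F]
      split_ifs
      · exact Sym2.mem_mk_left _ _
      · exact Sym2.mem_mk_right _ _
    let f : Copy (matchingGraph t) G := ⟨⟨F, by
      rintro ⟨i, j⟩ ⟨i', j'⟩ ⟨hi, hj⟩
      obtain rfl : i = i' := hi
      have hj : j ≠ j' := hj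
      fin_cases j <;> fin_cases j' <;>
        first | exact absurd rfl hj | exact hadj i | exact (hadj i).symm⟩, by
      rintro ⟨i, j⟩ ⟨i', j'⟩ h
      have h : F (i, j) = F (i', j') := h
      by_cases hi : i = i'
      · subst hi
        fin_cases j <;> fin_cases j' <;>
          first | rfl | exact absurd h (hadj i).ne | exact absurd h (hadj i).ne'
      · exact absurd (h ▸ hF (i', j')) (hMd _ (φ i).2 _ (φ i').2
          (fun h => hi (φ.injective (Subtype.ext h))) _ (hF (i, j)))⟩
    refine ⟨f.toSubgraph, Finset.mem_coe.2 (Finset.mem_image_of_mem _ (Finset.mem_univ f)), ?_⟩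
    ext e
    simp only [Finset.mem_filter, Finset.mem_univ, true_and, mem_edgeSet_toSubgraph]
    have hfe : ∀ i, s(f (i, 0), f (i, 1)) = (φ i : Sym2 V) := fun i => (hp (φ i)).symm
    constructor
    · rintro ⟨i, rfl⟩
      rw [hfe]
      exact (φ i).2
    · intro he
      exact ⟨φ.symm ⟨e, he⟩, by rw [hfe, Equiv.apply_symm_apply]⟩

end matchingGraph

lemma noPath_of_free {N : ℕ} (h : (pathGraph N).Free G) : NoPath G N := by
  intro l hl hc
  by_contra! hN
  refine h ⟨⟨⟨fun i => l[i.1]'(i.2.trans_le hN), ?_⟩, ?_⟩⟩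
  · intro i j hij
    rcases pathGraph_adj.1 hij with h | h
    · have := List.isChain_iff_getElem.1 hc i.1 (by omega)
      simpa [h] using this
    · have := List.isChain_iff_getElem.1 hc j.1 (by omega)
      simpa [h] using this.symm
  · intro i j hij
    exact Fin.ext ((hl.getElem_inj_iff).1 hij)

/-- The colouring `c` names the clique of a vertex and is constant along edges, so a path stays
within one clique, and each clique has fewer than `k` vertices. -/
lemma pathGraph_free_cliqueUnion {a b k : ℕ} (hb : b < k) :
    (pathGraph k).Free (cliqueUnion a (k - 1) b) := by
  rintro ⟨f⟩
  let c : (Fin a × Fin (k - 1)) ⊕ Fin b → Option (Fin a) := Sum.elim (fun x => some x.1) fun _ => none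
  have hc : ∀ x y, (cliqueUnion a (k - 1) b).Adj x y → c x = c y := by
    rintro (x | x) (y | y) h
    · exact congrArg some h.1
    · exact absurd h (by simp [cliqueUnion])
    · exact absurd h (by simp [cliqueUnion])
    · rfl
  have hconst : ∀ i (hi : i < k), c (f ⟨i, hi⟩) = c (f ⟨0, by omega⟩) := by
    intro i
    induction i with
    | zero => exact fun _ => rfl
    | succ i ih =>
      intro hi
      rw [← ih (by omega)]
      refine (hc _ _ (f.toHom.map_adj ?_)).symm
      rw [pathGraph_adj]
      exact Or.inl rfl
  rcases h0 : c (f ⟨0, by omega⟩) with _ | j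
  · have h : ∀ i, ∃ y, f i = Sum.inr y := by
      intro i
      have := (hconst i.1 i.2).trans h0
      rcases hfi : f i with x | y
      · simp [hfi, c] at this
      · exact ⟨y, rfl⟩
    choose g hg using h
    have := Fintype.card_le_of_injective g fun i i' hii => f.injective (by
      change f i = f i'
      rw [hg, hg, hii])
    simp at this
    omega
  · have h : ∀ i, ∃ y, f i = Sum.inl (j, y) := by
      intro i
      have := (hconst i.1 i.2).trans h0
      rcases hfi : f i with ⟨x, y⟩ | y
      · simp only [Fin.eta, hfi, c, Sum.elim_inl, Option.some.injEq] at this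
        exact ⟨y, by rw [this]⟩
      · simp [hfi, c] at this
    choose g hg using h
    have := Fintype.card_le_of_injective g fun i i' hii => f.injective (by
      change f i = f i'
      rw [hg, hg, hii])
    simp at this
    omega

/-- The value b = s is included: the last clique is then a further full one, although the remainder
modulo `s` is zero. -/
lemma coeff_cliqueSeries_mul_add {a s b : ℕ} (hs : 0 < s) (hb : b ≤ s) (t : ℕ) :
    PowerSeries.coeff t (cliqueSeries s (a * s + b)) = (cliqueUnion a s b).numMatchings t := by
  rw [cliqueSeries_mul_add hs, cliqueSeries_of_le hs hb, ← matchingSeries_cliqueUnion,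
    coeff_matchingSeries]

/-- Among the large graphs without a path on `k` vertices, the union of cliques on `k - 1` vertices
has the largest number of matchings of a given size. -/
theorem exists_forall_numMatchings_le_cliqueUnion (k t : ℕ) : ∃ n₀, ∀ n a b : ℕ, n₀ ≤ n →
    n = a * (k - 1) + b → b < k → ∀ G : SimpleGraph (Fin n), (pathGraph k).Free G →
      G.numMatchings t ≤ (cliqueUnion a (k - 1) b).numMatchings t := by
  rcases Nat.lt_or_ge k 3 with hk | hk
  · refine ⟨1, fun n a b hn hnab hb G hG => ?_⟩
    -- For k = 1 there are no vertices, which n ≥ 1 excludes; for k = 2 the graph has no edges.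
    obtain rfl : k = 2 := by
      rcases Nat.lt_or_ge k 2 with h | h
      · obtain ⟨rfl, rfl⟩ : k = 1 ∧ b = 0 := by omega
        simp at hnab
        omega
      · omega
    match t with
    | 0 => rw [numMatchings_zero, numMatchings_zero]
    | i + 1 =>
      have h1 := (noPath_of_free hG).degSumIn_le le_rfl
      have h2 := G.two_mul_numMatchings_one
      have h3 := G.succ_mul_numMatchings_le i
      rw [show G.numMatchings 1 = 0 by omega, mul_zero, Nat.le_zero, mul_eq_zero] at h3
      rw [h3.resolve_left (by omega)]
      exact Nat.zero_le _
  · obtain ⟨s, rfl⟩ : ∃ s, k = s + 1 := ⟨k - 1, by omega⟩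
    obtain ⟨n₀, h⟩ := exists_forall_numMatchings_le (s := s) (by omega) t
    refine ⟨n₀, fun n a b hn hnab hb G hG => ?_⟩
    have := h (Fin n) G (by simpa using hn) (noPath_of_free hG)
    rw [Fintype.card_fin] at this
    rw [Nat.add_sub_cancel] at hnab ⊢
    rwa [← coeff_cliqueSeries_mul_add (by omega) (by omega), ← hnab]

end SimpleGraph

end

end

theorem mainTheorem1 (k t : ℕ) :
    ∃ n₀ : ℕ, ∀ n a b : ℕ, n₀ ≤ n → n = a * (k - 1) + b → b < k →
      (SimpleGraph.pathGraph k).Free (cliqueUnion a (k - 1) b) ∧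
      generalizedTuranNumber n (matchingGraph t) (SimpleGraph.pathGraph k) =
        (cliqueUnion a (k - 1) b).copyCount (matchingGraph t) := by
  classical
  obtain ⟨n₀, h⟩ := SimpleGraph.exists_forall_numMatchings_le_cliqueUnion k t
  refine ⟨n₀, fun n a b hn hnab hb => ?_⟩
  have hfree := SimpleGraph.pathGraph_free_cliqueUnion (a := a) hb
  unfold generalizedTuranNumber
  refine ⟨hfree, le_antisymm (Finset.sup_le fun G hG => ?_) ?_⟩
  · rw [SimpleGraph.copyCount_matchingGraph, SimpleGraph.copyCount_matchingGraph]
    exact h n a b hn hnab hb G (Finset.mem_filter.1 hG).2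
  -- The supremum ranges over graphs on `Fin n`, so the union of cliques is transported there to
  -- serve as a competitor.
  · let φ : (Fin a × Fin (k - 1)) ⊕ Fin b ≃ Fin n :=
      Fintype.equivOfCardEq (by simp [hnab])
    let T := (cliqueUnion a (k - 1) b).map φ.toEmbedding
    have f : cliqueUnion a (k - 1) b ≃g T := SimpleGraph.Iso.map φ _
    rw [SimpleGraph.copyCount_matchingGraph, SimpleGraph.numMatchings_eq_of_iso f,
      ← SimpleGraph.copyCount_matchingGraph]
    refine Finset.le_sup (f := fun G : SimpleGraph (Fin n) => G.copyCount (matchingGraph t)) ?_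
    exact Finset.mem_filter.2 ⟨Finset.mem_univ _, (SimpleGraph.free_congr_right f).1 hfree⟩
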